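/- Let $M$ be a Riemann surface and let $y:M\to\mathbb{S}^4\subset\mathbb{R}^5$ be a smooth conformal immersion. **Invariants.** Let $\langle v,w\rangle=-v_0w_0+\sum_{i=1}^5 v_iw_i$ be the Lorentz form on $\mathbb{R}^{5,1}$, extended complex bilinearly. In a local complex coordinate $z$ let $Y$ be the positive multiple of $(1,y)$ with $\langle Y_z,Y_{\bar z}\rangle=\tfrac12$. Let $V=\mathrm{span}\{Y,\mathrm{Re}\,Y_z,\mathrm{Im}\,Y_z,Y_{z\bar z}\}$ be the mean curvature sphere bundle, let $D$ be the normal connection on $V^\perp$ (the $V^\perp$-component of the derivative), and let $\kappa$ be the $V^\perp\otimes\mathbb{C}$-component of $Y_{zz}$. Umbilic points are the zeros of $\kappa$, and $y$ is *isotropic* if $\langle\kappa,\kappa\rangle\equiv0$; these notions do not depend on $z$. If there are no umbilic points, the Möbius metric is $e^{2\omega}|dz|^2=4\langle\kappa,\bar\kappa\rangle|dz|^2$, with Gauss curvature (the Möbius curvature) $\mathcal{K}=-4e^{-2\omega}\omega_{z\bar z}$. If moreover $y$ is isotropic, then $D_{\bar z}\kappa$ is a multiple of $\kappa$; define $\mu$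 by $D_{\bar z}\kappa+\tfrac{\bar\mu}{2}\kappa=0$ and put $\rho=\bar\mu_z-2\langle\kappa,\bar\kappa\rangle$ and $\mathcal{P}=\rho/\langle\kappa,\bar\kappa\rangle$. The functions $\mathcal{K}:M\to\mathbb{R}$ and $\mathcal{P}:M\to\mathbb{C}$ do not depend on $z$. A Möbius transformation of $\mathbb{S}^4$ is a map induced, via $x\leftrightarrow[1,x]$, by a linear isometry of $\mathbb{R}^{5,1}$. The Veronese sphere is the immersion $\mathbb{S}^2\to\mathbb{S}^4$, $$(a,b,c)\mapsto\Big(\sqrt3\,bc,\ \sqrt3\,ac,\ \sqrt3\,ab,\ \tfrac{\sqrt3}{2}(a^2-b^2),\ \tfrac12(a^2+b^2-2c^2)\Big).$$ **Theorem.** Let $y:M\to\mathbb{S}^4$ be an isotropic surface without umbilic points. Then the following three conditions are equivalent: 1. $|\mathcal{P}|$ is a non-zero constant on $M$; 2. $\mathcal{K}\equiv\tfrac12$ on $M$; 3. $y$ is locally Möbius equivalent to the Veronese sphere, i.e. every point of $M$ has an open neighbourhood on which $y$, followed by some Möbius transformation of $\mathbb{S}^4$, equals the Veronese sphere composed with a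 smooth map into $\mathbb{S}^2$ (necessarily a local diffeomorphism). Moreover, if these conditions hold, then $\mathcal{P}\equiv-3$ on $M$. -/

import Mathlib

open scoped Manifold ContDiff

namespace MoebiusGeometry

noncomputable section

/-- The round unit sphere of dimension 4 in Euclidean 5-space. -/
abbrev S4 : Type := Metric.sphere (0 : EuclideanSpace ℝ (Fin 5)) 1

/-- The round unit sphere of dimension 2 in Euclidean 3-space. -/
abbrev S2 : Type := Metric.sphere (0 : EuclideanSpace ℝ (Fin 3)) 1

/-! ### Minkowski space, the light cone and Moebius transformations -/

/-- The Lorentz form `-v₀w₀ + v₁w₁ + ... + v₅w₅`. For `R = ℝ` this is the form of 6-dimensional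
Minkowski space, for `R = ℂ` it is the complex bilinear extension of that form. -/
def lorentz {R : Type*} [CommRing R] (v w : Fin 6 → R) : R :=
  -(v 0 * w 0) + ∑ i : Fin 5, v i.succ * w i.succ

/-- The light-like vector `(1, x)` attached to a point `x`. -/
def lightVec (x : EuclideanSpace ℝ (Fin 5)) : Fin 6 → ℝ :=
  Fin.cons 1 (fun i => x i)

/-- A Moebius transformation of the 4-sphere: the map induced, under `x ↔ [1, x]`, by a linear map
of Minkowski space that preserves the Lorentz form. -/
def IsMoebius (T : S4 → S4) : Prop :=
  ∃ A : (Fin 6 → ℝ) →ₗ[ℝ] (Fin 6 → ℝ),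
    (∀ v w, lorentz (A v) (A w) = lorentz v w) ∧
    ∀ x : S4, ∃ r : ℝ, r ≠ 0 ∧ A (lightVec x) = r • lightVec (T x)

/-! ### Wirtinger derivatives -/

/-- `∂F/∂z = (∂F/∂x - i ∂F/∂y) / 2`. -/
def dz {W : Type*} [NormedAddCommGroup W] [NormedSpace ℝ W] [NormedSpace ℂ W]
    (F : ℂ → W) (z : ℂ) : W :=
  (1 / 2 : ℂ) • (fderiv ℝ F z 1 - Complex.I • fderiv ℝ F z Complex.I)

/-- `∂F/∂z̄ = (∂F/∂x + i ∂F/∂y) / 2`. -/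
def dzbar {W : Type*} [NormedAddCommGroup W] [NormedSpace ℝ W] [NormedSpace ℂ W]
    (F : ℂ → W) (z : ℂ) : W :=
  (1 / 2 : ℂ) • (fderiv ℝ F z 1 + Complex.I • fderiv ℝ F z Complex.I)

/-! ### Moebius invariants of a conformal map `u`, defined on an open subset of the plane

Throughout, `u` is a local expression of a surface in a complex coordinate `z`. Vectors live in
the complexified Minkowski space `Fin 6 → ℂ`, where `star` is complex conjugation. -/

/-- The lift `(1, u)` of `u` into the light cone. -/
def lightLift (u : ℂ → EuclideanSpace ℝ (Fin 5)) (z : ℂ) : Fin 6 → ℂ :=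
  fun i => (lightVec (u z) i : ℂ)

/-- The canonical lift `Y`: the positive multiple of `F = (1, u)` with `|dY|² = |dz|²`, that is
with `⟨Y_z, Y_z̄⟩ = 1/2`. -/
def canLift (u : ℂ → EuclideanSpace ℝ (Fin 5)) (z : ℂ) : Fin 6 → ℂ :=
  ((Real.sqrt (2 * (lorentz (dz (lightLift u) z) (dzbar (lightLift u) z)).re))⁻¹ : ℂ) •
    lightLift u z

/-- The section `N` of the mean curvature sphere bundle `V = span {Y, Y_z, Y_z̄, Y_zz̄}` with
`⟨N, N⟩ = 0`, `⟨N, Y⟩ = -1`, `⟨N, Y_z⟩ = 0`. -/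
def frameN (u : ℂ → EuclideanSpace ℝ (Fin 5)) (z : ℂ) : Fin 6 → ℂ :=
  let Yzz' : Fin 6 → ℂ := dzbar (dz (canLift u)) z
  (2 : ℂ) • (Yzz' + lorentz Yzz' Yzz' • canLift u z)

/-- The component in `V^⊥ ⊗ ℂ` of a vector at the point with coordinate `z`, written in the frame
`Y, Y_z, Y_z̄, N` of `V ⊗ ℂ`, whose only non-zero products are `⟨Y_z, Y_z̄⟩ = 1/2`,
`⟨Y, N⟩ = -1`. -/
def normalPart (u : ℂ → EuclideanSpace ℝ (Fin 5)) (z : ℂ) (v : Fin 6 → ℂ) : Fin 6 → ℂ :=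
  let Y : Fin 6 → ℂ := canLift u z
  let Yz : Fin 6 → ℂ := dz (canLift u) z
  let Yz' : Fin 6 → ℂ := dzbar (canLift u) z
  let N : Fin 6 → ℂ := frameN u z
  v - ((-lorentz v N) • Y + (-lorentz v Y) • N
    + (2 * lorentz v Yz') • Yz + (2 * lorentz v Yz) • Yz')

/-- The Hopf differential `κ` with values in `V^⊥ ⊗ ℂ`: the normal component of `Y_zz`. -/
def kappa (u : ℂ → EuclideanSpace ℝ (Fin 5)) (z : ℂ) : Fin 6 → ℂ :=
  normalPart u z (dz (dz (canLift u)) z)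

/-- `D_z̄ κ`, where `D` is the normal connection, i.e. the normal component of the derivative. -/
def DzbarKappa (u : ℂ → EuclideanSpace ℝ (Fin 5)) (z : ℂ) : Fin 6 → ℂ :=
  normalPart u z (dzbar (kappa u) z)

/-- The real number `⟨κ, κ̄⟩`. -/
def kappaSq (u : ℂ → EuclideanSpace ℝ (Fin 5)) (z : ℂ) : ℝ :=
  (lorentz (kappa u z) (star (kappa u z))).re

/-- `ω`, where `e^{2ω} |dz|² = 4 ⟨κ, κ̄⟩ |dz|²` is the Moebius metric. -/
def omegaFun (u : ℂ → EuclideanSpace ℝ (Fin 5)) (z : ℂ) : ℝ :=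
  Real.log (4 * kappaSq u z) / 2

/-- The Moebius curvature `K = -4 e^{-2ω} ω_zz̄`: the Gauss curvature of the Moebius metric. -/
def moebiusCurvature (u : ℂ → EuclideanSpace ℝ (Fin 5)) (z : ℂ) : ℝ :=
  -4 * Real.exp (-2 * omegaFun u z) *
    (dzbar (dz (fun w => (omegaFun u w : ℂ))) z).re

/-- `μ̄`, where `μ` is determined by `D_z̄ κ + (μ̄ / 2) κ = 0`. The equation is solvable whenever
`D_z̄ κ` is a multiple of `κ ≠ 0` (as for isotropic surfaces), and then its solution is the quotient
below, see `muBar_eq`. -/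
def muBar (u : ℂ → EuclideanSpace ℝ (Fin 5)) (z : ℂ) : ℂ :=
  -2 * lorentz (DzbarKappa u z) (star (kappa u z)) / lorentz (kappa u z) (star (kappa u z))

theorem lorentz_smul_left {R : Type*} [CommRing R] (a : R) (v w : Fin 6 → R) :
    lorentz (a • v) w = a * lorentz v w := by
  simp only [lorentz, Pi.smul_apply, smul_eq_mul, mul_add, Finset.mul_sum]
  congr 1
  · ring
  · exact Finset.sum_congr rfl fun i _ => by ring

theorem muBar_eq (u : ℂ → EuclideanSpace ℝ (Fin 5)) (z m : ℂ)
    (hk : lorentz (kappa u z) (star (kappa u z)) ≠ 0)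
    (h : DzbarKappa u z + (m / 2) • kappa u z = 0) : muBar u z = m := by
  have h' : DzbarKappa u z = (-(m / 2)) • kappa u z := by
    rw [neg_smul]; exact eq_neg_of_add_eq_zero_left h
  rw [muBar, h', lorentz_smul_left]
  field_simp

/-- `ρ = μ̄_z - 2 ⟨κ, κ̄⟩`. -/
def rho (u : ℂ → EuclideanSpace ℝ (Fin 5)) (z : ℂ) : ℂ :=
  dz (muBar u) z - 2 * lorentz (kappa u z) (star (kappa u z))

/-- The invariant `P = ρ / ⟨κ, κ̄⟩`. -/
def invP (u : ℂ → EuclideanSpace ℝ (Fin 5)) (z : ℂ) : ℂ :=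
  rho u z / lorentz (kappa u z) (star (kappa u z))

/-! ### Surfaces in the 4-sphere -/

section Surface

variable {M : Type*} [TopologicalSpace M] [ChartedSpace ℂ M]

/-- The local expression of `y` in the coordinate `e`, as a map into Euclidean 5-space. -/
def localExpr (y : M → S4) (e : OpenPartialHomeomorph M ℂ) (z : ℂ) :
    EuclideanSpace ℝ (Fin 5) :=
  (y (e.symm z) : EuclideanSpace ℝ (Fin 5))

/-- `Q u z` holds at all points of the surface `y`, for its expression `u` in every holomorphic
coordinate `z`. It is used for conditions that do not depend on the coordinate. -/
def InCoordinates (y : M → S4) (Q : (ℂ → EuclideanSpace ℝ (Fin 5)) → ℂ → Prop) : Prop :=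
  ∀ e ∈ IsManifold.maximalAtlas 𝓘(ℂ) ω M, ∀ z ∈ e.target, Q (localExpr y e) z

/-- A smooth conformal immersion of a Riemann surface into the 4-sphere. Conformality at a point
(the differential is a non-zero multiple of a linear isometry) includes being immersed there. -/
structure IsConformalImmersion (y : M → S4) : Prop where
  smooth : ContMDiff 𝓘(ℝ, ℂ) 𝓘(ℝ, EuclideanSpace ℝ (Fin 5)) ∞
    (fun p => (y p : EuclideanSpace ℝ (Fin 5)))
  conformal : InCoordinates y (fun u z => ConformalAt u z)

/-- The surface is isotropic: `⟨κ, κ⟩ = 0`. -/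
def IsIsotropic (y : M → S4) : Prop :=
  InCoordinates y (fun u z => lorentz (kappa u z) (kappa u z) = 0)

/-- The surface has no umbilic points: `κ` has no zeros. -/
def HasNoUmbilics (y : M → S4) : Prop :=
  InCoordinates y (fun u z => kappa u z ≠ 0)

end Surface

/-! ### The Veronese surface -/

/-- `(a, b, c) ↦ (√3 bc, √3 ac, √3 ab, √3 (a² - b²)/2, (a² + b² - 2c²)/2)`. -/
def veroneseVec (x : EuclideanSpace ℝ (Fin 3)) : EuclideanSpace ℝ (Fin 5) :=
  !₂[√3 * (x 1 * x 2), √3 * (x 0 * x 2), √3 * (x 0 * x 1),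
    √3 * (x 0 ^ 2 - x 1 ^ 2) / 2, (x 0 ^ 2 + x 1 ^ 2 - 2 * x 2 ^ 2) / 2]

theorem veroneseVec_mem (x : S2) :
    veroneseVec x ∈ Metric.sphere (0 : EuclideanSpace ℝ (Fin 5)) 1 := by
  obtain ⟨x, hx⟩ := x
  have hx1 : ‖x‖ = 1 := by simpa using hx
  have hx2 : x 0 ^ 2 + x 1 ^ 2 + x 2 ^ 2 = 1 := by
    have h := EuclideanSpace.real_norm_sq_eq x
    rw [hx1, Fin.sum_univ_three] at h
    linarith
  have h3 : √3 ^ 2 = (3 : ℝ) := Real.sq_sqrt (by norm_num)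
  have hn : ‖veroneseVec x‖ ^ 2 = 1 := by
    rw [EuclideanSpace.real_norm_sq_eq, Fin.sum_univ_five]
    simp only [veroneseVec, PiLp.toLp_apply, Matrix.cons_val]
    have : x 2 ^ 2 = 1 - x 0 ^ 2 - x 1 ^ 2 := by linarith
    ring_nf
    simp only [h3, this, show x 2 ^ 4 = (x 2 ^ 2) ^ 2 by ring]
    ring
  have : ‖veroneseVec x‖ = 1 := by
    rw [← Real.sqrt_sq (norm_nonneg (veroneseVec x)), hn, Real.sqrt_one]
  simpa using this

/-- The Veronese sphere, as an immersion of the 2-sphere into the 4-sphere. -/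
def veronese (x : S2) : S4 := ⟨veroneseVec x, veroneseVec_mem x⟩

/-- Locally, `y` is Moebius equivalent to the Veronese sphere: near every point there are a Moebius
transformation `T` and a smooth map `ψ` into the 2-sphere with `T ∘ y = veronese ∘ ψ`. As `T ∘ y` is
an immersion of a surface, so is `ψ`: it is a local diffeomorphism (a change of parameters). -/
def IsLocallyVeronese {M : Type*} [TopologicalSpace M] [ChartedSpace ℂ M] (y : M → S4) : Prop :=
  ∀ p : M, ∃ U : Set M, IsOpen U ∧ p ∈ U ∧ ∃ T : S4 → S4, IsMoebius T ∧ ∃ ψ : M → S2,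
    ContMDiffOn 𝓘(ℝ, ℂ) 𝓘(ℝ, EuclideanSpace ℝ (Fin 3)) ∞
      (fun q => (ψ q : EuclideanSpace ℝ (Fin 3))) U ∧
    ∀ q ∈ U, T (y q) = veronese (ψ q)

end

end MoebiusGeometry

/-! Isotropy makes `κ` null, so `Y, N, Y_z, Y_z̄, κ, κ̄` is a frame of null vectors of `ℂ⁶` and its
derivatives are determined by inner products. Write `k = ⟨κ, κ̄⟩`, `l = (log k)_z` and let `d` be
`halfSchwarzian`. The compatibility conditions are `d_z̄ = (l - μ) k` (Gauss), `2d = μ_z - μ²/2`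
(Codazzi) and `l_z̄ + Re μ_z̄ = -2k` (Ricci). Eliminating `d` gives `r_z = μ r` for `r = μ_z̄ - 2k`,
the conjugate of `ρ`. Since `𝒦 = -l_z̄ / (2k)`, condition 2 says `l_z̄ = -k`.

From 1 to 2 (`dzbar_l_of_normSq`): if `|r| = c k`, the logarithmic derivatives of `r` are `μ` and `2
l̄ - μ̄`. Their compatibility gives `Re μ_z̄ = l_z̄`, and Ricci finishes.

Condition 2 forces `𝒫 = -3` and `μ = l` (`defect_eq_zero`): Ricci gives `r = -(3 + iH) k` with `H`
real. Commuting derivatives of `H` yields `3 |μ - l|² = k H²`. Where `H ≠ 0`, this relation fixes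
all first derivatives of `μ - l`, and these are incompatible. Hence `H = 0`.

From 2 to 3 (`frameSystem`, `exists_veronese`): with `μ = l` and `μ_z̄ = -k`, suitable multiples of
the lift and the frame satisfy the linear system of `ver ψ ψ` for a conformal `ψ` into the 2-sphere.
A Lorentz isometry matches the two frames at one point, and uniqueness for linear ODEs along rays
puts the transformed lift on the Veronese cone. A smooth `ψ` is then recovered by the explicit
inverse `verPole`.

From 3 back (`isSpherePatch`, `dzbar_dlog`): if an isometry takes `Y` to a multiple of `ver ψ ψ`,
then `ψ` is conformal and `k = ⟨ψ_z, ψ_z̄⟩`. The round sphere has curvature 1, which reads `(log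
k)_zz̄ = -k`. Hence `𝒫 = -3`, and in particular `|𝒫| = 3`. -/

namespace MoebiusGeometry

open Filter Topology

/-! ### Wirtinger calculus -/

section Wirtinger

theorem I_smul_I_smul {W : Type*} [AddCommGroup W] [Module ℂ W] (p : W) :
    Complex.I • Complex.I • p = -p := by
  rw [smul_smul, Complex.I_mul_I, neg_one_smul]

theorem half_smul_add_self {W : Type*} [AddCommGroup W] [Module ℂ W] (p : W) :
    (1 / 2 : ℂ) • (p + p) = p := by
  rw [← two_smul ℂ p, smul_smul]; norm_num

variable {W : Type*} [NormedAddCommGroup W] [NormedSpace ℝ W] [NormedSpace ℂ W]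

/-- `F` is real differentiable at `z` with Wirtinger derivatives `∂F/∂z = p`, `∂F/∂z̄ = q`. -/
structure HasW (F : ℂ → W) (p q : W) (z : ℂ) : Prop where
  diff : DifferentiableAt ℝ F z
  one : fderiv ℝ F z 1 = p + q
  I : fderiv ℝ F z Complex.I = Complex.I • (p - q)

theorem HasW.dz_eq {F : ℂ → W} {p q : W} {z : ℂ} (h : HasW F p q z) : dz F z = p := by
  rw [dz, h.one, h.I, I_smul_I_smul]
  convert half_smul_add_self p using 2
  abel

theorem HasW.dzbar_eq {F : ℂ → W} {p q : W} {z : ℂ} (h : HasW F p q z) : dzbar F z = q := by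
  rw [dzbar, h.one, h.I, I_smul_I_smul]
  convert half_smul_add_self q using 2
  abel

theorem hasW_of_differentiableAt {F : ℂ → W} {z : ℂ} (h : DifferentiableAt ℝ F z) :
    HasW F (dz F z) (dzbar F z) z := by
  refine ⟨h, ?_, ?_⟩
  · rw [dz, dzbar, ← smul_add]
    symm
    convert half_smul_add_self (fderiv ℝ F z 1) using 2
    abel
  · rw [dz, dzbar, ← smul_sub]
    symm
    convert half_smul_add_self (fderiv ℝ F z Complex.I) using 1
    rw [smul_comm]
    congr 1
    rw [smul_sub, smul_sub, smul_add, I_smul_I_smul]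
    abel

/-- The engine for differentiating identities: an equation valid on an open set gives one function
two derivations (through `congr_on`), and comparing them yields the differentiated equation. -/
theorem HasW.unique {F : ℂ → W} {p q p' q' : W} {z : ℂ} (h : HasW F p q z) (h' : HasW F p' q' z) :
    p = p' ∧ q = q' :=
  ⟨h.dz_eq.symm.trans h'.dz_eq, h.dzbar_eq.symm.trans h'.dzbar_eq⟩

theorem HasW.congr_val {F : ℂ → W} {p q p' q' : W} {z : ℂ} (h : HasW F p q z) (hp : p = p')
    (hq : q = q') : HasW F p' q' z := hp ▸ hq ▸ h

theorem HasW.congr_of_eventuallyEq {F G : ℂ → W} {p q : W} {z : ℂ} (h : HasW F p q z)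
    (hFG : G =ᶠ[𝓝 z] F) : HasW G p q z :=
  ⟨h.diff.congr_of_eventuallyEq hFG, by rw [hFG.fderiv_eq, h.one], by rw [hFG.fderiv_eq, h.I]⟩

theorem HasW.congr_on {F G : ℂ → W} {p q : W} {z : ℂ} {Ω : Set ℂ} (h : HasW F p q z)
    (hΩ : IsOpen Ω) (hz : z ∈ Ω) (hFG : ∀ w ∈ Ω, G w = F w) : HasW G p q z :=
  h.congr_of_eventuallyEq (eventually_of_mem (hΩ.mem_nhds hz) hFG)

theorem hasW_const (c : W) (z : ℂ) : HasW (fun _ => c) 0 0 z :=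
  ⟨differentiableAt_const c, by simp, by simp⟩

theorem HasW.add {F G : ℂ → W} {p q p' q' : W} {z : ℂ} (hF : HasW F p q z) (hG : HasW G p' q' z) :
    HasW (fun w => F w + G w) (p + p') (q + q') z := by
  refine ⟨hF.diff.add hG.diff, ?_, ?_⟩
  · rw [fderiv_fun_add hF.diff hG.diff, add_apply, hF.one, hG.one]; abel
  · rw [fderiv_fun_add hF.diff hG.diff, add_apply, hF.I, hG.I, ← smul_add]
    congr 1; abel

theorem HasW.neg {F : ℂ → W} {p q : W} {z : ℂ} (hF : HasW F p q z) :
    HasW (fun w => -F w) (-p) (-q) z := by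
  refine ⟨hF.diff.neg, ?_, ?_⟩
  · rw [fderiv_fun_neg, neg_apply, hF.one]; abel
  · rw [fderiv_fun_neg, neg_apply, hF.I, ← smul_neg]
    congr 1; abel

theorem HasW.sub {F G : ℂ → W} {p q p' q' : W} {z : ℂ} (hF : HasW F p q z) (hG : HasW G p' q' z) :
    HasW (fun w => F w - G w) (p - p') (q - q') z := by
  simpa only [sub_eq_add_neg] using hF.add hG.neg

theorem HasW.smul [IsScalarTower ℝ ℂ W] {f : ℂ → ℂ} {F : ℂ → W} {a b : ℂ} {p q : W} {z : ℂ}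
    (hf : HasW f a b z) (hF : HasW F p q z) :
    HasW (fun w => f w • F w) (a • F z + f z • p) (b • F z + f z • q) z := by
  refine ⟨hf.diff.smul hF.diff, ?_, ?_⟩
  · rw [fderiv_fun_smul hf.diff hF.diff]
    simp only [add_apply, smul_apply, ContinuousLinearMap.smulRight_apply, hf.one, hF.one]
    module
  · rw [fderiv_fun_smul hf.diff hF.diff]
    simp only [add_apply, smul_apply, ContinuousLinearMap.smulRight_apply, hf.I, hF.I]
    simp only [smul_eq_mul]
    module

theorem HasW.mul {f g : ℂ → ℂ} {a b c d z : ℂ} (hf : HasW f a b z) (hg : HasW g c d z) :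
    HasW (fun w => f w * g w) (a * g z + f z * c) (b * g z + f z * d) z := by
  simpa only [smul_eq_mul] using hf.smul hg

theorem HasW.const_mul {f : ℂ → ℂ} {a b z : ℂ} (c : ℂ) (hf : HasW f a b z) :
    HasW (fun w => c * f w) (c * a) (c * b) z := by
  simpa using (hasW_const c z).mul hf

theorem HasW.const_smul [IsScalarTower ℝ ℂ W] {F : ℂ → W} {p q : W} {z : ℂ} (c : ℂ)
    (hF : HasW F p q z) : HasW (fun w => c • F w) (c • p) (c • q) z := by
  simpa using (hasW_const c z).smul hF

/-- The derivatives are solved for from the product rule applied to `f⁻¹ * f`, which is constantly 1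
near `z`. -/
theorem HasW.inv {f : ℂ → ℂ} {a b z : ℂ} (hf : HasW f a b z) (h0 : f z ≠ 0) :
    HasW (fun w => (f w)⁻¹) (-a / f z ^ 2) (-b / f z ^ 2) z := by
  have hd : DifferentiableAt ℝ (fun w => (f w)⁻¹) z := hf.diff.inv h0
  have h1 := (hasW_of_differentiableAt hd)
  have h2 := h1.mul hf
  have h3 : HasW (fun w => (f w)⁻¹ * f w) 0 0 z := by
    refine (hasW_const (1 : ℂ) z).congr_of_eventuallyEq ?_
    filter_upwards [hf.diff.continuousAt.eventually_ne h0] with w hw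
    exact inv_mul_cancel₀ hw
  obtain ⟨e1, e2⟩ := h2.unique h3
  refine h1.congr_val ?_ ?_
  · field_simp at e1 ⊢
    linear_combination e1
  · field_simp at e2 ⊢
    linear_combination e2

theorem HasW.div {f g : ℂ → ℂ} {a b c d z : ℂ} (hf : HasW f a b z) (hg : HasW g c d z)
    (h0 : g z ≠ 0) : HasW (fun w => f w / g w) ((a * g z - f z * c) / g z ^ 2)
      ((b * g z - f z * d) / g z ^ 2) z := by
  simp only [div_eq_mul_inv (f _)]
  refine (hf.mul (hg.inv h0)).congr_val ?_ ?_ <;> field_simp <;> ring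

theorem HasW.conj {f : ℂ → ℂ} {a b z : ℂ} (hf : HasW f a b z) :
    HasW (fun w => star (f w)) (star b) (star a) z := by
  have hd : HasFDerivAt (fun w => star (f w))
      ((Complex.conjCLE : ℂ →L[ℝ] ℂ).comp (fderiv ℝ f z)) z :=
    (Complex.conjCLE : ℂ →L[ℝ] ℂ).hasFDerivAt.comp z hf.diff.hasFDerivAt
  refine ⟨hd.differentiableAt, ?_, ?_⟩
  · rw [hd.fderiv]
    simp [hf.one, add_comm]
  · rw [hd.fderiv]
    simp only [ContinuousLinearMap.comp_apply, hf.I]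
    simp
    ring

/-- Needed for the logarithm and the square root of `⟨κ, κ̄⟩`, which are real functions of a real
quantity. -/
theorem HasW.real_comp {k : ℂ → ℝ} {a b z : ℂ} {g : ℝ → ℝ} {g' : ℝ}
    (hk : HasW (fun w => (k w : ℂ)) a b z) (hg : HasDerivAt g g' (k z)) :
    HasW (fun w => (g (k w) : ℂ)) (g' * a) (g' * b) z := by
  have hd : HasFDerivAt k (Complex.reCLM.comp (fderiv ℝ (fun w => (k w : ℂ)) z)) z := by
    have := Complex.reCLM.hasFDerivAt.comp z hk.diff.hasFDerivAt
    exact this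
  have hkf : fderiv ℝ (fun w => (k w : ℂ)) z =
      Complex.ofRealCLM.comp (Complex.reCLM.comp (fderiv ℝ (fun w => (k w : ℂ)) z)) := by
    have := Complex.ofRealCLM.hasFDerivAt.comp z hd
    exact this.fderiv
  have h2 : HasFDerivAt (fun w => (g (k w) : ℂ))
      ((g' : ℝ) • fderiv ℝ (fun w => (k w : ℂ)) z) z := by
    have := Complex.ofRealCLM.hasFDerivAt.comp z (hg.comp_hasFDerivAt z hd)
    refine this.congr_fderiv ?_
    rw [ContinuousLinearMap.comp_smul, ← hkf]
  refine ⟨h2.differentiableAt, ?_, ?_⟩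
  · rw [h2.fderiv, smul_apply, hk.one, Complex.real_smul]; ring
  · rw [h2.fderiv, smul_apply, hk.I, Complex.real_smul, smul_eq_mul, smul_eq_mul]; ring

theorem HasW.fderiv_apply [IsScalarTower ℝ ℂ W] {F : ℂ → W} {p q : W} {z : ℂ} (h : HasW F p q z)
    (v : ℂ) : fderiv ℝ F z v = v • p + star v • q := by
  have hv : v = v.re • (1 : ℂ) + v.im • Complex.I := by
    simp [Complex.re_add_im]
  have hs : star v = (v.re : ℂ) - v.im * Complex.I := by
    apply Complex.ext <;> simp
  conv_lhs => rw [hv, map_add, map_smul, map_smul, h.one, h.I]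
  have hp : v • p = ((v.re : ℂ) + v.im * Complex.I) • p := by rw [Complex.re_add_im]
  rw [hs, hp]
  have hr : ∀ (r : ℝ) (w : W), r • w = (r : ℂ) • w := fun r w => (algebraMap_smul ℂ r w).symm
  simp only [hr]
  module

theorem HasW.hasFDerivAt [IsScalarTower ℝ ℂ W] {F : ℂ → W} {p q : W} {z : ℂ} (h : HasW F p q z) :
    HasFDerivAt F (fderiv ℝ F z) z := h.diff.hasFDerivAt

/-- Symmetry of second derivatives: `∂²F/∂z̄∂z = ∂²F/∂z∂z̄`. -/
theorem HasW.comm [IsScalarTower ℝ ℂ W] {F p q : ℂ → W} {p₁ p₂ q₁ q₂ : W} {z : ℂ}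
    (h : ∀ᶠ w in 𝓝 z, HasW F (p w) (q w) w) (hp : HasW p p₁ p₂ z) (hq : HasW q q₁ q₂ z) :
    p₂ = q₁ := by
  let J : W →L[ℝ] (ℂ →L[ℝ] W) :=
    (ContinuousLinearMap.smulRightL ℝ ℂ W Complex.reCLM)
  let K : W →L[ℝ] (ℂ →L[ℝ] W) :=
    (ContinuousLinearMap.smulRightL ℝ ℂ W Complex.imCLM)
  have hI := (hasW_const (W := ℂ) Complex.I z).smul (hp.sub hq)
  have hs := hp.add hq
  -- The real differential is `Re v • F_x + Im v • F_y` with `F_x = p + q` and `F_y = i (p - q)`.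
  have e : ∀ᶠ w in 𝓝 z, HasFDerivAt F (J (p w + q w) + K (Complex.I • (p w - q w))) w := by
    filter_upwards [h] with w hw
    refine hw.diff.hasFDerivAt.congr_fderiv (ContinuousLinearMap.ext fun v => ?_)
    rw [hw.fderiv_apply]
    have hv : star v = (v.re : ℂ) - v.im * Complex.I := by
      apply Complex.ext <;> simp
    have hr : ∀ (r : ℝ) (w : W), r • w = (r : ℂ) • w := fun r w => (algebraMap_smul ℂ r w).symm
    have hpw : v • p w = ((v.re : ℂ) + v.im * Complex.I) • p w := by rw [Complex.re_add_im]
    rw [hv, hpw]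
    have hJ : ∀ x : W, J x v = (v.re : ℂ) • x := fun x => hr v.re x
    have hK : ∀ x : W, K x v = (v.im : ℂ) • x := fun x => hr v.im x
    rw [add_apply, hJ, hK]
    module
  have e2 := (J.hasFDerivAt.comp z hs.diff.hasFDerivAt).add
    (K.hasFDerivAt.comp z hI.diff.hasFDerivAt)
  have e3 := second_derivative_symmetric_of_eventually_of_real e e2 1 Complex.I
  simp only [add_apply, ContinuousLinearMap.comp_apply, hs.one, hs.I, hI.one, hI.I] at e3
  simp [J, K, ContinuousLinearMap.smulRightL] at e3
  -- The difference of the two mixed real partials is exactly `2i (p₂ - q₁)`.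
  have e4 : (2 * Complex.I) • (p₂ - q₁) = 0 := by
    have : Complex.I • (p₁ - q₁ + (p₂ - q₂)) - Complex.I • (p₁ + q₁ - (p₂ + q₂)) = 0 :=
      sub_eq_zero.2 (by simpa [smul_sub, smul_add] using e3)
    rw [← this]
    module
  have := (smul_eq_zero.1 e4).resolve_left (by simp)
  exact sub_eq_zero.1 this

end Wirtinger

/-! ### Wirtinger derivatives of maps into `ℂⁿ`, and smoothness on open sets -/

section Wirtinger

theorem hasW_pi {n : ℕ} {F : ℂ → Fin n → ℂ} {p q : Fin n → ℂ} {z : ℂ} :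
    HasW F p q z ↔ ∀ i, HasW (fun w => F w i) (p i) (q i) z := by
  constructor
  · intro h i
    have hd : HasFDerivAt (fun w => F w i)
        ((ContinuousLinearMap.proj (R := ℝ) (φ := fun _ : Fin n => ℂ) i).comp (fderiv ℝ F z)) z :=
      (ContinuousLinearMap.proj (R := ℝ) (φ := fun _ : Fin n => ℂ) i).hasFDerivAt.comp z
        h.diff.hasFDerivAt
    refine ⟨hd.differentiableAt, ?_, ?_⟩
    · rw [hd.fderiv]; simp [h.one]
    · rw [hd.fderiv]; simp [h.I]
  · intro h
    have hd := hasFDerivAt_pi.2 fun i => (h i).diff.hasFDerivAt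
    refine ⟨hd.differentiableAt, ?_, ?_⟩
    · rw [hd.fderiv]; ext i; simp [(h i).one]
    · rw [hd.fderiv]; ext i; simp [(h i).I]

theorem HasW.conj_pi {n : ℕ} {F : ℂ → Fin n → ℂ} {p q : Fin n → ℂ} {z : ℂ} (h : HasW F p q z) :
    HasW (fun w => star (F w)) (star q) (star p) z :=
  hasW_pi.2 fun i => (hasW_pi.1 h i).conj

theorem hasW_sum {ι : Type*} (s : Finset ι) {f : ι → ℂ → ℂ} {a b : ι → ℂ} {z : ℂ}
    (h : ∀ i ∈ s, HasW (f i) (a i) (b i) z) :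
    HasW (fun w => ∑ i ∈ s, f i w) (∑ i ∈ s, a i) (∑ i ∈ s, b i) z := by
  classical
  induction s using Finset.induction_on with
  | empty => simpa using hasW_const (0 : ℂ) z
  | insert i s hi ih =>
    simp only [Finset.sum_insert hi]
    exact (h i (by simp)).add (ih fun j hj => h j (by simp [hj]))

theorem HasW.lorentz {F G : ℂ → Fin 6 → ℂ} {p q p' q' : Fin 6 → ℂ} {z : ℂ} (hF : HasW F p q z)
    (hG : HasW G p' q' z) :
    HasW (fun w => lorentz (F w) (G w)) (lorentz p (G z) + lorentz (F z) p')
      (lorentz q (G z) + lorentz (F z) q') z := by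
  have hF' := hasW_pi.1 hF
  have hG' := hasW_pi.1 hG
  refine (((hF' 0).mul (hG' 0)).neg.add
    (hasW_sum Finset.univ fun i _ => (hF' (Fin.succ i)).mul (hG' (Fin.succ i)))).congr_val ?_ ?_ <;>
  · simp only [MoebiusGeometry.lorentz, Finset.sum_add_distrib]
    ring

theorem HasW.linear {m n : ℕ} {F : ℂ → Fin m → ℂ} {p q : Fin m → ℂ} {z : ℂ} (hF : HasW F p q z)
    (L : (Fin m → ℂ) →ₗ[ℂ] (Fin n → ℂ)) : HasW (fun w => L (F w)) (L p) (L q) z := by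
  have hd : HasFDerivAt (fun w => L (F w))
      ((L.toContinuousLinearMap.restrictScalars ℝ).comp (fderiv ℝ F z)) z :=
    (L.toContinuousLinearMap.restrictScalars ℝ).hasFDerivAt.comp z hF.diff.hasFDerivAt
  refine ⟨hd.differentiableAt, ?_, ?_⟩
  · rw [hd.fderiv]; simp [hF.one]
  · rw [hd.fderiv]; simp [hF.I, smul_sub]

/-- Smoothness of a function on a set, through smoothness at its points. -/
def SmoothOn {W : Type*} [NormedAddCommGroup W] [NormedSpace ℝ W] (Ω : Set ℂ) (F : ℂ → W) : Prop :=
  ∀ z ∈ Ω, ContDiffAt ℝ ∞ F z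

section

variable {W : Type*} [NormedAddCommGroup W] [NormedSpace ℝ W] {Ω : Set ℂ} {F G : ℂ → W}
  {f g : ℂ → ℂ}

theorem ContDiffAt.fderiv_apply_smooth {F : ℂ → W} {z : ℂ} (h : ContDiffAt ℝ ∞ F z) (v : ℂ) :
    ContDiffAt ℝ ∞ (fun w => fderiv ℝ F w v) z :=
  (h.fderiv_right (m := ∞) (by simp)).clm_apply contDiffAt_const

theorem SmoothOn.add (hF : SmoothOn Ω F) (hG : SmoothOn Ω G) : SmoothOn Ω fun w => F w + G w :=
  fun z hz => (hF z hz).add (hG z hz)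

theorem SmoothOn.sub (hF : SmoothOn Ω F) (hG : SmoothOn Ω G) : SmoothOn Ω fun w => F w - G w :=
  fun z hz => (hF z hz).sub (hG z hz)

theorem SmoothOn.neg (hF : SmoothOn Ω F) : SmoothOn Ω fun w => -F w :=
  fun z hz => (hF z hz).neg

theorem smoothOn_const (c : W) : SmoothOn Ω fun _ => c := fun _ _ => contDiffAt_const

theorem SmoothOn.congr (h : SmoothOn Ω F) (hΩ : IsOpen Ω) (hFG : ∀ w ∈ Ω, G w = F w) :
    SmoothOn Ω G := fun z hz =>
  (h z hz).congr_of_eventuallyEq (eventually_of_mem (hΩ.mem_nhds hz) hFG)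

theorem SmoothOn.mono {Ω' : Set ℂ} (h : SmoothOn Ω F) (hs : Ω' ⊆ Ω) : SmoothOn Ω' F :=
  fun z hz => h z (hs hz)

variable [NormedSpace ℂ W]

theorem SmoothOn.hasW (h : SmoothOn Ω F) {z : ℂ} (hz : z ∈ Ω) :
    HasW F (dz F z) (dzbar F z) z :=
  hasW_of_differentiableAt ((h z hz).differentiableAt (by simp))

theorem contDiffAt_const_smul [IsScalarTower ℝ ℂ W] (c : ℂ) {F : ℂ → W} {z : ℂ}
    (h : ContDiffAt ℝ ∞ F z) : ContDiffAt ℝ ∞ (fun w => c • F w) z :=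
  (contDiffAt_const (c := c)).smul h

theorem SmoothOn.smul [IsScalarTower ℝ ℂ W] (hf : SmoothOn Ω f) (hF : SmoothOn Ω F) :
    SmoothOn Ω fun w => f w • F w :=
  fun z hz => (hf z hz).smul (hF z hz)

theorem SmoothOn.mul (hf : SmoothOn Ω f) (hg : SmoothOn Ω g) : SmoothOn Ω fun w => f w * g w :=
  fun z hz => (hf z hz).mul (hg z hz)

theorem SmoothOn.div (hf : SmoothOn Ω f) (hg : SmoothOn Ω g) (h0 : ∀ z ∈ Ω, g z ≠ 0) :
    SmoothOn Ω fun w => f w / g w := by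
  intro z hz
  simp only [div_eq_mul_inv]
  exact (hf z hz).mul ((hg z hz).inv (h0 z hz))

theorem SmoothOn.dz [IsScalarTower ℝ ℂ W] (h : SmoothOn Ω F) : SmoothOn Ω (dz F) := fun z hz =>
  contDiffAt_const_smul _ ((ContDiffAt.fderiv_apply_smooth (h z hz) _).sub
    (contDiffAt_const_smul _ (ContDiffAt.fderiv_apply_smooth (h z hz) _)))

theorem SmoothOn.dzbar [IsScalarTower ℝ ℂ W] (h : SmoothOn Ω F) : SmoothOn Ω (dzbar F) :=
  fun z hz => contDiffAt_const_smul _ ((ContDiffAt.fderiv_apply_smooth (h z hz) _).add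
    (contDiffAt_const_smul _ (ContDiffAt.fderiv_apply_smooth (h z hz) _)))

theorem smoothOn_pi {n : ℕ} {F : ℂ → Fin n → ℂ} :
    SmoothOn Ω F ↔ ∀ i, SmoothOn Ω fun w => F w i :=
  ⟨fun h i z hz => contDiffAt_pi.1 (h z hz) i, fun h z hz => contDiffAt_pi.2 fun i => h i z hz⟩

theorem SmoothOn.conj (hf : SmoothOn Ω f) : SmoothOn Ω fun w => star (f w) :=
  fun z hz => (Complex.conjCLE : ℂ →L[ℝ] ℂ).contDiff.contDiffAt.comp z (hf z hz)

theorem SmoothOn.conj_pi {n : ℕ} {F : ℂ → Fin n → ℂ} (hF : SmoothOn Ω F) :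
    SmoothOn Ω fun w => star (F w) :=
  smoothOn_pi.2 fun i => (smoothOn_pi.1 hF i).conj

theorem SmoothOn.re (hf : SmoothOn Ω f) : SmoothOn Ω fun w => (f w).re :=
  fun z hz => Complex.reCLM.contDiff.contDiffAt.comp z (hf z hz)

theorem SmoothOn.ofReal {k : ℂ → ℝ} (hf : SmoothOn Ω k) : SmoothOn Ω fun w => (k w : ℂ) :=
  fun z hz => Complex.ofRealCLM.contDiff.contDiffAt.comp z (hf z hz)

theorem SmoothOn.lorentz {F G : ℂ → Fin 6 → ℂ} (hF : SmoothOn Ω F) (hG : SmoothOn Ω G) :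
    SmoothOn Ω fun w => lorentz (F w) (G w) := by
  have hF' := smoothOn_pi.1 hF
  have hG' := smoothOn_pi.1 hG
  exact ((hF' 0).mul (hG' 0)).neg.add fun z hz =>
    ContDiffAt.sum fun i _ => (hF' (Fin.succ i) z hz).mul (hG' (Fin.succ i) z hz)

theorem HasW.comm_on [IsScalarTower ℝ ℂ W] (hΩ : IsOpen Ω) {p q : ℂ → W} {p₁ p₂ q₁ q₂ : W} {z : ℂ}
    (hz : z ∈ Ω) (h : ∀ w ∈ Ω, HasW F (p w) (q w) w) (hp : HasW p p₁ p₂ z) (hq : HasW q q₁ q₂ z) :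
    p₂ = q₁ :=
  HasW.comm (eventually_of_mem (hΩ.mem_nhds hz) h) hp hq

theorem dz_real {f : ℂ → ℂ} {z a b : ℂ} (hΩ : IsOpen Ω) (hz : z ∈ Ω)
    (hf : ∀ w ∈ Ω, star (f w) = f w) (h : HasW f a b z) : b = star a :=
  (h.unique (h.conj.congr_on hΩ hz fun w hw => (hf w hw).symm)).2

theorem dz_real_pi {n : ℕ} {F : ℂ → Fin n → ℂ} {z : ℂ} {p q : Fin n → ℂ} (hΩ : IsOpen Ω)
    (hz : z ∈ Ω) (hF : ∀ w ∈ Ω, star (F w) = F w) (h : HasW F p q z) : q = star p :=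
  (h.unique (h.conj_pi.congr_on hΩ hz fun w hw => (hF w hw).symm)).2

end

end Wirtinger

/-! ### The Lorentz form -/

section Lorentz

variable {R : Type*} [CommRing R] (u v w : Fin 6 → R)

theorem lorentz_comm : lorentz v w = lorentz w v := by
  simp only [lorentz, mul_comm]

theorem lorentz_add_left : lorentz (u + v) w = lorentz u w + lorentz v w := by
  simp only [lorentz, Pi.add_apply, add_mul, Finset.sum_add_distrib]; ring

theorem lorentz_add_right : lorentz u (v + w) = lorentz u v + lorentz u w := by
  simp only [lorentz, Pi.add_apply, mul_add, Finset.sum_add_distrib]; ring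

theorem lorentz_smul_right (a : R) : lorentz v (a • w) = a * lorentz v w := by
  rw [lorentz_comm, lorentz_smul_left, lorentz_comm]

theorem lorentz_neg_left : lorentz (-v) w = -lorentz v w := by
  rw [← neg_one_smul R v, lorentz_smul_left]; ring

theorem lorentz_neg_right : lorentz v (-w) = -lorentz v w := by
  rw [lorentz_comm, lorentz_neg_left, lorentz_comm]

theorem lorentz_sub_left : lorentz (u - v) w = lorentz u w - lorentz v w := by
  rw [sub_eq_add_neg, lorentz_add_left, lorentz_neg_left]; ring

theorem lorentz_sub_right : lorentz u (v - w) = lorentz u v - lorentz u w := by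
  rw [sub_eq_add_neg, lorentz_add_right, lorentz_neg_right]; ring

theorem lorentz_star (v w : Fin 6 → ℂ) : lorentz (star v) (star w) = star (lorentz v w) := by
  simp [lorentz]

theorem lorentz_star_left (v w : Fin 6 → ℂ) : lorentz (star v) w = star (lorentz v (star w)) := by
  rw [← lorentz_star, star_star]

/-- A Lorentz frame of `ℂ⁶` consisting of null vectors `p, n, x, x', w, w'` whose only non-zero
products are `⟨p, n⟩`, `⟨x, x'⟩`, `⟨w, w'⟩`. -/
structure NullFrame (p n x x' w w' : Fin 6 → ℂ) (a b c : ℂ) : Prop where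
  pp : lorentz p p = 0
  nn : lorentz n n = 0
  pn : lorentz p n = a
  px : lorentz p x = 0
  px' : lorentz p x' = 0
  pw : lorentz p w = 0
  pw' : lorentz p w' = 0
  nx : lorentz n x = 0
  nx' : lorentz n x' = 0
  nw : lorentz n w = 0
  nw' : lorentz n w' = 0
  xx : lorentz x x = 0
  xx' : lorentz x x' = b
  x'x' : lorentz x' x' = 0
  xw : lorentz x w = 0
  xw' : lorentz x w' = 0
  x'w : lorentz x' w = 0
  x'w' : lorentz x' w' = 0
  ww : lorentz w w = 0
  ww' : lorentz w w' = c
  w'w' : lorentz w' w' = 0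
  a_ne : a ≠ 0
  b_ne : b ≠ 0
  c_ne : c ≠ 0

/-- The frame, rearranged and rescaled, is dual to itself under the form. This gives a left inverse
`D` of the matrix `E` of frame vectors; for square matrices it is also a right inverse, so no
separate proof of linear independence or spanning is needed. -/
theorem NullFrame.expand {p n x x' w w' : Fin 6 → ℂ} {a b c : ℂ}
    (h : NullFrame p n x x' w w' a b c) (v : Fin 6 → ℂ) :
    v = (lorentz v n / a) • p + (lorentz v p / a) • n + (lorentz v x' / b) • x
      + (lorentz v x / b) • x' + (lorentz v w' / c) • w + (lorentz v w / c) • w' := by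
  -- The signature, which turns the Lorentz form into a dot product so that Gram matrices become
  -- matrix products.
  let η : Fin 6 → ℂ := ![-1, 1, 1, 1, 1, 1]
  have hl : ∀ r s : Fin 6 → ℂ, lorentz r s = ∑ i, (η i * r i) * s i := by
    intro r s
    simp [lorentz, η, Fin.sum_univ_succ]
  let E : Matrix (Fin 6) (Fin 6) ℂ := Matrix.of fun i j => ![p, n, x, x', w, w'] j i
  let D : Matrix (Fin 6) (Fin 6) ℂ := Matrix.of fun j i =>
    ![a⁻¹ • n, a⁻¹ • p, b⁻¹ • x', b⁻¹ • x, c⁻¹ • w', c⁻¹ • w] j i * η i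
  have hDE : D * E = 1 := by
    have key : ∀ i j, (D * E) i j =
        lorentz (![a⁻¹ • n, a⁻¹ • p, b⁻¹ • x', b⁻¹ • x, c⁻¹ • w', c⁻¹ • w] i)
          (![p, n, x, x', w, w'] j) := by
      intro i j
      rw [hl, Matrix.mul_apply]
      exact Finset.sum_congr rfl fun l _ => by simp only [D, E, Matrix.of_apply]; ring
    obtain ⟨pp, nn, pn, px, px', pw, pw', nx, nx', nw, nw', xx, xx', x'x', xw, xw', x'w, x'w', ww,
      ww', w'w', a_ne, b_ne, c_ne⟩ := h
    have np := (lorentz_comm n p).trans pn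
    have xp := (lorentz_comm x p).trans px
    have x'p := (lorentz_comm x' p).trans px'
    have wp := (lorentz_comm w p).trans pw
    have w'p := (lorentz_comm w' p).trans pw'
    have xn := (lorentz_comm x n).trans nx
    have x'n := (lorentz_comm x' n).trans nx'
    have wn := (lorentz_comm w n).trans nw
    have w'n := (lorentz_comm w' n).trans nw'
    have x'x := (lorentz_comm x' x).trans xx'
    have wx := (lorentz_comm w x).trans xw
    have wx' := (lorentz_comm w x').trans x'w
    have w'x := (lorentz_comm w' x).trans xw'
    have w'x' := (lorentz_comm w' x').trans x'w'
    have w'w := (lorentz_comm w' w).trans ww'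
    ext i j
    rw [key]
    clear hl key
    fin_cases i <;> fin_cases j <;> simp [lorentz_smul_left, *]
  have hED : E * D = 1 := mul_eq_one_comm.1 hDE
  have hv : v = E.mulVec (D.mulVec v) := by rw [Matrix.mulVec_mulVec, hED, Matrix.one_mulVec]
  have hD : D.mulVec v = ![lorentz v n / a, lorentz v p / a, lorentz v x' / b, lorentz v x / b,
      lorentz v w' / c, lorentz v w / c] := by
    have key : ∀ i, D.mulVec v i =
        lorentz (![a⁻¹ • n, a⁻¹ • p, b⁻¹ • x', b⁻¹ • x, c⁻¹ • w', c⁻¹ • w] i) v := by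
      intro i
      rw [hl, Matrix.mulVec, dotProduct]
      exact Finset.sum_congr rfl fun l _ => by simp only [D, Matrix.of_apply]; ring
    ext i
    rw [key]
    fin_cases i <;> simp [lorentz_smul_left, lorentz_comm v, div_eq_inv_mul]
  rw [hD] at hv
  conv_lhs => rw [hv]
  ext i
  simp [Matrix.mulVec, dotProduct, Fin.sum_univ_succ, E]
  ring

end Lorentz

/-! ### The canonical lift of a conformal map -/

/-- `u` is a smooth conformal map of the open set `Ω` of the plane into the unit sphere. -/
structure IsConformalPatch (u : ℂ → EuclideanSpace ℝ (Fin 5)) (Ω : Set ℂ) : Prop where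
  isOpen : IsOpen Ω
  smooth : SmoothOn Ω u
  conformal : ∀ z ∈ Ω, ConformalAt u z
  norm_eq : ∀ z ∈ Ω, ‖u z‖ = 1

/-- `Y` is a real light-like map with `⟨Y_z, Y_z⟩ = 0` and `⟨Y_z, Y_z̄⟩ = 1/2` on `Ω`. -/
structure IsCanonicalLift (Y : ℂ → Fin 6 → ℂ) (Ω : Set ℂ) : Prop where
  isOpen : IsOpen Ω
  smooth : SmoothOn Ω Y
  real : ∀ z ∈ Ω, star (Y z) = Y z
  null : ∀ z ∈ Ω, lorentz (Y z) (Y z) = 0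
  zz : ∀ z ∈ Ω, lorentz (dz Y z) (dz Y z) = 0
  zzbar : ∀ z ∈ Ω, lorentz (dz Y z) (dzbar Y z) = 1 / 2

theorem lightLift_zero (u : ℂ → EuclideanSpace ℝ (Fin 5)) (z : ℂ) : lightLift u z 0 = 1 := by
  simp [lightLift, lightVec]

theorem lightLift_succ (u : ℂ → EuclideanSpace ℝ (Fin 5)) (z : ℂ) (i : Fin 5) :
    lightLift u z i.succ = (u z i : ℂ) := by
  simp [lightLift, lightVec]

theorem lorentz_lightVec (x : EuclideanSpace ℝ (Fin 5)) (hx : ‖x‖ = 1) :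
    lorentz (lightVec x) (lightVec x) = 0 := by
  have h := EuclideanSpace.real_norm_sq_eq x
  rw [hx] at h
  simp only [lorentz, lightVec, Fin.cons_zero, Fin.cons_succ, ← pow_two]
  linarith

theorem lorentz_ofReal (v w : Fin 6 → ℝ) :
    lorentz (fun i => (v i : ℂ)) (fun i => (w i : ℂ)) = ((lorentz v w : ℝ) : ℂ) := by
  simp [lorentz]

theorem hasW_lightLift {u : ℂ → EuclideanSpace ℝ (Fin 5)} {z : ℂ} (hu : DifferentiableAt ℝ u z) :
    HasFDerivAt (lightLift u) (ContinuousLinearMap.pi (Fin.cons 0 fun i =>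
      Complex.ofRealCLM.comp ((EuclideanSpace.proj i).comp (fderiv ℝ u z)))) z := by
  refine hasFDerivAt_pi.2 fun i => ?_
  refine Fin.cases ?_ (fun i => ?_) i
  · simpa [lightLift, lightVec] using hasFDerivAt_const (1 : ℂ) z
  · have h1 : HasFDerivAt (fun w => u w i) ((EuclideanSpace.proj i).comp (fderiv ℝ u z)) z :=
      (EuclideanSpace.proj (𝕜 := ℝ) i).hasFDerivAt.comp z hu.hasFDerivAt
    have := Complex.ofRealCLM.hasFDerivAt.comp z h1
    simpa [lightLift, lightVec, Function.comp_def] using this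

theorem IsConformalPatch.lightLift_smooth {u : ℂ → EuclideanSpace ℝ (Fin 5)} {Ω : Set ℂ}
    (h : IsConformalPatch u Ω) : SmoothOn Ω (lightLift u) := by
  refine smoothOn_pi.2 fun i => Fin.cases ?_ (fun i => ?_) i
  · simpa only [lightLift_zero] using smoothOn_const (1 : ℂ)
  · simp only [lightLift_succ]
    exact SmoothOn.ofReal fun z hz =>
      (EuclideanSpace.proj (𝕜 := ℝ) i).contDiff.contDiffAt.comp z (h.smooth z hz)

/-- The time component of `(1, u)` is constant, so the form on its derivatives is the Euclidean
product of derivatives of `u`, which conformality makes `c²` times that of the plane. -/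
theorem ConformalAt.lorentz_lightLift {u : ℂ → EuclideanSpace ℝ (Fin 5)} {z : ℂ}
    (h : ConformalAt u z) : lorentz (dz (lightLift u) z) (dz (lightLift u) z) = 0 ∧
      ∃ g : ℝ, 0 < g ∧ lorentz (dz (lightLift u) z) (dzbar (lightLift u) z) = g := by
  obtain ⟨c, hc, li, hli⟩ := conformalAt_iff_isConformalMap_fderiv.1 h
  have hd := (hasW_lightLift h.differentiableAt).fderiv
  have hv : ∀ v, fderiv ℝ (lightLift u) z v = fun i => ((Fin.cons 0 (fun j => (c • li v) j) :
      Fin 6 → ℝ) i : ℂ) := by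
    intro v
    rw [hd]
    ext i
    refine Fin.cases ?_ (fun i => ?_) i <;> simp [hli]
  have hp : ∀ v w, lorentz (fderiv ℝ (lightLift u) z v) (fderiv ℝ (lightLift u) z w) =
      ((c ^ 2 * inner ℝ v w : ℝ) : ℂ) := by
    intro v w
    rw [hv, hv, lorentz_ofReal, ← li.inner_map_map v w]
    congr 1
    simp only [lorentz, Fin.cons_zero, Fin.cons_succ, PiLp.inner_apply, Finset.mul_sum]
    rw [zero_mul, neg_zero, zero_add]
    refine Finset.sum_congr rfl fun i _ => ?_
    simp; ring
  have h11 := hp 1 1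
  have h1I := hp 1 Complex.I
  have hI1 := hp Complex.I 1
  have hII := hp Complex.I Complex.I
  simp [Complex.inner] at h11 h1I hI1 hII
  have key : Complex.I * Complex.I = -1 := Complex.I_mul_I
  refine ⟨?_, c ^ 2 / 2, by positivity, ?_⟩
  · simp only [dz, lorentz_smul_left, lorentz_smul_right, lorentz_sub_left, lorentz_sub_right, h11,
      h1I, hI1, hII]
    linear_combination (1 / 4 : ℂ) * c ^ 2 * key
  · simp only [dz, dzbar, lorentz_smul_left, lorentz_smul_right, lorentz_sub_left,
      lorentz_add_right, h11, h1I, hI1, hII]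
    push_cast
    linear_combination (-1 / 4 : ℂ) * c ^ 2 * key

/-- The square root of the conformal factor of `(1, u)`. -/
noncomputable def liftScale (u : ℂ → EuclideanSpace ℝ (Fin 5)) (z : ℂ) : ℝ :=
  (Real.sqrt (2 * (lorentz (dz (lightLift u) z) (dzbar (lightLift u) z)).re))⁻¹

theorem canLift_eq (u : ℂ → EuclideanSpace ℝ (Fin 5)) (z : ℂ) :
    canLift u z = (liftScale u z : ℂ) • lightLift u z := by
  simp [canLift, liftScale]

theorem liftScale_pos {u : ℂ → EuclideanSpace ℝ (Fin 5)} {z : ℂ} (h : ConformalAt u z) :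
    0 < liftScale u z := by
  obtain ⟨-, g, hg, h⟩ := ConformalAt.lorentz_lightLift h
  rw [liftScale, h, Complex.ofReal_re]
  positivity

theorem IsConformalPatch.liftScale_smooth {u : ℂ → EuclideanSpace ℝ (Fin 5)} {Ω : Set ℂ}
    (h : IsConformalPatch u Ω) : SmoothOn Ω (liftScale u) := by
  intro z hz
  obtain ⟨-, g, hg, hgz⟩ := ConformalAt.lorentz_lightLift (h.conformal z hz)
  have hl := h.lightLift_smooth
  have h1 := (hl.dz.lorentz hl.dzbar).re z hz
  have h2 : ContDiffAt ℝ ∞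
      (fun w => 2 * (lorentz (dz (lightLift u) w) (dzbar (lightLift u) w)).re) z :=
    contDiffAt_const.mul h1
  have h3 : 2 * (lorentz (dz (lightLift u) z) (dzbar (lightLift u) z)).re ≠ 0 := by
    rw [hgz, Complex.ofReal_re]; positivity
  refine (h2.sqrt h3).inv ?_
  rw [hgz, Complex.ofReal_re]; positivity

/-- A light-like `F` is orthogonal to its derivatives, so rescaling `F` by a function `s` merely
multiplies `⟨F_z, F_z⟩` and `⟨F_z, F_z̄⟩` by `s²`; the derivatives of `s` drop out. -/
theorem IsConformalPatch.isCanonicalLift {u : ℂ → EuclideanSpace ℝ (Fin 5)} {Ω : Set ℂ}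
    (h : IsConformalPatch u Ω) : IsCanonicalLift (canLift u) Ω := by
  have hl := h.lightLift_smooth
  have hs := h.liftScale_smooth.ofReal
  have hnull : ∀ z ∈ Ω, lorentz (lightLift u z) (lightLift u z) = 0 := by
    intro z hz
    have := lorentz_ofReal (lightVec (u z)) (lightVec (u z))
    rw [lorentz_lightVec _ (h.norm_eq z hz)] at this
    rw [Complex.ofReal_zero] at this
    exact this
  have hfun : canLift u = fun z => (liftScale u z : ℂ) • lightLift u z := funext (canLift_eq u)
  have hsm : SmoothOn Ω (canLift u) := by rw [hfun]; exact hs.smul hl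
  have hderiv : ∀ z ∈ Ω, lorentz (lightLift u z) (dz (lightLift u) z) = 0 ∧
      lorentz (lightLift u z) (dzbar (lightLift u) z) = 0 := by
    intro z hz
    have h1 := ((hl.hasW hz).lorentz (hl.hasW hz)).unique
      ((hasW_const (0 : ℂ) z).congr_on h.isOpen hz hnull)
    rw [lorentz_comm _ (lightLift u z), lorentz_comm _ (lightLift u z)] at h1
    exact ⟨by linear_combination h1.1 / 2, by linear_combination h1.2 / 2⟩
  have hYz : ∀ z ∈ Ω, HasW (canLift u) _ _ z := fun z hz => by
    rw [hfun]; exact (hs.hasW hz).smul (hl.hasW hz)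
  refine ⟨h.isOpen, hsm, fun z hz => ?_, fun z hz => ?_, fun z hz => ?_, fun z hz => ?_⟩
  · ext i
    simp [canLift_eq, lightLift]
  · rw [canLift_eq, lorentz_smul_left, lorentz_smul_right, hnull z hz]; ring
  · obtain ⟨e1, e2⟩ := hderiv z hz
    rw [(hYz z hz).dz_eq]
    simp only [lorentz_add_left, lorentz_add_right, lorentz_smul_left, lorentz_smul_right,
      lorentz_comm (dz (lightLift u) z) (lightLift u z), e1, hnull z hz,
      (ConformalAt.lorentz_lightLift (h.conformal z hz)).1]
    ring
  · obtain ⟨e1, e2⟩ := hderiv z hz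
    obtain ⟨-, g, hg, hgz⟩ := ConformalAt.lorentz_lightLift (h.conformal z hz)
    rw [(hYz z hz).dz_eq, (hYz z hz).dzbar_eq]
    simp only [lorentz_add_left, lorentz_add_right, lorentz_smul_left, lorentz_smul_right,
      lorentz_comm (dz (lightLift u) z) (lightLift u z), e1, e2, hnull z hz, hgz]
    have : liftScale u z * (liftScale u z * g) = 1 / 2 := by
      rw [liftScale, hgz, Complex.ofReal_re]
      have h2 : √(2 * g) * √(2 * g) = 2 * g := Real.mul_self_sqrt (by positivity)
      have h3 : √(2 * g) ≠ 0 := by positivity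
      field_simp
      linear_combination -h2
    have h' : (liftScale u z : ℂ) * (liftScale u z * g) = 1 / 2 := by
      rw [← Complex.ofReal_mul, ← Complex.ofReal_mul, this]; norm_num
    linear_combination h'

/-! ### The frame of the mean curvature sphere bundle -/

namespace IsCanonicalLift

section

variable {Y : ℂ → Fin 6 → ℂ} {Ω : Set ℂ} (h : IsCanonicalLift Y Ω) {z : ℂ} (hz : z ∈ Ω)

include h hz

theorem dzbar_eq : dzbar Y z = star (dz Y z) :=
  dz_real_pi h.isOpen hz h.real (h.smooth.hasW hz)

theorem hasW : HasW Y (dz Y z) (star (dz Y z)) z :=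
  h.dzbar_eq hz ▸ h.smooth.hasW hz

theorem hasW_dz : HasW (dz Y) (dz (dz Y) z) (dzbar (dz Y) z) z :=
  h.smooth.dz.hasW hz

theorem hasW_dz_star :
    HasW (fun w => star (dz Y w)) (star (dzbar (dz Y) z)) (star (dz (dz Y) z)) z :=
  (h.hasW_dz hz).conj_pi

theorem dz_dz_star : lorentz (dz Y z) (star (dz Y z)) = 1 / 2 := by
  rw [← h.dzbar_eq hz, h.zzbar z hz]

theorem star_dzbar_dz : star (dzbar (dz Y) z) = dzbar (dz Y) z :=
  (HasW.comm_on h.isOpen hz (fun _ hw => h.hasW hw) (h.hasW_dz hz) (h.hasW_dz_star hz)).symm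

/-- This product and the ones below arise by differentiating the normalisations `⟨Y, Y⟩ = 0`, `⟨Y_z,
Y_z⟩ = 0`, `⟨Y_z, Y_z̄⟩ = 1/2` and their consequences. -/
theorem Y_dz : lorentz (Y z) (dz Y z) = 0 := by
  have h1 := ((h.hasW hz).lorentz (h.hasW hz)).unique
    ((hasW_const (0 : ℂ) z).congr_on h.isOpen hz h.null)
  rw [lorentz_comm _ (Y z)] at h1
  linear_combination h1.1 / 2

theorem Y_dz_star : lorentz (Y z) (star (dz Y z)) = 0 := by
  rw [← h.real z hz, lorentz_star, h.Y_dz hz, star_zero]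

theorem dz_star_dz_star : lorentz (star (dz Y z)) (star (dz Y z)) = 0 := by
  rw [lorentz_star, h.zz z hz, star_zero]

theorem dz_dzbar_dz : lorentz (dz Y z) (dzbar (dz Y) z) = 0 := by
  have h1 := ((h.hasW_dz hz).lorentz (h.hasW_dz hz)).unique
    ((hasW_const (0 : ℂ) z).congr_on h.isOpen hz h.zz)
  rw [lorentz_comm _ (dz Y z), lorentz_comm _ (dz Y z)] at h1
  linear_combination h1.2 / 2

theorem dz_dz_dz : lorentz (dz Y z) (dz (dz Y) z) = 0 := by
  have h1 := ((h.hasW_dz hz).lorentz (h.hasW_dz hz)).unique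
    ((hasW_const (0 : ℂ) z).congr_on h.isOpen hz h.zz)
  rw [lorentz_comm _ (dz Y z), lorentz_comm _ (dz Y z)] at h1
  linear_combination h1.1 / 2

theorem Y_dzbar_dz : lorentz (Y z) (dzbar (dz Y) z) = -1 / 2 := by
  have h1 := ((h.hasW hz).lorentz (h.hasW_dz hz)).unique
    ((hasW_const (0 : ℂ) z).congr_on h.isOpen hz fun w hw => h.Y_dz hw)
  have h2 := h.dz_dz_star hz
  rw [lorentz_comm] at h2
  linear_combination h1.2 - h2

theorem Y_dz_dz : lorentz (Y z) (dz (dz Y) z) = 0 := by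
  have h1 := ((h.hasW hz).lorentz (h.hasW_dz hz)).unique
    ((hasW_const (0 : ℂ) z).congr_on h.isOpen hz fun w hw => h.Y_dz hw)
  linear_combination h1.1 - h.zz z hz

theorem dz_star_dz_dz : lorentz (star (dz Y z)) (dz (dz Y) z) = 0 := by
  have h1 := ((h.hasW_dz_star hz).lorentz (h.hasW_dz hz)).unique
    ((hasW_const (1 / 2 : ℂ) z).congr_on h.isOpen hz fun w hw => by
      rw [lorentz_comm, h.dz_dz_star hw])
  have h2 := h.dz_dzbar_dz hz
  rw [lorentz_comm] at h2
  rw [h.star_dzbar_dz hz] at h1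
  linear_combination h1.1 - h2

end

end IsCanonicalLift

/-! ### The normal projection and the Hopf differential -/

section Frame

variable {u : ℂ → EuclideanSpace ℝ (Fin 5)} {Ω : Set ℂ} (h : IsCanonicalLift (canLift u) Ω)
  {z : ℂ} (hz : z ∈ Ω)

/-- Half of the Schwarzian of the lift: `Y_zz + d Y` is normal. -/
noncomputable def halfSchwarzian (u : ℂ → EuclideanSpace ℝ (Fin 5)) (z : ℂ) : ℂ :=
  lorentz (dz (dz (canLift u)) z) (frameN u z)

/-- The function `⟨Y_zz̄, Y_zz̄⟩`. -/
noncomputable def lapSq (u : ℂ → EuclideanSpace ℝ (Fin 5)) (z : ℂ) : ℂ :=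
  lorentz (dzbar (dz (canLift u)) z) (dzbar (dz (canLift u)) z)

theorem frameN_eq (u : ℂ → EuclideanSpace ℝ (Fin 5)) (z : ℂ) :
    frameN u z = (2 : ℂ) • (dzbar (dz (canLift u)) z + lapSq u z • canLift u z) := rfl

theorem dzbar_dz_canLift (u : ℂ → EuclideanSpace ℝ (Fin 5)) (z : ℂ) :
    dzbar (dz (canLift u)) z = (1 / 2 : ℂ) • frameN u z - lapSq u z • canLift u z := by
  rw [frameN_eq, smul_smul]; norm_num

namespace IsCanonicalLift

include h

theorem smooth_lapSq : SmoothOn Ω (lapSq u) := h.smooth.dz.dzbar.lorentz h.smooth.dz.dzbar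

theorem smooth_frameN : SmoothOn Ω (frameN u) :=
  (smoothOn_const (W := ℂ) 2).smul (h.smooth.dz.dzbar.add (h.smooth_lapSq.smul h.smooth))

theorem smooth_halfSchwarzian : SmoothOn Ω (halfSchwarzian u) :=
  h.smooth.dz.dz.lorentz h.smooth_frameN

theorem smooth_normalPart {F : ℂ → Fin 6 → ℂ} (hF : SmoothOn Ω F) :
    SmoothOn Ω fun w => normalPart u w (F w) := by
  have hY := h.smooth
  have hN := h.smooth_frameN
  exact hF.sub (((((hF.lorentz hN).neg.smul hY).add ((hF.lorentz hY).neg.smul hN)).add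
    (((smoothOn_const (2 : ℂ)).mul (hF.lorentz hY.dzbar)).smul hY.dz)).add
    (((smoothOn_const (2 : ℂ)).mul (hF.lorentz hY.dz)).smul hY.dzbar))

theorem smooth_kappa : SmoothOn Ω (kappa u) := h.smooth_normalPart h.smooth.dz.dz

theorem smooth_kappaSq : SmoothOn Ω (kappaSq u) :=
  (h.smooth_kappa.lorentz h.smooth_kappa.conj_pi).re

theorem smooth_muBar (hk : ∀ z ∈ Ω, lorentz (kappa u z) (star (kappa u z)) ≠ 0) :
    SmoothOn Ω (muBar u) :=
  ((smoothOn_const (-2 : ℂ)).mul ((h.smooth_normalPart h.smooth_kappa.dzbar).lorentz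
    h.smooth_kappa.conj_pi)).div (h.smooth_kappa.lorentz h.smooth_kappa.conj_pi) hk

include hz

theorem star_lapSq : star (lapSq u z) = lapSq u z := by
  rw [lapSq, ← lorentz_star, h.star_dzbar_dz hz]

theorem star_frameN : star (frameN u z) = frameN u z := by
  rw [frameN_eq, star_smul, star_add, star_smul, h.star_lapSq hz, h.star_dzbar_dz hz, h.real z hz]
  simp

theorem N_Y : lorentz (frameN u z) (canLift u z) = -1 := by
  rw [frameN_eq, lorentz_smul_left, lorentz_add_left, lorentz_smul_left, h.null z hz,
    lorentz_comm, h.Y_dzbar_dz hz]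
  ring

theorem Y_N : lorentz (canLift u z) (frameN u z) = -1 := by rw [lorentz_comm, h.N_Y hz]

theorem N_N : lorentz (frameN u z) (frameN u z) = 0 := by
  simp only [frameN_eq, lorentz_smul_left, lorentz_smul_right, lorentz_add_left, lorentz_add_right,
    h.null z hz, lorentz_comm (dzbar _ z) (canLift u z), h.Y_dzbar_dz hz]
  rw [← lapSq]
  ring

theorem N_dz : lorentz (frameN u z) (dz (canLift u) z) = 0 := by
  rw [frameN_eq, lorentz_smul_left, lorentz_add_left, lorentz_smul_left, h.Y_dz hz,
    lorentz_comm, h.dz_dzbar_dz hz]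
  ring

theorem N_dz_star : lorentz (frameN u z) (star (dz (canLift u) z)) = 0 := by
  rw [← h.star_frameN hz, lorentz_star, h.N_dz hz, star_zero]

theorem normalPart_orthogonal (v : Fin 6 → ℂ) :
    lorentz (normalPart u z v) (canLift u z) = 0 ∧ lorentz (normalPart u z v) (frameN u z) = 0 ∧
    lorentz (normalPart u z v) (dz (canLift u) z) = 0 ∧
    lorentz (normalPart u z v) (star (dz (canLift u) z)) = 0 := by
  have e1 := h.dz_dz_star hz
  have e2 := e1
  rw [lorentz_comm] at e2
  have e3 := h.Y_dz hz
  rw [lorentz_comm] at e3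
  have e4 := h.Y_dz_star hz
  rw [lorentz_comm] at e4
  have e5 := h.N_dz hz
  rw [lorentz_comm] at e5
  have e6 := h.N_dz_star hz
  rw [lorentz_comm] at e6
  simp only [normalPart, h.dzbar_eq hz, lorentz_sub_left, lorentz_add_left, lorentz_smul_left,
    h.null z hz, h.N_Y hz, h.Y_N hz, h.N_N hz, h.Y_dz hz, h.Y_dz_star hz, h.N_dz hz,
    h.N_dz_star hz, h.zz z hz, h.dz_star_dz_star hz, e1, e2, e3, e4, e5, e6]
  refine ⟨?_, ?_, ?_, ?_⟩ <;> ring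

theorem kappa_Y : lorentz (kappa u z) (canLift u z) = 0 := (h.normalPart_orthogonal hz _).1

theorem kappa_N : lorentz (kappa u z) (frameN u z) = 0 := (h.normalPart_orthogonal hz _).2.1

theorem kappa_dz : lorentz (kappa u z) (dz (canLift u) z) = 0 :=
  (h.normalPart_orthogonal hz _).2.2.1

theorem kappa_dz_star : lorentz (kappa u z) (star (dz (canLift u) z)) = 0 :=
  (h.normalPart_orthogonal hz _).2.2.2

theorem kappa_star_Y : lorentz (star (kappa u z)) (canLift u z) = 0 := by
  rw [← h.real z hz, lorentz_star, h.kappa_Y hz, star_zero]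

theorem kappa_star_N : lorentz (star (kappa u z)) (frameN u z) = 0 := by
  rw [← h.star_frameN hz, lorentz_star, h.kappa_N hz, star_zero]

theorem kappa_star_dz : lorentz (star (kappa u z)) (dz (canLift u) z) = 0 := by
  rw [lorentz_star_left, h.kappa_dz_star hz, star_zero]

theorem kappa_star_dz_star : lorentz (star (kappa u z)) (star (dz (canLift u) z)) = 0 := by
  rw [lorentz_star, h.kappa_dz hz, star_zero]

/-- `Y_zz` is orthogonal to `Y`, `Y_z` and `Y_z̄`, so the projection only has a `Y`-component to
remove. -/
theorem kappa_eq : kappa u z = dz (dz (canLift u)) z + halfSchwarzian u z • canLift u z := by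
  have e1 := h.Y_dz_dz hz
  have e2 := h.dz_dz_dz hz
  have e3 := h.dz_star_dz_dz hz
  rw [lorentz_comm] at e1 e2 e3
  simp only [kappa, normalPart, h.dzbar_eq hz, e1, e2, e3, halfSchwarzian]
  module

theorem hasW_dz_frame : HasW (dz (canLift u)) (kappa u z - halfSchwarzian u z • canLift u z)
    ((1 / 2 : ℂ) • frameN u z - lapSq u z • canLift u z) z :=
  (h.hasW_dz hz).congr_val (by rw [h.kappa_eq hz, add_sub_cancel_right]) (dzbar_dz_canLift u z)

/-- `κ̄` is orthogonal to the removed components. Hence `μ̄` can be computed from the ordinary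
derivative of `κ`. -/
theorem lorentz_normalPart (v : Fin 6 → ℂ) :
    lorentz (normalPart u z v) (star (kappa u z)) = lorentz v (star (kappa u z)) := by
  rw [lorentz_comm, lorentz_comm v]
  simp only [normalPart, h.dzbar_eq hz, lorentz_sub_right, lorentz_add_right, lorentz_smul_right,
    h.kappa_star_Y hz, h.kappa_star_N hz, h.kappa_star_dz hz,
    h.kappa_star_dz_star hz]
  ring

theorem muBar_mul (hk : lorentz (kappa u z) (star (kappa u z)) ≠ 0) :
    muBar u z * lorentz (kappa u z) (star (kappa u z)) =
      -2 * lorentz (dzbar (kappa u) z) (star (kappa u z)) := by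
  rw [muBar, DzbarKappa, h.lorentz_normalPart hz]
  field_simp

end IsCanonicalLift

/-- Subtracting the multiple `v 0` of the null vector `(1, x)`, to which `v` is orthogonal, does not
change `⟨v, v̄⟩` and leaves a vector without time component, on which the form is Euclidean. -/
theorem lorentz_star_of_orthogonal {x : EuclideanSpace ℝ (Fin 5)} (hx : ‖x‖ = 1) {v : Fin 6 → ℂ}
    (hv : lorentz v (fun i => (lightVec x i : ℂ)) = 0) :
    lorentz v (star v) = ((∑ i : Fin 5, Complex.normSq (v i.succ - v 0 * x i) : ℝ) : ℂ) := by
  have hx2 := EuclideanSpace.real_norm_sq_eq x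
  rw [hx] at hx2
  have hx3 : ∑ i : Fin 5, (x i : ℂ) * x i = 1 := by
    have : ((∑ i : Fin 5, x i ^ 2 : ℝ) : ℂ) = 1 := by rw [← hx2]; norm_num
    simpa [pow_two] using this
  simp only [lorentz, lightVec, Fin.cons_zero, Fin.cons_succ, Complex.ofReal_one, mul_one] at hv
  have h0 : ∑ i : Fin 5, v i.succ * (x i : ℂ) = v 0 := by linear_combination hv
  have h1 : ∑ i : Fin 5, star (v i.succ) * (x i : ℂ) = star (v 0) := by
    rw [← h0, star_sum]
    exact Finset.sum_congr rfl fun i _ => by simp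
  have key : ((∑ i : Fin 5, Complex.normSq (v i.succ - v 0 * x i) : ℝ) : ℂ) =
      ∑ i : Fin 5, v i.succ * star (v i.succ) - star (v 0) * ∑ i : Fin 5, v i.succ * (x i : ℂ)
      - v 0 * ∑ i : Fin 5, star (v i.succ) * (x i : ℂ)
      + v 0 * star (v 0) * ∑ i : Fin 5, (x i : ℂ) * x i := by
    simp only [Finset.mul_sum, ← Finset.sum_sub_distrib, ← Finset.sum_add_distrib]
    push_cast
    refine Finset.sum_congr rfl fun i _ => ?_
    rw [← Complex.mul_conj]
    simp
    ring
  rw [key, h0, h1, hx3, lorentz]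
  simp only [Pi.star_apply]
  ring

/-- By the preceding semidefiniteness, `⟨κ, κ̄⟩ = 0` would make `κ` a multiple of `Y`; since `⟨κ, N⟩
= 0` and `⟨Y, N⟩ = -1`, that multiple would be zero. -/
theorem IsConformalPatch.kappaSq_pos (h : IsConformalPatch u Ω) (hz : z ∈ Ω)
    (hk : kappa u z ≠ 0) :
    lorentz (kappa u z) (star (kappa u z)) = (kappaSq u z : ℂ) ∧ 0 < kappaSq u z := by
  have hc := h.isCanonicalLift
  have hs := (liftScale_pos (h.conformal z hz)).ne'
  have horth : lorentz (kappa u z) (lightLift u z) = 0 := by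
    have := hc.kappa_Y hz
    rw [canLift_eq, lorentz_smul_right] at this
    exact (mul_eq_zero.1 this).resolve_left (by exact_mod_cast hs)
  have h1 := lorentz_star_of_orthogonal (h.norm_eq z hz) (v := kappa u z) horth
  have h2 : kappaSq u z = ∑ i : Fin 5, Complex.normSq (kappa u z i.succ - kappa u z 0 * u z i) := by
    rw [kappaSq, h1, Complex.ofReal_re]
  refine ⟨by rw [h1, h2], ?_⟩
  rw [h2]
  refine lt_of_le_of_ne (Finset.sum_nonneg fun i _ => Complex.normSq_nonneg _) fun h0 => hk ?_
  have h3 : ∀ i : Fin 5, kappa u z i.succ = kappa u z 0 * u z i := fun i => by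
    have := (Finset.sum_eq_zero_iff_of_nonneg fun i _ => Complex.normSq_nonneg _).1 h0.symm i
      (Finset.mem_univ i)
    exact sub_eq_zero.1 (Complex.normSq_eq_zero.1 this)
  have h4 : kappa u z = kappa u z 0 • lightLift u z := by
    ext i
    refine Fin.cases ?_ (fun i => ?_) i
    · simp [lightLift_zero]
    · simp [lightLift_succ, h3]
  have h5 := hc.kappa_N hz
  have h6 := hc.Y_N hz
  rw [h4, lorentz_smul_left] at h5
  rw [canLift_eq, lorentz_smul_left] at h6
  have h7 : kappa u z 0 = 0 := by
    refine (mul_eq_zero.1 h5).resolve_right fun h => ?_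
    rw [h, mul_zero] at h6
    norm_num at h6
  rw [h4, h7, zero_smul]

end Frame

/-! ### Structure equations of isotropic surfaces -/

/-- A conformal patch with isotropic and nowhere vanishing Hopf differential. -/
structure IsIsotropicPatch (u : ℂ → EuclideanSpace ℝ (Fin 5)) (Ω : Set ℂ) : Prop
    extends IsConformalPatch u Ω where
  isotropic : ∀ z ∈ Ω, lorentz (kappa u z) (kappa u z) = 0
  kappa_ne : ∀ z ∈ Ω, kappa u z ≠ 0

/-- `⟨κ, κ̄⟩` as a complex number. -/
noncomputable def kappaSqC (u : ℂ → EuclideanSpace ℝ (Fin 5)) (z : ℂ) : ℂ := (kappaSq u z : ℂ)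

/-- `μ`, the conjugate of `μ̄`. -/
noncomputable def mu (u : ℂ → EuclideanSpace ℝ (Fin 5)) (z : ℂ) : ℂ := star (muBar u z)

/-- The logarithmic derivative `∂ log ⟨κ, κ̄⟩ / ∂z`. -/
noncomputable def dlogKappa (u : ℂ → EuclideanSpace ℝ (Fin 5)) (z : ℂ) : ℂ :=
  dz (kappaSqC u) z / kappaSqC u z

namespace IsIsotropicPatch

variable {u : ℂ → EuclideanSpace ℝ (Fin 5)} {Ω : Set ℂ} (h : IsIsotropicPatch u Ω)
  {z : ℂ} (hz : z ∈ Ω)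

include h

theorem lift : IsCanonicalLift (canLift u) Ω := h.toIsConformalPatch.isCanonicalLift

section

include hz

theorem lorentz_kappa : lorentz (kappa u z) (star (kappa u z)) = kappaSqC u z :=
  (h.toIsConformalPatch.kappaSq_pos hz (h.kappa_ne z hz)).1

theorem kappaSq_pos : 0 < kappaSq u z :=
  (h.toIsConformalPatch.kappaSq_pos hz (h.kappa_ne z hz)).2

theorem kappaSqC_ne : kappaSqC u z ≠ 0 := by
  have := (h.kappaSq_pos hz).ne'
  rw [kappaSqC]
  exact_mod_cast this

end

theorem smooth_kappaSqC : SmoothOn Ω (kappaSqC u) := h.lift.smooth_kappaSq.ofReal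

theorem smooth_muBar : SmoothOn Ω (muBar u) :=
  h.lift.smooth_muBar fun z hz => by rw [h.lorentz_kappa hz]; exact h.kappaSqC_ne hz

theorem smooth_mu : SmoothOn Ω (mu u) := h.smooth_muBar.conj

theorem smooth_dlogKappa : SmoothOn Ω (dlogKappa u) :=
  h.smooth_kappaSqC.dz.div h.smooth_kappaSqC fun _ hz => h.kappaSqC_ne hz

include hz

theorem hasW_kappaSqC : HasW (kappaSqC u) (dlogKappa u z * kappaSqC u z)
    (star (dlogKappa u z) * kappaSqC u z) z := by
  have h1 := h.smooth_kappaSqC.hasW hz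
  have h2 := dz_real h.isOpen hz (fun w _ => by simp [kappaSqC]) h1
  have h3 := h.kappaSqC_ne hz
  have h4 : star (kappaSqC u z) = kappaSqC u z := by simp [kappaSqC]
  refine h1.congr_val ?_ ?_
  · rw [dlogKappa]; field_simp
  · rw [h2, dlogKappa, star_div₀, h4]; field_simp

/-- Isotropy enters in `ww` and `w'w'`: the normal plane is spanned by the null vectors `κ` and
`κ̄`, so every derivative can be expanded from its inner products. -/
theorem nullFrame : NullFrame (canLift u z) (frameN u z) (dz (canLift u) z)
    (star (dz (canLift u) z)) (kappa u z) (star (kappa u z)) (-1) (1 / 2) (kappaSqC u z) where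
  pp := h.lift.null z hz
  nn := h.lift.N_N hz
  pn := h.lift.Y_N hz
  px := h.lift.Y_dz hz
  px' := h.lift.Y_dz_star hz
  pw := by rw [lorentz_comm]; exact h.lift.kappa_Y hz
  pw' := by rw [lorentz_comm]; exact h.lift.kappa_star_Y hz
  nx := h.lift.N_dz hz
  nx' := h.lift.N_dz_star hz
  nw := by rw [lorentz_comm]; exact h.lift.kappa_N hz
  nw' := by rw [lorentz_comm]; exact h.lift.kappa_star_N hz
  xx := h.lift.zz z hz
  xx' := h.lift.dz_dz_star hz
  x'x' := h.lift.dz_star_dz_star hz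
  xw := by rw [lorentz_comm]; exact h.lift.kappa_dz hz
  xw' := by rw [lorentz_comm]; exact h.lift.kappa_star_dz hz
  x'w := by rw [lorentz_comm]; exact h.lift.kappa_dz_star hz
  x'w' := by rw [lorentz_comm]; exact h.lift.kappa_star_dz_star hz
  ww := h.isotropic z hz
  ww' := h.lorentz_kappa hz
  w'w' := by rw [lorentz_star, h.isotropic z hz, star_zero]
  a_ne := by norm_num
  b_ne := by norm_num
  c_ne := h.kappaSqC_ne hz

theorem dz_star_star : star (dz (dz (canLift u)) z) =
    star (kappa u z) - star (halfSchwarzian u z) • canLift u z := by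
  have e := ((h.lift.hasW_dz hz).unique (h.lift.hasW_dz_frame hz)).1
  rw [e, star_sub, star_smul, h.lift.real z hz]

/-- Each product comes from differentiating an orthogonality relation of `κ`, the last from the
definition of `μ̄`. The product with `N` has to wait until `N_z` is known. -/
theorem lorentz_dzbar_kappa :
    lorentz (dzbar (kappa u) z) (canLift u z) = 0 ∧
    lorentz (dzbar (kappa u) z) (dz (canLift u) z) = 0 ∧
    lorentz (dzbar (kappa u) z) (star (dz (canLift u) z)) = -kappaSqC u z ∧
    lorentz (dzbar (kappa u) z) (kappa u z) = 0 ∧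
    lorentz (dzbar (kappa u) z) (star (kappa u z)) = -(muBar u z / 2) * kappaSqC u z := by
  have hc := h.lift
  have hk := hc.smooth_kappa.hasW hz
  refine ⟨?_, ?_, ?_, ?_, ?_⟩
  · have := ((hk.lorentz (hc.hasW hz)).unique ((hasW_const (0 : ℂ) z).congr_on h.isOpen hz
      fun w hw => hc.kappa_Y hw)).2
    rwa [hc.kappa_dz_star hz, add_zero] at this
  · have := ((hk.lorentz (hc.hasW_dz hz)).unique ((hasW_const (0 : ℂ) z).congr_on h.isOpen hz
      fun w hw => hc.kappa_dz hw)).2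
    rwa [dzbar_dz_canLift, lorentz_sub_right, lorentz_smul_right, lorentz_smul_right,
      hc.kappa_N hz, hc.kappa_Y hz, mul_zero, mul_zero, sub_zero, add_zero] at this
  · have := ((hk.lorentz (hc.hasW_dz_star hz)).unique ((hasW_const (0 : ℂ) z).congr_on h.isOpen hz
      fun w hw => hc.kappa_dz_star hw)).2
    rw [h.dz_star_star hz, lorentz_sub_right, lorentz_smul_right, hc.kappa_Y hz,
      h.lorentz_kappa hz] at this
    linear_combination this
  · have := ((hk.lorentz hk).unique ((hasW_const (0 : ℂ) z).congr_on h.isOpen hz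
      h.isotropic)).2
    rw [lorentz_comm (kappa u z)] at this
    linear_combination this / 2
  · have := hc.muBar_mul hz (by rw [h.lorentz_kappa hz]; exact h.kappaSqC_ne hz)
    rw [h.lorentz_kappa hz] at this
    linear_combination this / 2

theorem lorentz_dz_kappa :
    lorentz (dz (kappa u) z) (canLift u z) = 0 ∧
    lorentz (dz (kappa u) z) (dz (canLift u) z) = 0 ∧
    lorentz (dz (kappa u) z) (star (dz (canLift u) z)) = 0 ∧
    lorentz (dz (kappa u) z) (kappa u z) = 0 ∧
    lorentz (dz (kappa u) z) (star (kappa u z)) =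
      (dlogKappa u z + mu u z / 2) * kappaSqC u z := by
  have hc := h.lift
  have hk := hc.smooth_kappa.hasW hz
  refine ⟨?_, ?_, ?_, ?_, ?_⟩
  · have := ((hk.lorentz (hc.hasW hz)).unique ((hasW_const (0 : ℂ) z).congr_on h.isOpen hz
      fun w hw => hc.kappa_Y hw)).1
    rwa [hc.kappa_dz hz, add_zero] at this
  · have := ((hk.lorentz (hc.hasW_dz_frame hz)).unique ((hasW_const (0 : ℂ) z).congr_on h.isOpen hz
      fun w hw => hc.kappa_dz hw)).1
    rwa [lorentz_sub_right, lorentz_smul_right, hc.kappa_Y hz,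
      h.isotropic z hz, mul_zero, sub_zero, add_zero] at this
  · have := ((hk.lorentz (hc.hasW_dz_star hz)).unique ((hasW_const (0 : ℂ) z).congr_on h.isOpen hz
      fun w hw => hc.kappa_dz_star hw)).1
    rwa [hc.star_dzbar_dz hz, dzbar_dz_canLift, lorentz_sub_right, lorentz_smul_right,
      lorentz_smul_right, hc.kappa_N hz, hc.kappa_Y hz, mul_zero, mul_zero, sub_zero,
      add_zero] at this
  · have := ((hk.lorentz hk).unique ((hasW_const (0 : ℂ) z).congr_on h.isOpen hz
      h.isotropic)).1
    rw [lorentz_comm (kappa u z)] at this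
    linear_combination this / 2
  · have h1 := ((hk.lorentz hk.conj_pi).unique ((h.hasW_kappaSqC hz).congr_on h.isOpen hz
      fun w hw => h.lorentz_kappa hw)).1
    have h2 : lorentz (kappa u z) (star (dzbar (kappa u) z)) = -(mu u z / 2) * kappaSqC u z := by
      rw [lorentz_comm, lorentz_star_left, (h.lorentz_dzbar_kappa hz).2.2.2.2]
      simp [mu, kappaSqC]
    linear_combination h1 - h2

theorem dzbar_kappa_expand : dzbar (kappa u) z =
    -lorentz (dzbar (kappa u) z) (frameN u z) • canLift u z
      - (2 * kappaSqC u z) • dz (canLift u) z - (muBar u z / 2) • kappa u z := by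
  obtain ⟨e1, e2, e3, e4, e5⟩ := h.lorentz_dzbar_kappa hz
  have hk := h.kappaSqC_ne hz
  have := (h.nullFrame hz).expand (dzbar (kappa u) z)
  rw [e1, e2, e3, e4, e5, mul_div_assoc, div_self hk] at this
  refine this.trans ?_
  module

theorem dz_kappa_expand : dz (kappa u) z =
    -lorentz (dz (kappa u) z) (frameN u z) • canLift u z
      + (dlogKappa u z + mu u z / 2) • kappa u z := by
  obtain ⟨e1, e2, e3, e4, e5⟩ := h.lorentz_dz_kappa hz
  have hk := h.kappaSqC_ne hz
  have := (h.nullFrame hz).expand (dz (kappa u) z)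
  rw [e1, e2, e3, e4, e5, mul_div_assoc, div_self hk] at this
  refine this.trans ?_
  module

/-- Compare `(Y_zz)_z̄` with `(Y_zz̄)_z`; the latter contains `N_z / 2`, for which the equation is
solved. -/
theorem dz_frameN : dz (frameN u) z = (2 : ℂ) • (dzbar (kappa u) z
    - dzbar (halfSchwarzian u) z • canLift u z
    - halfSchwarzian u z • star (dz (canLift u) z) + dz (lapSq u) z • canLift u z
    + lapSq u z • dz (canLift u) z) := by
  have hc := h.lift
  have hP := (hc.smooth_kappa.hasW hz).sub ((hc.smooth_halfSchwarzian.hasW hz).smul (hc.hasW hz))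
  have hQ := ((hc.smooth_frameN.hasW hz).const_smul (1 / 2 : ℂ)).sub
    ((hc.smooth_lapSq.hasW hz).smul (hc.hasW hz))
  have := HasW.comm_on h.isOpen hz (fun w hw => hc.hasW_dz_frame hw) hP hQ
  have h2 : (1 / 2 : ℂ) • dz (frameN u) z = (dzbar (kappa u) z
    - dzbar (halfSchwarzian u) z • canLift u z
    - halfSchwarzian u z • star (dz (canLift u) z) + dz (lapSq u) z • canLift u z
    + lapSq u z • dz (canLift u) z) := by
    rw [← sub_add_cancel ((1 / 2 : ℂ) • dz (frameN u) z)
      (dz (lapSq u) z • canLift u z + lapSq u z • dz (canLift u) z), ← this]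
    module
  rw [← h2, smul_smul]
  norm_num

/-- Obtained by differentiating `⟨N, Y_z̄⟩ = 0` in `z`: the two terms are `⟨Y_zz̄, Y_zz̄⟩ - 2k` and
`⟨Y_zz̄, Y_zz̄⟩`. -/
theorem lapSq_eq : lapSq u z = kappaSqC u z := by
  have hc := h.lift
  have h1 := (((hc.smooth_frameN.hasW hz).lorentz (hc.hasW_dz_star hz)).unique
    ((hasW_const (0 : ℂ) z).congr_on h.isOpen hz fun w hw => hc.N_dz_star hw)).1
  rw [hc.star_dzbar_dz hz, dzbar_dz_canLift, h.dz_frameN hz] at h1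
  simp only [lorentz_smul_left, lorentz_add_left, lorentz_sub_left, lorentz_sub_right,
    lorentz_smul_right, (h.lorentz_dzbar_kappa hz).2.2.1, hc.Y_dz_star hz, hc.dz_star_dz_star hz,
    hc.dz_dz_star hz, hc.N_N hz, hc.N_Y hz] at h1
  linear_combination h1 / 2

/-- Differentiating `⟨N, κ̄⟩ = 0` in `z` reduces this to `⟨κ_z̄, κ̄⟩`, since the remaining terms of
`N_z` are orthogonal to `κ̄`. -/
theorem lorentz_dzbar_kappa_N :
    lorentz (dzbar (kappa u) z) (frameN u z) = mu u z * kappaSqC u z := by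
  have hc := h.lift
  have hk := hc.smooth_kappa.hasW hz
  have h1 := (((hc.smooth_frameN.hasW hz).lorentz hk.conj_pi).unique
    ((hasW_const (0 : ℂ) z).congr_on h.isOpen hz fun w hw => by
      rw [lorentz_comm, hc.kappa_star_N hw])).1
  rw [h.dz_frameN hz, lorentz_comm _ (star (kappa u z))] at h1
  simp only [lorentz_smul_right, lorentz_add_right, lorentz_sub_right,
    hc.kappa_star_Y hz, hc.kappa_star_dz hz,
    hc.kappa_star_dz_star hz] at h1
  rw [lorentz_comm (star (kappa u z)), (h.lorentz_dzbar_kappa hz).2.2.2.2,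
    lorentz_comm (frameN u z), lorentz_star_left, hc.star_frameN hz] at h1
  have h2 : star (lorentz (dzbar (kappa u) z) (frameN u z)) = muBar u z * kappaSqC u z := by
    linear_combination h1
  rw [← star_star (lorentz (dzbar (kappa u) z) (frameN u z)), h2]
  simp [mu, kappaSqC]

/-- Differentiate `⟨N, κ⟩ = 0`; the surviving term `⟨κ_z̄, κ⟩` vanishes by isotropy. -/
theorem lorentz_dz_kappa_N : lorentz (dz (kappa u) z) (frameN u z) = 0 := by
  have hc := h.lift
  have hk := hc.smooth_kappa.hasW hz
  have h1 := (((hc.smooth_frameN.hasW hz).lorentz hk).unique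
    ((hasW_const (0 : ℂ) z).congr_on h.isOpen hz fun w hw => by
      rw [lorentz_comm, hc.kappa_N hw])).1
  rw [h.dz_frameN hz, lorentz_comm _ (kappa u z)] at h1
  simp only [lorentz_smul_right, lorentz_add_right, lorentz_sub_right,
    hc.kappa_Y hz, hc.kappa_dz hz, hc.kappa_dz_star hz] at h1
  rw [lorentz_comm (kappa u z), (h.lorentz_dzbar_kappa hz).2.2.2.1] at h1
  rw [lorentz_comm]
  linear_combination h1

theorem hasW_kappa : HasW (kappa u) ((dlogKappa u z + mu u z / 2) • kappa u z)
    (-(mu u z * kappaSqC u z) • canLift u z - (2 * kappaSqC u z) • dz (canLift u) z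
      - (muBar u z / 2) • kappa u z) z := by
  refine (h.lift.smooth_kappa.hasW hz).congr_val ?_ ?_
  · rw [h.dz_kappa_expand hz, h.lorentz_dz_kappa_N hz]; simp
  · rw [h.dzbar_kappa_expand hz, h.lorentz_dzbar_kappa_N hz]

/-- The conformal Gauss equation. -/
theorem gauss : dzbar (halfSchwarzian u) z = (dlogKappa u z - mu u z) * kappaSqC u z := by
  have hc := h.lift
  -- `⟨N_z, N⟩ = 0`: in the formula for `N_z` only `⟨κ_z̄, N⟩` and the coefficients of `Y` survive.
  have h1 := (((hc.smooth_frameN.hasW hz).lorentz (hc.smooth_frameN.hasW hz)).unique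
    ((hasW_const (0 : ℂ) z).congr_on h.isOpen hz fun w hw => hc.N_N hw)).1
  rw [lorentz_comm (frameN u z), h.dz_frameN hz] at h1
  have h2 := hc.N_dz hz
  have h3 := hc.N_dz_star hz
  rw [lorentz_comm] at h2 h3
  simp only [lorentz_smul_left, lorentz_add_left, lorentz_sub_left, h.lorentz_dzbar_kappa_N hz,
    hc.Y_N hz, h2, h3] at h1
  have h4 : dz (lapSq u) z = dlogKappa u z * kappaSqC u z :=
    ((hc.smooth_lapSq.hasW hz).unique ((h.hasW_kappaSqC hz).congr_on h.isOpen hz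
      fun w hw => h.lapSq_eq hw)).1
  rw [h4] at h1
  linear_combination h1 / 4

/-- This is `κ_zz̄ = κ_z̄z` in the frame. Pairing with `N` isolates the `Y`-coefficient (Codazzi),
pairing with `κ̄` the `κ`-coefficient (Ricci). -/
theorem second_derivatives_kappa :
    (dzbar (dlogKappa u) z + dzbar (mu u) z / 2) • kappa u z +
    (dlogKappa u z + mu u z / 2) • (-(mu u z * kappaSqC u z) • canLift u z
      - (2 * kappaSqC u z) • dz (canLift u) z - (muBar u z / 2) • kappa u z) =
    -(dz (mu u) z * kappaSqC u z + mu u z * (dlogKappa u z * kappaSqC u z)) • canLift u z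
      - (mu u z * kappaSqC u z) • dz (canLift u) z
      - (2 * (dlogKappa u z * kappaSqC u z)) • dz (canLift u) z
      - (2 * kappaSqC u z) • (kappa u z - halfSchwarzian u z • canLift u z)
      - (dz (muBar u) z / 2) • kappa u z
      - (muBar u z / 2) • ((dlogKappa u z + mu u z / 2) • kappa u z) := by
  have hc := h.lift
  have hl := h.smooth_dlogKappa.hasW hz
  have hm := h.smooth_mu.hasW hz
  have hb := h.smooth_muBar.hasW hz
  have hk := h.hasW_kappaSqC hz
  have hP := (hl.add (hm.const_mul (1 / 2))).smul (h.hasW_kappa hz)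
  have hQ := (((hm.mul hk).neg.smul (hc.hasW hz)).sub
    ((hk.const_mul 2).smul (hc.hasW_dz_frame hz))).sub
    ((hb.const_mul (1 / 2)).smul (h.hasW_kappa hz))
  have := HasW.comm_on h.isOpen hz (fun w hw => (h.hasW_kappa hw).congr_val
    (by rw [div_eq_inv_mul, ← one_div]) (by rw [div_eq_inv_mul, ← one_div])) hP hQ
  refine Eq.trans ?_ (this.trans ?_) <;> module

/-- The conformal Codazzi equation. -/
theorem codazzi : 2 * halfSchwarzian u z = dz (mu u) z - mu u z ^ 2 / 2 := by
  have hc := h.lift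
  have h1 := congrArg (fun v => lorentz v (frameN u z)) (h.second_derivatives_kappa hz)
  have h2 := hc.N_dz hz
  rw [lorentz_comm] at h2
  simp only [lorentz_smul_left, lorentz_add_left, lorentz_sub_left, hc.kappa_N hz, hc.Y_N hz,
    h2] at h1
  refine mul_right_cancel₀ (h.kappaSqC_ne hz) ?_
  linear_combination h1

/-- The Ricci equation. -/
theorem ricci : dzbar (dlogKappa u) z + dzbar (mu u) z / 2 + dz (muBar u) z / 2 =
    -2 * kappaSqC u z := by
  have hc := h.lift
  have h1 := congrArg (fun v => lorentz v (star (kappa u z))) (h.second_derivatives_kappa hz)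
  have h2 := hc.kappa_star_dz hz
  have h3 := hc.kappa_star_Y hz
  rw [lorentz_comm] at h2 h3
  simp only [lorentz_smul_left, lorentz_add_left, lorentz_sub_left, h2, h3,
    h.lorentz_kappa hz] at h1
  refine mul_right_cancel₀ (h.kappaSqC_ne hz) ?_
  linear_combination h1

end IsIsotropicPatch

/-! ### The scalar equations of isotropic surfaces -/

/-- The equations between the functions `k = ⟨κ, κ̄⟩`, `l = ∂ log k / ∂z` and `μ = m` of an isotropic
surface: the Ricci equation, and the Gauss and Codazzi equations combined. -/
structure ScalarSystem (k l m : ℂ → ℂ) (Ω : Set ℂ) : Prop where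
  isOpen : IsOpen Ω
  smooth_l : SmoothOn Ω l
  smooth_m : SmoothOn Ω m
  real_k : ∀ z ∈ Ω, star (k z) = k z
  k_ne : ∀ z ∈ Ω, k z ≠ 0
  hasW_k : ∀ z ∈ Ω, HasW k (l z * k z) (star (l z) * k z) z
  ricci : ∀ z ∈ Ω, dzbar l z + dzbar m z / 2 + star (dzbar m z) / 2 = -2 * k z
  gauss : ∀ z ∈ Ω, dz (fun w => dzbar m w - 2 * k w) z = m z * (dzbar m z - 2 * k z)

namespace ScalarSystem

variable {k l m : ℂ → ℂ} {Ω : Set ℂ} (h : ScalarSystem k l m Ω)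

include h

theorem star_dzbar_l {z : ℂ} (hz : z ∈ Ω) : star (dzbar l z) = dzbar l z := by
  have h1 := h.ricci z hz
  have h2 := congrArg star h1
  simp only [star_add, star_mul', star_div₀, star_neg, star_ofNat, star_star, h.real_k z hz] at h2
  linear_combination h2 - h1

theorem hasW_r {z : ℂ} (hz : z ∈ Ω) : HasW (fun w => dzbar m w - 2 * k w)
    (m z * (dzbar m z - 2 * k z)) (dzbar (fun w => dzbar m w - 2 * k w) z) z := by
  have h1 := (h.smooth_m.dzbar.hasW hz).sub ((h.hasW_k z hz).const_mul 2)
  exact (hasW_of_differentiableAt h1.diff).congr_val (h.gauss z hz) rfl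

/-- The hypothesis is `|r|² = c² k²`. Its logarithmic `z`-derivative and `r_z = μ r` determine `r_z̄
= (2 l̄ - μ̄) r`; then `r_zz̄ = r_z̄z` gives `Re μ_z̄ = l_z̄`, to be combined with Ricci. -/
theorem dzbar_l_of_normSq {c : ℂ} (hc : c ≠ 0)
    (hr : ∀ z ∈ Ω, (dzbar m z - 2 * k z) * star (dzbar m z - 2 * k z) = (c * k z) ^ 2)
    {z : ℂ} (hz : z ∈ Ω) : dzbar l z = -k z := by
  set r : ℂ → ℂ := fun w => dzbar m w - 2 * k w with hrdef
  have hr0 : ∀ z ∈ Ω, r z ≠ 0 := fun z hz h0 => by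
    have h1 := hr z hz
    change r z * star (r z) = _ at h1
    rw [h0, zero_mul] at h1
    exact pow_ne_zero 2 (mul_ne_zero hc (h.k_ne z hz)) h1.symm
  have hrW : ∀ z ∈ Ω, HasW r (m z * r z) ((2 * star (l z) - star (m z)) * r z) z := by
    intro z hz
    have h1 := h.hasW_r hz
    have h2 := (h.hasW_k z hz).const_mul c
    have h3 := ((h1.mul h1.conj).unique ((h2.mul h2).congr_on h.isOpen hz fun w hw => by
      rw [← pow_two]; exact hr w hw)).1
    have h5 := hr z hz
    change r z * star (r z) = _ at h5
    change m z * r z * star (r z) + r z * star (dzbar r z) = _ at h3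
    have h4 : star (dzbar r z) = (2 * l z - m z) * star (r z) := by
      refine mul_left_cancel₀ (hr0 z hz) ?_
      linear_combination h3 - 2 * l z * h5
    refine h1.congr_val rfl ?_
    rw [← star_star (dzbar (fun w => dzbar m w - 2 * k w) z)]
    change star (star (dzbar r z)) = _
    rw [h4]
    simp only [star_mul', star_sub, star_star, star_ofNat]
  have hl := h.smooth_l.hasW hz
  have hm := h.smooth_m.hasW hz
  have h6 := HasW.comm_on h.isOpen hz hrW (hm.mul (hrW z hz))
    (((hl.conj.const_mul 2).sub hm.conj).mul (hrW z hz))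
  have h7 : dzbar m z = 2 * dzbar l z - star (dzbar m z) := by
    refine mul_right_cancel₀ (hr0 z hz) ?_
    rw [h.star_dzbar_l hz] at h6
    linear_combination h6
  linear_combination (h.ricci z hz) / 2 - h7 / 4

/-- `H` measures how far `r / k` is from `-3`. Ricci fixes the real part of `r / k`, so `H` is real,
and its derivatives follow from `(r / k)_z = (μ - l) r / k`. -/
theorem exists_defect (hl : ∀ z ∈ Ω, dzbar l z = -k z) :
    ∃ H : ℂ → ℂ, (∀ z ∈ Ω, dzbar m z - 2 * k z = -(3 + Complex.I * H z) * k z) ∧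
      (∀ z ∈ Ω, star (H z) = H z) ∧
      (∀ z ∈ Ω, HasW H ((m z - l z) * (H z - 3 * Complex.I))
        (star (m z - l z) * (H z + 3 * Complex.I)) z) ∧
      (∀ z ∈ Ω, dzbar (fun w => m w - l w) z = -Complex.I * H z * k z) := by
  have hI := Complex.I_mul_I
  have hI' : star Complex.I = -Complex.I := Complex.conj_I
  let H : ℂ → ℂ := fun w => Complex.I * ((dzbar m w - 2 * k w) / k w + 3)
  have hH : ∀ z ∈ Ω, dzbar m z - 2 * k z = -(3 + Complex.I * H z) * k z := by
    intro z hz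
    have := h.k_ne z hz
    simp only [H]
    field_simp
    linear_combination (dzbar m z + k z) * hI
  have hreal : ∀ z ∈ Ω, star (H z) = H z := by
    intro z hz
    have h1 := h.ricci z hz
    rw [hl z hz] at h1
    have h2 := h.k_ne z hz
    simp only [H, star_mul', star_add, star_div₀, star_sub, star_ofNat, h.real_k z hz, hI']
    field_simp
    linear_combination -2 * h1
  have hz1 : ∀ z ∈ Ω, HasW H ((m z - l z) * (H z - 3 * Complex.I))
        (star (m z - l z) * (H z + 3 * Complex.I)) z := by
    intro z hz
    have h1 := ((((h.hasW_r hz).div (h.hasW_k z hz) (h.k_ne z hz)).add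
      (hasW_const (3 : ℂ) z)).const_mul Complex.I)
    have h2 := dz_real h.isOpen hz hreal h1
    have h3 := h.k_ne z hz
    have h4 : Complex.I * ((m z * (dzbar m z - 2 * k z) * k z -
        (dzbar m z - 2 * k z) * (l z * k z)) / k z ^ 2 + 0) =
        (m z - l z) * (H z - 3 * Complex.I) := by
      simp only [H]
      field_simp
      ring
    refine h1.congr_val h4 ?_
    rw [h2, h4]
    simp only [star_mul', star_sub, hreal z hz, star_ofNat, hI']
    ring
  refine ⟨H, hH, hreal, hz1, fun z hz => ?_⟩
  have h1 := ((h.smooth_m.hasW hz).sub (h.smooth_l.hasW hz)).dzbar_eq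
  rw [h1, hl z hz]
  linear_combination hH z hz

/-- With `a = m - l`, the equations for `H` and `a` form an overdetermined system: symmetry of
second derivatives of `H`, and then of `a`, admits only `H = 0` and `a = 0`. -/
theorem defect_eq_zero (hl : ∀ z ∈ Ω, dzbar l z = -k z) {z : ℂ} (hz : z ∈ Ω) :
    dzbar m z - 2 * k z = -3 * k z ∧ m z = l z := by
  have hI := Complex.I_mul_I
  have hI' : star Complex.I = -Complex.I := Complex.conj_I
  obtain ⟨H, hH, hreal, hHW, ha⟩ := h.exists_defect hl
  have hsm := h.smooth_m.sub h.smooth_l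
  set a : ℂ → ℂ := fun w => m w - l w with hadef
  have haW : ∀ z ∈ Ω, HasW a (dz a z) (-Complex.I * H z * k z) z := fun z hz =>
    (hsm.hasW hz).congr_val rfl (ha z hz)
  have hconj : ∀ z ∈ Ω, HasW (fun w => star (a w)) (Complex.I * H z * k z) (star (dz a z)) z :=
    fun z hz => (haW z hz).conj.congr_val (by
      simp only [star_mul', star_neg, hreal z hz, h.real_k z hz, hI', neg_neg]) rfl
  -- This is the integrability condition `H_zz̄ = H_z̄z`.
  have hnorm : ∀ z ∈ Ω, 3 * (a z * star (a z)) = k z * H z ^ 2 := by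
    intro z hz
    have h1 := (haW z hz).mul ((hHW z hz).sub (hasW_const (3 * Complex.I) z))
    have h2 := (hconj z hz).mul ((hHW z hz).add (hasW_const (3 * Complex.I) z))
    have h3 := HasW.comm_on h.isOpen hz hHW h1 h2
    change -Complex.I * H z * k z * (H z - 3 * Complex.I) +
      a z * (star (a z) * (H z + 3 * Complex.I) - 0) = Complex.I * H z * k z * (H z + 3 * Complex.I)
      + star (a z) * (a z * (H z - 3 * Complex.I) + 0) at h3
    refine mul_left_cancel₀ Complex.I_ne_zero ?_
    linear_combination h3 / 2
  have hzero : H z = 0 := by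
    by_contra hne
    have hcont : ContinuousOn H Ω := fun w hw =>
      (hHW w hw).diff.continuousAt.continuousWithinAt
    -- The formula for `a_z` below divides by `H` and cancels `ā`, so it is used on the open set
    -- where `H ≠ 0`; there `a ≠ 0` as well by `hnorm`.
    have hΩ' : IsOpen (Ω ∩ H ⁻¹' {0}ᶜ) := hcont.isOpen_inter_preimage h.isOpen isOpen_compl_singleton
    set Ω' := Ω ∩ H ⁻¹' {0}ᶜ
    have hz' : z ∈ Ω' := ⟨hz, hne⟩
    have hHne : ∀ w ∈ Ω', H w ≠ 0 := fun w hw => hw.2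
    have hane : ∀ w ∈ Ω', a w ≠ 0 := fun w hw h0 => by
      have := hnorm w hw.1
      rw [h0, zero_mul, mul_zero] at this
      exact mul_ne_zero (h.k_ne w hw.1) (pow_ne_zero 2 (hHne w hw)) this.symm
    -- Differentiating `hnorm` in `z` and cancelling `ā` determines `a_z`; `a_z̄` is already known.
    have hA : ∀ w ∈ Ω', HasW a (a w * (l w + 2 * a w - 9 * Complex.I * (a w / H w)))
        (-Complex.I * (H w * k w)) w := by
      intro w hw
      have h1 := ((haW w hw.1).mul (hconj w hw.1)).const_mul 3
      have h2 := (h.hasW_k w hw.1).mul ((hHW w hw.1).mul (hHW w hw.1))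
      have h3 := (h1.unique (h2.congr_on h.isOpen hw.1 fun v hv => by
        rw [← pow_two]; exact hnorm v hv)).1
      change 3 * (dz a w * star (a w) + a w * (Complex.I * H w * k w)) =
        l w * k w * (H w * H w) + k w * (a w * (H w - 3 * Complex.I) * H w +
          H w * (a w * (H w - 3 * Complex.I))) at h3
      have h4 := hnorm w hw.1
      have h5 : star (a w) ≠ 0 := star_ne_zero.2 (hane w hw)
      have h6 := hHne w hw
      have h7 : dz a w = a w * (l w + 2 * a w - 9 * Complex.I * (a w / H w)) := by
        refine mul_left_cancel₀ (mul_ne_zero h5 h6) ?_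
        linear_combination H w / 3 * h3 -
          (l w * H w + 2 * a w * H w - 9 * Complex.I * a w) / 3 * h4 +
          9 * Complex.I * star (a w) * a w * div_mul_cancel₀ (a w) h6
      exact (haW w hw.1).congr_val h7 (by ring)
    have hd := (hA z hz').div (hHW z hz) hne
    have h1 := (hA z hz').mul (((h.smooth_l.hasW hz).add ((hA z hz').const_mul 2)).sub
      (hd.const_mul (9 * Complex.I)))
    have h2 := ((hHW z hz).mul (h.hasW_k z hz)).const_mul (-Complex.I)
    have h3 := HasW.comm_on hΩ' hz' hA h1 h2
    have h4 := hnorm z hz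
    rw [hl z hz] at h3
    change _ * (l z + 2 * a z - 9 * Complex.I * (a z / H z)) + a z * (-k z + 2 * (-Complex.I *
      (H z * k z)) - 9 * Complex.I * ((-Complex.I * (H z * k z) * H z - a z * (star (a z) *
      (H z + 3 * Complex.I))) / H z ^ 2)) = -Complex.I * (a z * (H z - 3 * Complex.I) * k z +
      H z * (l z * k z)) at h3
    have h5 : (-Complex.I * (H z * k z) * H z - a z * (star (a z) * (H z + 3 * Complex.I))) /
        H z ^ 2 = k z * (-Complex.I - (H z + 3 * Complex.I) / 3) := by
      rw [div_eq_iff (pow_ne_zero 2 hne)]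
      linear_combination -(H z + 3 * Complex.I) / 3 * h4
    rw [h5] at h3
    -- In `a_zz̄ = a_z̄z` the terms with `l` and with `H k a` cancel, and `-25 k a = 0` remains.
    have h7 : k z * a z = 0 := by
      linear_combination -h3 / 25 + 24 / 25 * k z * a z * hI +
        9 / 25 * Complex.I ^ 2 * k z * div_mul_cancel₀ (a z) hne
    exact mul_ne_zero (h.k_ne z hz) (hane z hz') h7
  have h1 := hnorm z hz
  rw [hzero] at h1
  have h2 : a z = 0 := by
    have : a z * star (a z) = 0 := by linear_combination h1 / 3
    rcases mul_eq_zero.1 this with h | h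
    · exact h
    · exact star_eq_zero.1 h
  refine ⟨?_, sub_eq_zero.1 h2⟩
  have := hH z hz
  rw [hzero] at this
  linear_combination this

end ScalarSystem

/-- For `gauss`, the Codazzi equation is differentiated in `z̄` and `d_z̄` is replaced by the Gauss
equation, which eliminates the Schwarzian. -/
theorem IsIsotropicPatch.scalarSystem {u : ℂ → EuclideanSpace ℝ (Fin 5)} {Ω : Set ℂ}
    (h : IsIsotropicPatch u Ω) : ScalarSystem (kappaSqC u) (dlogKappa u) (mu u) Ω where
  isOpen := h.isOpen
  smooth_l := h.smooth_dlogKappa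
  smooth_m := h.smooth_mu
  real_k z _ := by simp [kappaSqC]
  k_ne z hz := h.kappaSqC_ne hz
  hasW_k z hz := h.hasW_kappaSqC hz
  ricci z hz := by
    have h1 := (h.smooth_muBar.hasW hz).conj.dzbar_eq
    change dzbar (mu u) z = star (dz (muBar u) z) at h1
    have h2 := h.ricci hz
    rw [← star_star (dz (muBar u) z), ← h1] at h2
    exact h2
  gauss z hz := by
    have hm := h.smooth_mu.hasW hz
    have hmz := h.smooth_mu.dz.hasW hz
    have hmb := h.smooth_mu.dzbar.hasW hz
    have h1 := HasW.comm_on h.isOpen hz (fun w hw => h.smooth_mu.hasW hw) hmz hmb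
    have h2 := ((h.lift.smooth_halfSchwarzian.hasW hz).const_mul 2).unique
      ((hmz.sub ((hm.mul hm).const_mul (1 / 2))).congr_on h.isOpen hz fun w hw => by
        rw [h.codazzi hw]; ring)
    have h3 := h.gauss hz
    rw [(hmb.sub ((h.hasW_kappaSqC hz).const_mul 2)).dz_eq]
    linear_combination -h1 - h2.2 + 2 * h3

theorem IsIsotropicPatch.rho_eq {u : ℂ → EuclideanSpace ℝ (Fin 5)} {Ω : Set ℂ}
    (h : IsIsotropicPatch u Ω) {z : ℂ} (hz : z ∈ Ω) :
    rho u z = star (dzbar (mu u) z - 2 * kappaSqC u z) := by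
  have h1 := (h.smooth_muBar.hasW hz).conj.dzbar_eq
  change dzbar (mu u) z = star (dz (muBar u) z) at h1
  rw [rho, h.lorentz_kappa hz, h1]
  simp [kappaSqC]

/-- Since `ω = log (4k) / 2`, one has `ω_z = l / 2` and `e^{-2ω} = 1 / (4k)`. -/
theorem IsIsotropicPatch.moebiusCurvature_eq {u : ℂ → EuclideanSpace ℝ (Fin 5)} {Ω : Set ℂ}
    (h : IsIsotropicPatch u Ω) {z : ℂ} (hz : z ∈ Ω) :
    (moebiusCurvature u z : ℂ) = -dzbar (dlogKappa u) z / (2 * kappaSqC u z) := by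
  have hW : ∀ w ∈ Ω, HasW (fun w => (omegaFun u w : ℂ)) (1 / 2 * dlogKappa u w)
      (1 / 2 * star (dlogKappa u w)) w := by
    intro w hw
    have hk := h.kappaSq_pos hw
    have hkC := h.kappaSqC_ne hw
    have h1 : HasDerivAt (fun x : ℝ => Real.log (4 * x) / 2) (1 / (2 * kappaSq u w))
        (kappaSq u w) := by
      have := (((hasDerivAt_id (kappaSq u w)).const_mul 4).log (by simp; exact hk.ne')).div_const 2
      refine this.congr_deriv ?_
      rw [id]
      field_simp
    have h2 := (h.hasW_kappaSqC hw).real_comp (k := kappaSq u) h1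
    refine h2.congr_val ?_ ?_
    · push_cast
      rw [← kappaSqC]
      field_simp
    · push_cast
      rw [← kappaSqC]
      field_simp
  have h1 : HasW (dz fun w => (omegaFun u w : ℂ)) _ (1 / 2 * dzbar (dlogKappa u) z) z :=
    ((h.smooth_dlogKappa.hasW hz).const_mul (1 / 2)).congr_on h.isOpen hz
      fun w hw => (hW w hw).dz_eq
  have hk := h.kappaSq_pos hz
  have hkC := h.kappaSqC_ne hz
  have h2 : Real.exp (-2 * omegaFun u z) = (4 * kappaSq u z)⁻¹ := by
    rw [omegaFun, show -2 * (Real.log (4 * kappaSq u z) / 2) = -Real.log (4 * kappaSq u z) by ring,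
      Real.exp_neg, Real.exp_log (by positivity)]
  obtain ⟨x, hx⟩ : ∃ x : ℝ, dzbar (dlogKappa u) z = x :=
    ⟨_, (Complex.conj_eq_iff_re.1 (h.scalarSystem.star_dzbar_l hz)).symm⟩
  rw [moebiusCurvature, h2, h1.dzbar_eq, hx]
  have h3 : ((1 / 2 : ℂ) * (x : ℂ)).re = x / 2 := by
    rw [show (1 / 2 : ℂ) * (x : ℂ) = ((x / 2 : ℝ) : ℂ) by push_cast; ring, Complex.ofReal_re]
  rw [h3]
  push_cast
  rw [← kappaSqC]
  field_simp

/-! ### Linear ordinary differential equations -/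

/-- The bound `1/2` gives existence on all of `[0, 1]` at once: on the ball of radius `‖x₀‖ + 1`
about `x₀` the speed is at most `(2‖x₀‖ + 1) / 2`, so the solution cannot leave the ball in unit
time. -/
theorem exists_solution_of_small {E : Type*} [NormedAddCommGroup E] [NormedSpace ℝ E]
    [CompleteSpace E] (f : ℝ → E → E) (hsub : ∀ t x y, f t (x - y) = f t x - f t y)
    (hb : ∀ t ∈ Set.Icc (0 : ℝ) 1, ∀ x, ‖f t x‖ ≤ 1 / 2 * ‖x‖)
    (hc : ∀ x, ContinuousOn (fun t => f t x) (Set.Icc 0 1)) (x₀ : E) :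
    ∃ α : ℝ → E, α 0 = x₀ ∧
      ∀ t ∈ Set.Icc (0 : ℝ) 1, HasDerivWithinAt α (f t (α t)) (Set.Icc 0 1) t := by
  have hpl : IsPicardLindelof f (⟨0, by simp⟩ : Set.Icc (0 : ℝ) 1) x₀ ⟨‖x₀‖ + 1, by positivity⟩ 0
      ⟨‖x₀‖ + 1, by positivity⟩ 1 := by
    refine ⟨fun t ht => LipschitzOnWith.of_dist_le_mul fun x _ y _ => ?_, fun x _ => hc x,
      fun t ht x hx => ?_, ?_⟩
    · rw [dist_eq_norm, dist_eq_norm, ← hsub]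
      refine (hb t ht _).trans ?_
      have := norm_nonneg (x - y)
      simp only [NNReal.coe_one]
      linarith
    · refine (hb t ht x).trans ?_
      have h1 : ‖x - x₀‖ ≤ ‖x₀‖ + 1 := by rwa [Metric.mem_closedBall, dist_eq_norm] at hx
      have h2 : ‖x‖ ≤ ‖x - x₀‖ + ‖x₀‖ := by simpa using norm_add_le (x - x₀) x₀
      change 1 / 2 * ‖x‖ ≤ ‖x₀‖ + 1
      linarith
    · simp
  exact hpl.exists_eq_forall_mem_Icc_hasDerivWithinAt₀

theorem eq_zero_of_linear_bound {E : Type*} [NormedAddCommGroup E] [NormedSpace ℝ E]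
    {f f' : ℝ → E} {K : ℝ} (hf : ∀ t ∈ Set.Icc (0 : ℝ) 1, HasDerivWithinAt f (f' t) (Set.Icc 0 1) t)
    (h0 : f 0 = 0) (hb : ∀ t ∈ Set.Icc (0 : ℝ) 1, ‖f' t‖ ≤ K * ‖f t‖) : f 1 = 0 :=
  eq_zero_of_abs_deriv_le_mul_abs_self_of_eq_zero_right
    (fun t ht => (hf t ht).continuousWithinAt)
    (fun t ht => (hf t ⟨ht.1, ht.2.le⟩).mono_of_mem_nhdsWithin (Icc_mem_nhdsGE_of_mem ht)) h0
    (fun t ht => hb t ⟨ht.1, ht.2.le⟩) 1 (by simp)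

theorem HasW.hasDerivAt_ray {W : Type*} [NormedAddCommGroup W] [NormedSpace ℝ W] [NormedSpace ℂ W]
    [IsScalarTower ℝ ℂ W] {F : ℂ → W} {p q : W} {z₀ ζ : ℂ} {t : ℝ}
    (h : HasW F p q (z₀ + t * ζ)) :
    HasDerivAt (fun s : ℝ => F (z₀ + s * ζ)) (ζ • p + star ζ • q) t := by
  have h1 : HasDerivAt (fun s : ℝ => z₀ + s * ζ) ζ t := by
    have := ((Complex.ofRealCLM.hasDerivAt (x := t)).mul_const ζ).const_add z₀
    simpa using this
  have h2 := h.hasFDerivAt.comp_hasDerivAt t h1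
  rw [h.fderiv_apply] at h2
  exact h2

/-! ### The polarised Veronese map -/

/-- The complex bilinear dot product on `ℂ³`. -/
noncomputable def dot3 (a b : Fin 3 → ℂ) : ℂ := a 0 * b 0 + a 1 * b 1 + a 2 * b 2

/-- The symmetric bilinear map with `ver x x = (|x|², veroneseVec x)`. -/
noncomputable def ver (a b : Fin 3 → ℂ) : Fin 6 → ℂ :=
  ![dot3 a b, (√3 : ℝ) / 2 * (a 1 * b 2 + a 2 * b 1), (√3 : ℝ) / 2 * (a 0 * b 2 + a 2 * b 0),
    (√3 : ℝ) / 2 * (a 0 * b 1 + a 1 * b 0), (√3 : ℝ) / 2 * (a 0 * b 0 - a 1 * b 1),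
    (a 0 * b 0 + a 1 * b 1 - 2 * (a 2 * b 2)) / 2]

theorem dot3_comm (a b : Fin 3 → ℂ) : dot3 a b = dot3 b a := by simp only [dot3]; ring

theorem ver_comm (a b : Fin 3 → ℂ) : ver a b = ver b a := by
  ext i; fin_cases i <;> simp [ver, dot3] <;> ring

theorem ver_add_left (a a' b : Fin 3 → ℂ) : ver (a + a') b = ver a b + ver a' b := by
  ext i; fin_cases i <;> simp [ver, dot3] <;> ring

theorem ver_smul_left (c : ℂ) (a b : Fin 3 → ℂ) : ver (c • a) b = c • ver a b := by
  ext i; fin_cases i <;> simp [ver, dot3] <;> ring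

theorem ver_add_right (a b b' : Fin 3 → ℂ) : ver a (b + b') = ver a b + ver a b' := by
  rw [ver_comm, ver_add_left, ver_comm b, ver_comm b']

theorem ver_smul_right (c : ℂ) (a b : Fin 3 → ℂ) : ver a (c • b) = c • ver a b := by
  rw [ver_comm, ver_smul_left, ver_comm]

theorem ver_star (a b : Fin 3 → ℂ) : ver (star a) (star b) = star (ver a b) := by
  ext i; fin_cases i <;> simp [ver, dot3]

theorem dot3_star (a b : Fin 3 → ℂ) : dot3 (star a) (star b) = star (dot3 a b) := by
  simp [dot3]

/-- Reduces all products on the Veronese side to dot products in `ℂ³`. For four equal arguments the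
right side vanishes: `ver x x` is light-like. -/
theorem lorentz_ver (a b c d : Fin 3 → ℂ) : lorentz (ver a b) (ver c d) =
    3 / 4 * (dot3 a c * dot3 b d + dot3 a d * dot3 b c) - 3 / 2 * (dot3 a b * dot3 c d) := by
  have h3 : ((√3 : ℝ) : ℂ) ^ 2 = 3 := by
    rw [← Complex.ofReal_pow, Real.sq_sqrt (by norm_num)]; norm_num
  simp only [lorentz, Fin.sum_univ_five, ver, dot3, Fin.succ_zero_eq_one, Fin.succ_one_eq_two,
    Matrix.cons_val, show Fin.succ (2 : Fin 5) = 3 from rfl, show Fin.succ (3 : Fin 5) = 4 from rfl,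
    show Fin.succ (4 : Fin 5) = 5 from rfl]
  linear_combination (1 / 4 * ((a 1 * b 2 + a 2 * b 1) * (c 1 * d 2 + c 2 * d 1) +
    (a 0 * b 2 + a 2 * b 0) * (c 0 * d 2 + c 2 * d 0) +
    (a 0 * b 1 + a 1 * b 0) * (c 0 * d 1 + c 1 * d 0) +
    (a 0 * b 0 - a 1 * b 1) * (c 0 * d 0 - c 1 * d 1))) * h3

/-- `ver` as a continuous real bilinear map. -/
noncomputable def verL : (Fin 3 → ℂ) →L[ℝ] (Fin 3 → ℂ) →L[ℝ] (Fin 6 → ℂ) :=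
  LinearMap.toContinuousBilinearMap (LinearMap.mk₂ ℝ ver ver_add_left
    (fun c a b => by simpa using ver_smul_left (c : ℂ) a b) ver_add_right
    (fun c a b => by simpa using ver_smul_right (c : ℂ) a b))

theorem verL_apply (a b : Fin 3 → ℂ) : verL a b = ver a b := rfl

theorem HasW.ver {F G : ℂ → Fin 3 → ℂ} {p q p' q' : Fin 3 → ℂ} {z : ℂ} (hF : HasW F p q z)
    (hG : HasW G p' q' z) : HasW (fun w => ver (F w) (G w)) (ver p (G z) + ver (F z) p')
      (ver q (G z) + ver (F z) q') z := by
  have hd := verL.hasFDerivAt_of_bilinear hF.diff.hasFDerivAt hG.diff.hasFDerivAt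
  simp only [verL_apply] at hd
  have hv : ∀ v, fderiv ℝ (fun w => MoebiusGeometry.ver (F w) (G w)) z v =
      MoebiusGeometry.ver (F z) (fderiv ℝ G z v) + MoebiusGeometry.ver (fderiv ℝ F z v) (G z) :=
    fun v => by rw [hd.fderiv]; rfl
  refine ⟨hd.differentiableAt, ?_, ?_⟩
  · rw [hv, hF.one, hG.one, ver_add_left, ver_add_right]
    abel
  · rw [hv, hF.I, hG.I, sub_eq_add_neg, sub_eq_add_neg, ← neg_one_smul ℂ q, ← neg_one_smul ℂ q',
      ver_smul_left, ver_smul_right, ver_add_left, ver_add_right, ver_smul_left, ver_smul_right]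
    module

theorem hasDerivWithinAt_ver {F G : ℝ → Fin 3 → ℂ} {F' G' : Fin 3 → ℂ} {s : Set ℝ} {t : ℝ}
    (hF : HasDerivWithinAt F F' s t) (hG : HasDerivWithinAt G G' s t) :
    HasDerivWithinAt (fun r => ver (F r) (G r)) (ver (F t) G' + ver F' (G t)) s t :=
  verL.hasDerivWithinAt_of_bilinear hF hG

/-! ### Lorentz isometries defined by frames -/

namespace NullFrame

variable {p n x x' w w' P N X X' V V' : Fin 6 → ℂ} {a b c : ℂ}

/-- The linear map taking one null frame to another one. -/
noncomputable def toLinearMap (_ : NullFrame p n x x' w w' a b c)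
    (_ : NullFrame P N X X' V V' a b c) : (Fin 6 → ℂ) →ₗ[ℂ] (Fin 6 → ℂ) where
  toFun v := (lorentz v n / a) • P + (lorentz v p / a) • N + (lorentz v x' / b) • X
      + (lorentz v x / b) • X' + (lorentz v w' / c) • V + (lorentz v w / c) • V'
  map_add' v v' := by
    simp only [lorentz_add_left, add_div, add_smul]; abel
  map_smul' r v := by
    simp only [lorentz_smul_left, mul_div_assoc, smul_add, mul_smul, RingHom.id_apply]

variable (h : NullFrame p n x x' w w' a b c) (H : NullFrame P N X X' V V' a b c)

theorem toLinearMap_apply (v : Fin 6 → ℂ) : h.toLinearMap H v =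
    (lorentz v n / a) • P + (lorentz v p / a) • N + (lorentz v x' / b) • X
      + (lorentz v x / b) • X' + (lorentz v w' / c) • V + (lorentz v w / c) • V' := rfl

theorem toLinearMap_p : h.toLinearMap H p = P := by
  simp [toLinearMap_apply, h.pp, h.pn, h.px, h.px', h.pw, h.pw', div_self h.a_ne]

theorem toLinearMap_n : h.toLinearMap H n = N := by
  simp [toLinearMap_apply, h.nn, lorentz_comm n p, h.pn, h.nx, h.nx', h.nw, h.nw',
    div_self h.a_ne]

theorem toLinearMap_x : h.toLinearMap H x = X := by
  simp [toLinearMap_apply, lorentz_comm x n, lorentz_comm x p, h.px, h.nx, h.xx, h.xx', h.xw,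
    h.xw', div_self h.b_ne]

theorem toLinearMap_w : h.toLinearMap H w = V := by
  simp [toLinearMap_apply, lorentz_comm w n, lorentz_comm w p, lorentz_comm w x, lorentz_comm w x',
    h.pw, h.nw, h.xw, h.x'w, h.ww, h.ww', div_self h.c_ne]

theorem lorentz_toLinearMap (v v' : Fin 6 → ℂ) :
    lorentz (h.toLinearMap H v) (h.toLinearMap H v') = lorentz v v' := by
  conv_rhs => rw [h.expand v, h.expand v']
  have e1 := lorentz_comm N P
  have e2 := lorentz_comm X P
  have e3 := lorentz_comm X' P
  have e4 := lorentz_comm V P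
  have e5 := lorentz_comm V' P
  have e6 := lorentz_comm X N
  have e7 := lorentz_comm X' N
  have e8 := lorentz_comm V N
  have e9 := lorentz_comm V' N
  have e10 := lorentz_comm X' X
  have e11 := lorentz_comm V X
  have e12 := lorentz_comm V' X
  have e13 := lorentz_comm V X'
  have e14 := lorentz_comm V' X'
  have e15 := lorentz_comm V' V
  have f1 := lorentz_comm n p
  have f2 := lorentz_comm x p
  have f3 := lorentz_comm x' p
  have f4 := lorentz_comm w p
  have f5 := lorentz_comm w' p
  have f6 := lorentz_comm x n
  have f7 := lorentz_comm x' n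
  have f8 := lorentz_comm w n
  have f9 := lorentz_comm w' n
  have f10 := lorentz_comm x' x
  have f11 := lorentz_comm w x
  have f12 := lorentz_comm w' x
  have f13 := lorentz_comm w x'
  have f14 := lorentz_comm w' x'
  have f15 := lorentz_comm w' w
  simp only [toLinearMap_apply, lorentz_add_left, lorentz_add_right, lorentz_smul_left,
    lorentz_smul_right, e1, e2, e3, e4, e5, e6, e7, e8, e9, e10, e11, e12, e13, e14, e15,
    f1, f2, f3, f4, f5, f6, f7, f8, f9, f10, f11, f12, f13, f14, f15,
    H.pp, H.nn, H.pn, H.px, H.px', H.pw, H.pw', H.nx, H.nx', H.nw, H.nw', H.xx, H.xx', H.x'x',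
    H.xw, H.xw', H.x'w, H.x'w', H.ww, H.ww', H.w'w',
    h.pp, h.nn, h.pn, h.px, h.px', h.pw, h.pw', h.nx, h.nx', h.nw, h.nw', h.xx, h.xx', h.x'x',
    h.xw, h.xw', h.x'w, h.x'w', h.ww, h.ww', h.w'w']

end NullFrame

/-- Conjugation fixes the first two vectors of both frames and swaps the members of the other pairs,
so the map between the frames is real. -/
theorem NullFrame.star_toLinearMap {p n x w P N X V : Fin 6 → ℂ} {a b c : ℂ}
    (h : NullFrame p n x (star x) w (star w) a b c) (H : NullFrame P N X (star X) V (star V) a b c)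
    (hp : star p = p) (hn : star n = n) (hP : star P = P) (hN : star N = N)
    (ha : star a = a) (hb : star b = b) (hc : star c = c) (v : Fin 6 → ℂ) :
    h.toLinearMap H (star v) = star (h.toLinearMap H v) := by
  have e : ∀ y, lorentz (star v) y = star (lorentz v (star y)) := fun y => lorentz_star_left v y
  simp only [toLinearMap_apply, e, star_add, star_smul, star_div₀, hp, hn, hP, hN, ha, hb, hc,
    star_star]
  abel

/-- A complex Lorentz isometry that commutes with conjugation restricts to Minkowski space. -/
theorem exists_real_isometry (L : (Fin 6 → ℂ) →ₗ[ℂ] (Fin 6 → ℂ))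
    (hs : ∀ v, L (star v) = star (L v)) (hL : ∀ v w, lorentz (L v) (L w) = lorentz v w) :
    ∃ A : (Fin 6 → ℝ) →ₗ[ℝ] (Fin 6 → ℝ), (∀ v w, lorentz (A v) (A w) = lorentz v w) ∧
      ∀ v : Fin 6 → ℝ, (fun i => (A v i : ℂ)) = L (fun i => (v i : ℂ)) := by
  let A : (Fin 6 → ℝ) →ₗ[ℝ] (Fin 6 → ℝ) :=
    { toFun := fun v i => (L (fun j => (v j : ℂ)) i).re
      map_add' := fun v w => by
        ext i
        have : (fun j => ((v + w) j : ℂ)) = (fun j => (v j : ℂ)) + fun j => (w j : ℂ) := by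
          ext j; simp
        rw [this, map_add]; simp
      map_smul' := fun r v => by
        ext i
        have : (fun j => ((r • v) j : ℂ)) = (r : ℂ) • fun j => (v j : ℂ) := by
          ext j; simp
        rw [this, map_smul]; simp }
  have hA : ∀ v : Fin 6 → ℝ, (fun i => (A v i : ℂ)) = L (fun i => (v i : ℂ)) := by
    intro v
    ext i
    have h1 := congrFun (hs (fun i => (v i : ℂ))) i
    have h2 : star (fun i => (v i : ℂ)) = fun i => (v i : ℂ) := by ext; simp
    rw [h2] at h1
    exact Complex.conj_eq_iff_re.1 h1.symm
  refine ⟨A, fun v w => ?_, hA⟩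
  have := lorentz_ofReal (A v) (A w)
  rw [hA, hA, hL, lorentz_ofReal] at this
  exact_mod_cast this.symm

/-! ### The linear system of the Veronese sphere -/

/-- The linear system satisfied by `F = ver ψ ψ`, `X = ver ψ ψ_z`, `V = ver ψ_z ψ_z`,
`Z = ver ψ_z ψ_z̄` for a conformal map `ψ` into the 2-sphere, with `k = ⟨ψ_z, ψ_z̄⟩` and
`m = ∂ log k / ∂z`. -/
structure FrameSystem (F X V Z : ℂ → Fin 6 → ℂ) (k m : ℂ → ℂ) (Ω : Set ℂ) : Prop where
  hasW_F : ∀ z ∈ Ω, HasW F ((2 : ℂ) • X z) ((2 : ℂ) • star (X z)) z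
  hasW_X : ∀ z ∈ Ω, HasW X (V z + m z • X z) (Z z - k z • F z) z
  hasW_V : ∀ z ∈ Ω, HasW V ((2 * m z) • V z) (-(2 * k z) • X z) z
  hasW_Z : ∀ z ∈ Ω, HasW Z (m z • Z z - k z • X z) (star (m z) • Z z - k z • star (X z)) z

/-- The linear system along a ray with direction `ζ`. -/
structure RaySystem (F X V Z : ℝ → Fin 6 → ℂ) (k m : ℝ → ℂ) (ζ : ℂ) : Prop where
  deriv_F : ∀ t ∈ Set.Icc (0 : ℝ) 1, HasDerivWithinAt F
    (ζ • ((2 : ℂ) • X t) + star ζ • ((2 : ℂ) • star (X t))) (Set.Icc 0 1) t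
  deriv_X : ∀ t ∈ Set.Icc (0 : ℝ) 1, HasDerivWithinAt X
    (ζ • (V t + m t • X t) + star ζ • (Z t - k t • F t)) (Set.Icc 0 1) t
  deriv_V : ∀ t ∈ Set.Icc (0 : ℝ) 1, HasDerivWithinAt V
    (ζ • ((2 * m t) • V t) + star ζ • (-(2 * k t) • X t)) (Set.Icc 0 1) t
  deriv_Z : ∀ t ∈ Set.Icc (0 : ℝ) 1, HasDerivWithinAt Z
    (ζ • (m t • Z t - k t • X t) + star ζ • (star (m t) • Z t - k t • star (X t))) (Set.Icc 0 1) t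

/-- The system is linear with scalar coefficients and involves conjugation, so it survives any
linear map that commutes with `star`. This allows the initial frame to be normalised. -/
theorem FrameSystem.ray {F X V Z : ℂ → Fin 6 → ℂ} {k m : ℂ → ℂ} {Ω : Set ℂ}
    (h : FrameSystem F X V Z k m Ω) (L : (Fin 6 → ℂ) →ₗ[ℂ] (Fin 6 → ℂ))
    (hL : ∀ v, L (star v) = star (L v)) {z₀ ζ : ℂ}
    (hray : ∀ t ∈ Set.Icc (0 : ℝ) 1, z₀ + t * ζ ∈ Ω) :
    RaySystem (fun t => L (F (z₀ + t * ζ))) (fun t => L (X (z₀ + t * ζ)))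
      (fun t => L (V (z₀ + t * ζ))) (fun t => L (Z (z₀ + t * ζ)))
      (fun t => k (z₀ + t * ζ)) (fun t => m (z₀ + t * ζ)) ζ where
  deriv_F t ht := by
    have := (((h.hasW_F _ (hray t ht)).linear L).hasDerivAt_ray).hasDerivWithinAt (s := Set.Icc 0 1)
    simpa only [map_smul, map_add, hL] using this
  deriv_X t ht := by
    have := (((h.hasW_X _ (hray t ht)).linear L).hasDerivAt_ray).hasDerivWithinAt (s := Set.Icc 0 1)
    simpa only [map_smul, map_add, map_sub, hL] using this
  deriv_V t ht := by
    have := (((h.hasW_V _ (hray t ht)).linear L).hasDerivAt_ray).hasDerivWithinAt (s := Set.Icc 0 1)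
    simpa only [map_smul, map_add, map_neg, hL] using this
  deriv_Z t ht := by
    have := (((h.hasW_Z _ (hray t ht)).linear L).hasDerivAt_ray).hasDerivWithinAt (s := Set.Icc 0 1)
    simpa only [map_smul, map_add, map_sub, hL] using this

theorem RaySystem.sub {F X V Z F' X' V' Z' : ℝ → Fin 6 → ℂ} {k m : ℝ → ℂ} {ζ : ℂ}
    (h : RaySystem F X V Z k m ζ) (h' : RaySystem F' X' V' Z' k m ζ) :
    RaySystem (fun t => F t - F' t) (fun t => X t - X' t) (fun t => V t - V' t)
      (fun t => Z t - Z' t) k m ζ where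
  deriv_F t ht := ((h.deriv_F t ht).sub (h'.deriv_F t ht)).congr_deriv (by
    rw [star_sub]; module)
  deriv_X t ht := ((h.deriv_X t ht).sub (h'.deriv_X t ht)).congr_deriv (by module)
  deriv_V t ht := ((h.deriv_V t ht).sub (h'.deriv_V t ht)).congr_deriv (by module)
  deriv_Z t ht := ((h.deriv_Z t ht).sub (h'.deriv_Z t ht)).congr_deriv (by
    rw [star_sub]; module)

theorem RaySystem.eq_zero {F X V Z : ℝ → Fin 6 → ℂ} {k m : ℝ → ℂ} {ζ : ℂ} {C : ℝ}
    (h : RaySystem F X V Z k m ζ) (hζ : ‖ζ‖ ≤ 1)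
    (hk : ∀ t ∈ Set.Icc (0 : ℝ) 1, ‖k t‖ ≤ C) (hm : ∀ t ∈ Set.Icc (0 : ℝ) 1, ‖m t‖ ≤ C)
    (hF : F 0 = 0) (hX : X 0 = 0) (hV : V 0 = 0) (hZ : Z 0 = 0) : F 1 = 0 := by
  have hC : 0 ≤ C := (norm_nonneg _).trans (hk 0 (by simp))
  -- The four rows are bounded by `4R`, `(2 + 2C)R`, `4CR` and `4CR`, where `R` is the norm of the
  -- whole vector; `4 + 4C` dominates them all.
  have key := eq_zero_of_linear_bound (f := fun t => ((F t, X t), (V t, Z t)))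
    (K := 4 + 4 * C)
    (fun t ht => ((h.deriv_F t ht).prodMk (h.deriv_X t ht)).prodMk
      ((h.deriv_V t ht).prodMk (h.deriv_Z t ht))) (by simp [hF, hX, hV, hZ]) ?_
  · exact congrArg (fun x => x.1.1) key
  · intro t ht
    set R := ‖((F t, X t), (V t, Z t))‖ with hR
    have hF : ‖F t‖ ≤ R := (norm_fst_le (F t, X t)).trans (norm_fst_le ((F t, X t), (V t, Z t)))
    have hX : ‖X t‖ ≤ R := (norm_snd_le (F t, X t)).trans (norm_fst_le ((F t, X t), (V t, Z t)))
    have hV : ‖V t‖ ≤ R := (norm_fst_le (V t, Z t)).trans (norm_snd_le ((F t, X t), (V t, Z t)))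
    have hZ : ‖Z t‖ ≤ R := (norm_snd_le (V t, Z t)).trans (norm_snd_le ((F t, X t), (V t, Z t)))
    have hXs : ‖star (X t)‖ ≤ R := by rwa [norm_star]
    have hms : ‖star (m t)‖ ≤ C := by rw [norm_star]; exact hm t ht
    have hζs : ‖star ζ‖ ≤ 1 := by rwa [norm_star]
    have hR0 : 0 ≤ R := norm_nonneg _
    have hsm : ∀ {c : ℂ} {v : Fin 6 → ℂ} {a b : ℝ}, ‖c‖ ≤ a → ‖v‖ ≤ b → 0 ≤ a →
        ‖c • v‖ ≤ a * b := fun h1 h2 h3 => by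
      rw [norm_smul]; exact mul_le_mul h1 h2 (norm_nonneg _) h3
    have hadd : ∀ {v w : Fin 6 → ℂ} {a b : ℝ}, ‖v‖ ≤ a → ‖w‖ ≤ b → ‖ζ • v + star ζ • w‖ ≤ a + b :=
      fun h1 h2 => by
        refine (norm_add_le _ _).trans ?_
        have e1 := hsm hζ h1 zero_le_one
        have e2 := hsm hζs h2 zero_le_one
        linarith
    have h2 : ‖(2 : ℂ)‖ ≤ 2 := by simp
    have hCR : 0 ≤ C * R := mul_nonneg hC hR0
    have h2k : ‖-(2 * k t)‖ ≤ 2 * C := by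
      rw [norm_neg, norm_mul]; have := hk t ht; simp; linarith
    have h2m : ‖2 * m t‖ ≤ 2 * C := by
      rw [norm_mul]; have := hm t ht; simp; linarith
    refine max_le (max_le ?_ ?_) (max_le ?_ ?_)
    · refine (hadd (hsm h2 hX zero_le_two) (hsm h2 hXs zero_le_two)).trans ?_
      linarith
    · refine (hadd ((norm_add_le _ _).trans (add_le_add hV (hsm (hm t ht) hX hC)))
        ((norm_sub_le _ _).trans (add_le_add hZ (hsm (hk t ht) hF hC)))).trans ?_
      linarith
    · refine (hadd (hsm h2m hV (by positivity)) (hsm h2k hX (by positivity))).trans ?_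
      linarith
    · refine (hadd ((norm_sub_le _ _).trans (add_le_add (hsm (hm t ht) hZ hC)
        (hsm (hk t ht) hX hC))) ((norm_sub_le _ _).trans (add_le_add (hsm hms hZ hC)
        (hsm (hk t ht) hXs hC)))).trans ?_
      linarith

/-- A conformal map into the sphere with factor `k` satisfies `ψ_z = A`, `A_z = m A`, `A_z̄ = -k ψ`.
Restricted to one ray this is an ODE, so no integrability condition is needed, and the quadratic
expressions in `ψ` and `A` inherit the linear system. -/
theorem exists_model_ray {k m : ℝ → ℂ} {ζ : ℂ} {C : ℝ}
    (hk : ∀ t ∈ Set.Icc (0 : ℝ) 1, ‖k t‖ ≤ C) (hm : ∀ t ∈ Set.Icc (0 : ℝ) 1, ‖m t‖ ≤ C)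
    (hkr : ∀ t ∈ Set.Icc (0 : ℝ) 1, star (k t) = k t)
    (hkc : ContinuousOn k (Set.Icc 0 1)) (hmc : ContinuousOn m (Set.Icc 0 1))
    (hζ : ‖ζ‖ * (2 + 2 * C) ≤ 1 / 2) (ψ₀ : Fin 3 → ℝ) (A₀ : Fin 3 → ℂ) :
    ∃ (ψ : ℝ → Fin 3 → ℝ) (A : ℝ → Fin 3 → ℂ), ψ 0 = ψ₀ ∧ A 0 = A₀ ∧
      RaySystem (fun t => ver (fun i => (ψ t i : ℂ)) (fun i => (ψ t i : ℂ)))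
        (fun t => ver (fun i => (ψ t i : ℂ)) (A t)) (fun t => ver (A t) (A t))
        (fun t => ver (A t) (star (A t))) k m ζ := by
  have hC : 0 ≤ C := (norm_nonneg _).trans (hk 0 (by simp))
  -- `ψ' = 2 Re (ζ A)` and `A' = ζ m A - ζ̄ k ψ`. Keeping `ψ` in a real space makes it real along
  -- the whole ray.
  let f : ℝ → (Fin 3 → ℝ) × (Fin 3 → ℂ) → (Fin 3 → ℝ) × (Fin 3 → ℂ) := fun t x =>
    (fun i => 2 * (ζ * x.2 i).re, fun i => ζ * (m t * x.2 i) - star ζ * (k t * x.1 i))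
  have hsub : ∀ t x y, f t (x - y) = f t x - f t y := by
    intro t x y
    refine Prod.ext (funext fun i => ?_) (funext fun i => ?_)
    · simp [f]; ring
    · simp [f]; ring
  have hb : ∀ t ∈ Set.Icc (0 : ℝ) 1, ∀ x, ‖f t x‖ ≤ 1 / 2 * ‖x‖ := by
    intro t ht x
    have hx0 := norm_nonneg x
    refine le_trans ?_ (mul_le_mul_of_nonneg_right hζ hx0)
    have hζ0 := norm_nonneg ζ
    have h1 : ∀ i, ‖x.1 i‖ ≤ ‖x‖ := fun i => (norm_le_pi_norm x.1 i).trans (norm_fst_le x)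
    have h2 : ∀ i, ‖x.2 i‖ ≤ ‖x‖ := fun i => (norm_le_pi_norm x.2 i).trans (norm_snd_le x)
    have hP : 0 ≤ ‖ζ‖ * (C * ‖x‖) := by positivity
    have hP' : 0 ≤ ‖ζ‖ * ‖x‖ := by positivity
    refine max_le ((pi_norm_le_iff_of_nonneg (by positivity)).2 fun i => ?_)
      ((pi_norm_le_iff_of_nonneg (by positivity)).2 fun i => ?_)
    · have e1 : ‖(ζ * x.2 i).re‖ ≤ ‖ζ‖ * ‖x‖ := by
        refine (Complex.abs_re_le_norm _).trans ?_
        rw [norm_mul]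
        exact mul_le_mul_of_nonneg_left (h2 i) hζ0
      simp only [f, norm_mul, Real.norm_ofNat]
      linarith
    · have e1 : ‖ζ * (m t * x.2 i)‖ ≤ ‖ζ‖ * (C * ‖x‖) := by
        rw [norm_mul, norm_mul]
        exact mul_le_mul_of_nonneg_left (mul_le_mul (hm t ht) (h2 i) (norm_nonneg _) hC) hζ0
      have e2 : ‖star ζ * (k t * x.1 i)‖ ≤ ‖ζ‖ * (C * ‖x‖) := by
        rw [norm_mul, norm_mul, norm_star, Complex.norm_real]
        exact mul_le_mul_of_nonneg_left (mul_le_mul (hk t ht) (h1 i) (norm_nonneg _) hC) hζ0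
      refine (norm_sub_le _ _).trans ?_
      linarith
  have hc : ∀ x, ContinuousOn (fun t => f t x) (Set.Icc 0 1) := by
    intro x
    refine continuousOn_const.prodMk (continuousOn_pi.2 fun i => ?_)
    exact (continuousOn_const.mul (hmc.mul continuousOn_const)).sub
      (continuousOn_const.mul (hkc.mul continuousOn_const))
  obtain ⟨α, hα0, hα⟩ := exists_solution_of_small f hsub hb hc (ψ₀, A₀)
  refine ⟨fun t => (α t).1, fun t => (α t).2, congrArg Prod.fst hα0, congrArg Prod.snd hα0, ?_⟩
  have hψ : ∀ t ∈ Set.Icc (0 : ℝ) 1, HasDerivWithinAt (fun t i => ((α t).1 i : ℂ))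
      (ζ • (α t).2 + star ζ • star (α t).2) (Set.Icc 0 1) t := by
    intro t ht
    refine hasDerivWithinAt_pi.2 fun i => ?_
    have h1 := ((hasDerivWithinAt_pi.1 (hα t ht).fst) i).ofReal_comp
    refine h1.congr_deriv ?_
    simp only [f, Pi.add_apply, Pi.smul_apply, Pi.star_apply, smul_eq_mul]
    rw [← star_mul']
    have := Complex.add_conj (ζ * (α t).2 i)
    exact this.symm
  have hA : ∀ t ∈ Set.Icc (0 : ℝ) 1, HasDerivWithinAt (fun t => (α t).2)
      (ζ • (m t • (α t).2) - star ζ • (k t • fun i => ((α t).1 i : ℂ))) (Set.Icc 0 1) t := by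
    intro t ht
    exact (hα t ht).snd
  have hAs : ∀ t ∈ Set.Icc (0 : ℝ) 1, HasDerivWithinAt (fun t => star (α t).2)
      (star ζ • (star (m t) • star (α t).2) - ζ • (k t • fun i => ((α t).1 i : ℂ)))
      (Set.Icc 0 1) t := by
    intro t ht
    refine (hA t ht).star.congr_deriv ?_
    simp only [star_sub, star_smul, star_star, hkr t ht]
    congr 3
    ext i
    simp
  have hneg : ∀ a b c : Fin 3 → ℂ, ver (a - b) c = ver a c - ver b c := fun a b c => by
    rw [sub_eq_add_neg, ← neg_one_smul ℂ b, ver_add_left, ver_smul_left]; module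
  have hneg' : ∀ a b c : Fin 3 → ℂ, ver c (a - b) = ver c a - ver c b := fun a b c => by
    rw [ver_comm, hneg, ver_comm a, ver_comm b]
  have hreal : ∀ t, star (fun i => ((α t).1 i : ℂ)) = fun i => ((α t).1 i : ℂ) := fun t => by
    ext i; simp
  constructor
  · intro t ht
    refine (hasDerivWithinAt_ver (hψ t ht) (hψ t ht)).congr_deriv ?_
    rw [← ver_star, hreal, ver_comm (_ + _)]
    simp only [ver_add_right, ver_smul_right]
    module
  · intro t ht
    refine (hasDerivWithinAt_ver (hψ t ht) (hA t ht)).congr_deriv ?_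
    rw [ver_comm (α t).2 (star (α t).2)]
    simp only [ver_add_left, ver_smul_left, hneg', ver_smul_right]
    module
  · intro t ht
    refine (hasDerivWithinAt_ver (hA t ht) (hA t ht)).congr_deriv ?_
    rw [ver_comm (_ - _), ver_comm _ (α t).2]
    simp only [hneg', ver_smul_right]
    rw [ver_comm (α t).2 fun i => ((α t).1 i : ℂ)]
    module
  · intro t ht
    refine (hasDerivWithinAt_ver (hA t ht) (hAs t ht)).congr_deriv ?_
    rw [← ver_star, hreal]
    simp only [hneg, hneg', ver_smul_left, ver_smul_right]
    rw [ver_comm (α t).2 fun i => ((α t).1 i : ℂ)]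
    module

/-! ### Isotropic surfaces of Moebius curvature 1/2 satisfy the Veronese system -/

/-- The real function `√(6 ⟨κ, κ̄⟩)`. -/
noncomputable def verScale (u : ℂ → EuclideanSpace ℝ (Fin 5)) (z : ℂ) : ℝ := √(6 * kappaSq u z)

/-- The multiple of the canonical lift that solves the Veronese system. -/
noncomputable def frameF (u : ℂ → EuclideanSpace ℝ (Fin 5)) (z : ℂ) : Fin 6 → ℂ :=
  (verScale u z : ℂ) • canLift u z

/-- Half of the derivative of `frameF`. -/
noncomputable def frameX (u : ℂ → EuclideanSpace ℝ (Fin 5)) (z : ℂ) : Fin 6 → ℂ :=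
  (1 / 2 * verScale u z : ℂ) • (dz (canLift u) z + (1 / 2 * mu u z) • canLift u z)

/-- The multiple of the Hopf differential in the Veronese system. -/
noncomputable def frameV (u : ℂ → EuclideanSpace ℝ (Fin 5)) (z : ℂ) : Fin 6 → ℂ :=
  (1 / 2 * verScale u z : ℂ) • kappa u z

/-- The real null vector that completes `frameF`, `frameX` and `frameV` to a null frame. -/
noncomputable def frameNt (u : ℂ → EuclideanSpace ℝ (Fin 5)) (z : ℂ) : Fin 6 → ℂ :=
  (1 / 2 * verScale u z : ℂ) • ((1 / 2 : ℂ) • frameN u z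
    + (1 / 2 * mu u z) • star (dz (canLift u) z) + (1 / 2 * star (mu u z)) • dz (canLift u) z
    + (1 / 4 * (mu u z * star (mu u z))) • canLift u z)

/-- The real vector `Z` of the Veronese system. -/
noncomputable def frameZ (u : ℂ → EuclideanSpace ℝ (Fin 5)) (z : ℂ) : Fin 6 → ℂ :=
  frameNt u z + (1 / 4 * kappaSqC u z) • frameF u z

namespace IsIsotropicPatch

variable {u : ℂ → EuclideanSpace ℝ (Fin 5)} {Ω : Set ℂ} (h : IsIsotropicPatch u Ω)
  {z : ℂ} (hz : z ∈ Ω)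

include h hz

theorem verScale_pos : 0 < verScale u z := by
  have := h.kappaSq_pos hz
  rw [verScale]; positivity

theorem verScale_sq : (verScale u z : ℂ) * verScale u z = 6 * kappaSqC u z := by
  have := (h.kappaSq_pos hz).le
  rw [verScale, ← Complex.ofReal_mul, Real.mul_self_sqrt (by positivity), kappaSqC]
  push_cast; ring

theorem hasW_verScale : HasW (fun w => (verScale u w : ℂ)) (1 / 2 * dlogKappa u z * verScale u z)
    (1 / 2 * star (dlogKappa u z) * verScale u z) z := by
  have hk := h.kappaSq_pos hz
  have h1 : HasDerivAt (fun x : ℝ => √(6 * x)) (6 / (2 * √(6 * kappaSq u z))) (kappaSq u z) := by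
    have := ((hasDerivAt_id (kappaSq u z)).const_mul 6).sqrt (by simp; exact hk.ne')
    refine this.congr_deriv ?_
    simp
  have hs := h.verScale_sq hz
  have hs0 : (verScale u z : ℂ) ≠ 0 := by exact_mod_cast (h.verScale_pos hz).ne'
  have h2 := (h.hasW_kappaSqC hz).real_comp (k := kappaSq u) h1
  refine h2.congr_val ?_ ?_
  · push_cast
    rw [← verScale]
    field_simp
    linear_combination -dlogKappa u z * hs
  · push_cast
    rw [← verScale]
    field_simp
    linear_combination -star (dlogKappa u z) * hs

/-- The factor `√(6k)` gives `⟨F_z, F_z̄⟩ = 3k`, the value for `ver ψ ψ` with `⟨ψ_z, ψ_z̄⟩ = k`. The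
three constants therefore agree with those of `nullFrame_model`, as an isometry between the frames
requires. -/
theorem nullFrame_ver : NullFrame (frameF u z) (frameNt u z) (frameX u z) (star (frameX u z))
    (frameV u z) (star (frameV u z)) (-(3 / 2) * kappaSqC u z) (3 / 4 * kappaSqC u z)
    (3 / 2 * kappaSqC u z ^ 2) := by
  have H := h.nullFrame hz
  have hY := h.lift.real z hz
  have hs := h.verScale_sq hz
  have hk := h.kappaSqC_ne hz
  have e1 := (lorentz_comm (frameN u z) (canLift u z)).trans H.pn
  have e2 := (lorentz_comm (dz (canLift u) z) (canLift u z)).trans H.px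
  have e3 := (lorentz_comm (star (dz (canLift u) z)) (canLift u z)).trans H.px'
  have e4 := (lorentz_comm (dz (canLift u) z) (frameN u z)).trans H.nx
  have e5 := (lorentz_comm (star (dz (canLift u) z)) (frameN u z)).trans H.nx'
  have e6 := (lorentz_comm (star (dz (canLift u) z)) (dz (canLift u) z)).trans H.xx'
  have hr : star (1 / 2 * verScale u z : ℂ) = 1 / 2 * verScale u z := by simp
  have hrm : star (1 / 2 * mu u z) = 1 / 2 * star (mu u z) := by simp
  constructor
  all_goals try simp only [frameF, frameNt, frameX, frameV, star_smul, star_add, hr, hrm, hY,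
    lorentz_smul_left, lorentz_smul_right, lorentz_add_left, lorentz_add_right,
    H.pp, H.nn, H.pn, H.px, H.px', H.pw, H.pw', H.nx, H.nx', H.nw, H.nw', H.xx, H.xx', H.x'x',
    H.xw, H.xw', H.x'w, H.x'w', H.ww, H.ww', H.w'w', e1, e2, e3, e4, e5, e6]
  case pn => linear_combination -1 / 4 * hs
  case xx' => linear_combination 1 / 8 * hs
  case ww' => linear_combination kappaSqC u z / 4 * hs
  case a_ne => exact mul_ne_zero (by norm_num) hk
  case b_ne => exact mul_ne_zero (by norm_num) hk
  case c_ne => exact mul_ne_zero (by norm_num) (pow_ne_zero 2 hk)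
  all_goals ring

theorem star_frameF : star (frameF u z) = frameF u z := by
  rw [frameF, star_smul, h.lift.real z hz]; simp

theorem star_frameNt : star (frameNt u z) = frameNt u z := by
  rw [frameNt]
  simp only [star_smul, star_add, h.lift.real z hz, h.lift.star_frameN hz, star_mul', star_star,
    star_div₀, star_one, star_ofNat]
  rw [show star (verScale u z : ℂ) = verScale u z by simp]
  module

theorem star_frameZ : star (frameZ u z) = frameZ u z := by
  rw [frameZ, star_add, star_smul, h.star_frameF hz, h.star_frameNt hz]
  congr 2
  simp [kappaSqC]

omit hz in
-- Under these hypotheses the structure equations close up: Codazzi, in the form `μ_z = 2d + μ²/2`,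
-- cancels the Schwarzian, and `μ_z̄ = -k` removes the remaining terms.
theorem frameSystem (hm : ∀ z ∈ Ω, mu u z = dlogKappa u z)
    (hmb : ∀ z ∈ Ω, dzbar (mu u) z = -kappaSqC u z) :
    FrameSystem (frameF u) (frameX u) (frameV u) (frameZ u) (kappaSqC u) (mu u) Ω := by
  have hσ : ∀ z ∈ Ω, HasW (fun w => (verScale u w : ℂ)) (1 / 2 * mu u z * verScale u z)
      (1 / 2 * star (mu u z) * verScale u z) z := fun z hz =>
    (h.hasW_verScale hz).congr_val (by rw [hm z hz]) (by rw [hm z hz])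
  have hmW : ∀ z ∈ Ω, HasW (mu u) (2 * halfSchwarzian u z + mu u z ^ 2 / 2) (-kappaSqC u z) z :=
    fun z hz => (h.smooth_mu.hasW hz).congr_val (by rw [h.codazzi hz]; ring) (hmb z hz)
  have hk : ∀ z ∈ Ω, HasW (kappaSqC u) (mu u z * kappaSqC u z)
      (star (mu u z) * kappaSqC u z) z := fun z hz =>
    (h.hasW_kappaSqC hz).congr_val (by rw [hm z hz]) (by rw [hm z hz])
  have hkr : ∀ z, star (kappaSqC u z) = kappaSqC u z := fun z => by simp [kappaSqC]
  have hmu : ∀ z, muBar u z = star (mu u z) := fun z => by simp [mu]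
  have hY : ∀ z ∈ Ω, HasW (dz (canLift u)) (kappa u z - halfSchwarzian u z • canLift u z)
      ((1 / 2 : ℂ) • frameN u z - kappaSqC u z • canLift u z) z := fun z hz =>
    (h.lift.hasW_dz_frame hz).congr_val rfl (by rw [h.lapSq_eq hz])
  have hYs : ∀ z ∈ Ω, HasW (fun w => star (dz (canLift u) w))
      ((1 / 2 : ℂ) • frameN u z - kappaSqC u z • canLift u z)
      (star (kappa u z - halfSchwarzian u z • canLift u z)) z := fun z hz =>
    (hY z hz).conj_pi.congr_val (by
      rw [star_sub, star_smul, star_smul, h.lift.star_frameN hz, h.lift.real z hz, hkr]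
      simp) rfl
  have hκ : ∀ z ∈ Ω, HasW (kappa u) ((3 / 2 * mu u z) • kappa u z)
      (-(mu u z * kappaSqC u z) • canLift u z - (2 * kappaSqC u z) • dz (canLift u) z
      - (star (mu u z) / 2) • kappa u z) z := fun z hz =>
    (h.hasW_kappa hz).congr_val (by rw [← hm z hz]; module) (by rw [hmu])
  have hN : ∀ z ∈ Ω, dz (frameN u) z = -(2 * kappaSqC u z) • dz (canLift u) z
      - star (mu u z) • kappa u z - (2 * halfSchwarzian u z) • star (dz (canLift u) z) := by
    intro z hz
    have h1 : dz (lapSq u) z = mu u z * kappaSqC u z :=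
      ((h.lift.smooth_lapSq.hasW hz).unique ((hk z hz).congr_on h.isOpen hz
        fun w hw => h.lapSq_eq hw)).1
    rw [h.dz_frameN hz, (hκ z hz).dzbar_eq, h1, h.lapSq_eq hz, h.gauss hz, hm z hz]
    module
  have hF : ∀ z ∈ Ω, HasW (frameF u) ((2 : ℂ) • frameX u z) ((2 : ℂ) • star (frameX u z)) z := by
    intro z hz
    have h1 := (hσ z hz).smul (h.lift.hasW hz)
    have h2 : (1 / 2 * mu u z * verScale u z) • canLift u z +
        (verScale u z : ℂ) • dz (canLift u) z = (2 : ℂ) • frameX u z := by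
      rw [frameX]; module
    refine h1.congr_val h2 ?_
    rw [dz_real_pi h.isOpen hz (fun w hw => h.star_frameF hw) h1]
    change star ((1 / 2 * mu u z * verScale u z) • canLift u z +
        (verScale u z : ℂ) • dz (canLift u) z) = _
    rw [h2, star_smul]
    simp
  refine ⟨hF, fun z hz => ?_, fun z hz => ?_, fun z hz => ?_⟩
  · have h1 := ((hσ z hz).const_mul (1 / 2)).smul
      ((hY z hz).add (((hmW z hz).const_mul (1 / 2)).smul (h.lift.hasW hz)))
    refine h1.congr_val ?_ ?_
    · rw [frameV, frameX]; module
    · rw [frameZ, frameNt, frameF]; module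
  · have h1 := ((hσ z hz).const_mul (1 / 2)).smul (hκ z hz)
    refine h1.congr_val ?_ ?_
    · rw [frameV]; module
    · rw [frameX]; module
  -- Only the `z`-derivative of `Z` is computed; the other one is its conjugate because `Z` is real.
  · have hms := (hmW z hz).conj
    have h1 := (((hσ z hz).const_mul (1 / 2)).smul
      (((((h.lift.smooth_frameN.hasW hz).const_smul (1 / 2 : ℂ)).add
        (((hmW z hz).const_mul (1 / 2)).smul (hYs z hz))).add
        ((hms.const_mul (1 / 2)).smul (hY z hz))).add
        ((((hmW z hz).mul hms).const_mul (1 / 4)).smul (h.lift.hasW hz)))).add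
      (((hk z hz).const_mul (1 / 4)).smul (hF z hz))
    have h2 := dz_real_pi h.isOpen hz (fun w hw => h.star_frameZ hw) h1
    have h3 := (hasW_of_differentiableAt h1.diff)
    have h4 : dz (frameZ u) z = mu u z • frameZ u z - kappaSqC u z • frameX u z := by
      refine h1.dz_eq.trans ?_
      rw [hN z hz, star_neg, hkr]
      simp only [frameZ, frameNt, frameF, frameX]
      module
    refine h3.congr_val h4 ?_
    refine (h1.dzbar_eq.trans h2).trans ?_
    rw [← h1.dz_eq]
    change star (dz (frameZ u) z) = _
    rw [h4, star_sub, star_smul, star_smul, hkr, h.star_frameZ hz]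

end IsIsotropicPatch

/-- The null frame of the Veronese sphere at a point. -/
theorem nullFrame_model {ψ A : Fin 3 → ℂ} {k : ℂ} (hk : k ≠ 0) (hψ : star ψ = ψ)
    (h1 : dot3 ψ ψ = 1) (h2 : dot3 ψ A = 0) (h3 : dot3 A A = 0) (h4 : dot3 A (star A) = k) :
    NullFrame (ver ψ ψ) (ver A (star A) - (1 / 4 * k) • ver ψ ψ) (ver ψ A) (star (ver ψ A))
      (ver A A) (star (ver A A)) (-(3 / 2) * k) (3 / 4 * k) (3 / 2 * k ^ 2) := by
  have h5 : dot3 ψ (star A) = 0 := by rw [← hψ, dot3_star, h2, star_zero]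
  have h6 : dot3 (star A) (star A) = 0 := by rw [dot3_star, h3, star_zero]
  have e1 := (dot3_comm A ψ).trans h2
  have e2 := (dot3_comm (star A) ψ).trans h5
  have e3 := (dot3_comm (star A) A).trans h4
  constructor
  all_goals try simp only [← ver_star, hψ, lorentz_sub_left, lorentz_sub_right, lorentz_smul_left,
    lorentz_smul_right, lorentz_ver, h1, h2, h3, h4, h5, h6, e1, e2, e3]
  case a_ne => exact mul_ne_zero (by norm_num) hk
  case b_ne => exact mul_ne_zero (by norm_num) hk
  case c_ne => exact mul_ne_zero (by norm_num) (pow_ne_zero 2 hk)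
  all_goals ring

/-! ### Moebius transformations and the inverse of the Veronese map -/

/-- The image of `(1, x)` is light-like; if its time component vanished it would be zero,
contradicting `⟨(1, x), e₀⟩ = -1`. Dividing by that component, of either sign, gives a point of the
sphere. -/
theorem exists_moebius (A : (Fin 6 → ℝ) →ₗ[ℝ] (Fin 6 → ℝ))
    (hA : ∀ v w, lorentz (A v) (A w) = lorentz v w) :
    ∃ T : S4 → S4, ∀ x : S4, A (lightVec x) 0 ≠ 0 ∧
      A (lightVec x) = A (lightVec x) 0 • lightVec (T x) := by
  have hnull : ∀ x : S4, ∑ i : Fin 5, A (lightVec x) i.succ ^ 2 = A (lightVec x) 0 ^ 2 := by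
    intro x
    have := (hA (lightVec x) (lightVec x)).trans (lorentz_lightVec x (by simp))
    simp only [lorentz, ← pow_two] at this
    linarith
  have hne : ∀ x : S4, A (lightVec x) 0 ≠ 0 := by
    intro x h0
    have h1 := hnull x
    rw [h0, zero_pow two_ne_zero,
      Finset.sum_eq_zero_iff_of_nonneg fun i _ => sq_nonneg _] at h1
    have h2 : A (lightVec x) = 0 := by
      ext i
      refine Fin.cases h0 (fun i => ?_) i
      exact pow_eq_zero_iff two_ne_zero |>.1 (h1 i (Finset.mem_univ i))
    have h3 := hA (lightVec x) (Pi.single 0 1)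
    rw [h2] at h3
    simp [lorentz, lightVec] at h3
  have hmem : ∀ x : S4, (WithLp.toLp 2 fun i : Fin 5 => A (lightVec x) i.succ / A (lightVec x) 0) ∈
      Metric.sphere (0 : EuclideanSpace ℝ (Fin 5)) 1 := by
    intro x
    have h1 : ‖(WithLp.toLp 2 fun i : Fin 5 => A (lightVec x) i.succ / A (lightVec x) 0 :
        EuclideanSpace ℝ (Fin 5))‖ ^ 2 = 1 := by
      rw [EuclideanSpace.real_norm_sq_eq]
      simp only [div_pow, ← Finset.sum_div, hnull x]
      exact div_self (pow_ne_zero 2 (hne x))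
    rw [mem_sphere_zero_iff_norm]
    exact (pow_eq_one_iff_of_nonneg (norm_nonneg _) two_ne_zero).1 h1
  refine ⟨fun x => ⟨_, hmem x⟩, fun x => ⟨hne x, ?_⟩⟩
  ext i
  refine Fin.cases ?_ (fun i => ?_) i
  · simp [lightVec]
  · exact (mul_div_cancel₀ _ (hne x)).symm

/-- A polynomial inverse, up to scale, of the Veronese map away from an equator. -/
noncomputable def verPole (v : Fin 6 → ℝ) : EuclideanSpace ℝ (Fin 3) :=
  !₂[v 2 / √3, v 1 / √3, (v 0 - 2 * v 5) / 3]

theorem contDiff_verPole : ContDiff ℝ ∞ verPole := by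
  refine (contDiff_piLp 2).2 fun i => ?_
  fin_cases i <;> simp only [verPole] <;> simp <;> fun_prop

theorem veroneseVec_smul (c : ℝ) (x : EuclideanSpace ℝ (Fin 3)) :
    veroneseVec (c • x) = c ^ 2 • veroneseVec x := by
  ext i; fin_cases i <;> simp [veroneseVec] <;> ring

/-- The light-like vector `(|x|², veroneseVec x)`. -/
noncomputable def verLight (x : EuclideanSpace ℝ (Fin 3)) : Fin 6 → ℝ :=
  Fin.cons (‖x‖ ^ 2) fun i => veroneseVec x i

/-- The entries of the Veronese vector are linear in the products `x i * x j`, and `verPole`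
extracts `x 0 * x 2`, `x 1 * x 2` and `x 2 ^ 2`. -/
theorem verPole_smul (τ : ℝ) (x : EuclideanSpace ℝ (Fin 3)) :
    verPole (τ • verLight x) = (τ * x 2) • x := by
  have h3 : √3 ≠ 0 := by positivity
  have hn := EuclideanSpace.real_norm_sq_eq x
  rw [Fin.sum_univ_three] at hn
  have e0 : verLight x 0 = x 0 ^ 2 + x 1 ^ 2 + x 2 ^ 2 := hn
  have e1 : verLight x 1 = √3 * (x 1 * x 2) := rfl
  have e2 : verLight x 2 = √3 * (x 0 * x 2) := rfl
  have e5 : verLight x 5 = (x 0 ^ 2 + x 1 ^ 2 - 2 * x 2 ^ 2) / 2 := rfl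
  ext i; fin_cases i
  · simp [verPole, e2]; field_simp
  · simp [verPole, e1]; field_simp
  · simp [verPole, e0, e5]; ring

/-- The Veronese map is homogeneous of degree 2, so the unknown `τ` and the sign of `τ * x 2`
disappear after normalisation. -/
theorem veroneseVec_verPole {v : Fin 6 → ℝ} {τ : ℝ} {x : EuclideanSpace ℝ (Fin 3)}
    (hv : v = τ • verLight x) (h : verPole v 2 ≠ 0) (i : Fin 5) :
    veroneseVec (‖verPole v‖⁻¹ • verPole v) i = v i.succ / v 0 := by
  have h1 : verPole v = (τ * x 2) • x := by rw [hv, verPole_smul]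
  have h2 : τ * x 2 * x 2 ≠ 0 := by rw [h1] at h; simpa using h
  have hτ : τ ≠ 0 := fun h0 => h2 (by simp [h0])
  have hx2 : x 2 ≠ 0 := fun h0 => h2 (by simp [h0])
  have hx : ‖x‖ ≠ 0 := fun h0 => hx2 (by rw [norm_eq_zero.1 h0]; rfl)
  have e0 : v 0 = τ * ‖x‖ ^ 2 := by rw [hv]; rfl
  have e1 : v i.succ = τ * veroneseVec x i := by rw [hv]; rfl
  rw [e0, e1, h1, smul_smul, veroneseVec_smul, norm_smul, PiLp.smul_apply, smul_eq_mul, mul_pow,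
    inv_pow, mul_pow, Real.norm_eq_abs, sq_abs]
  field_simp

theorem ver_ofReal (x : EuclideanSpace ℝ (Fin 3)) :
    ver (fun i => (x i : ℂ)) (fun i => (x i : ℂ)) = fun i => (verLight x i : ℂ) := by
  have hn := EuclideanSpace.real_norm_sq_eq x
  rw [Fin.sum_univ_three] at hn
  ext i
  refine Fin.cases ?_ (fun i => ?_) i
  · simp only [ver, dot3, verLight, Fin.cons_zero, hn, Matrix.cons_val_zero]
    push_cast; ring
  · fin_cases i <;> simp [ver, verLight, veroneseVec] <;> ring

/-! ### Surfaces that satisfy the Veronese system are Veronese surfaces -/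

/-- An isometry moves the frame at `z₀` to a model frame; along each ray from `z₀` both the moved
frame and the model solve one linear system with equal initial values. The vector `x` is obtained
ray by ray, so nothing is claimed about its dependence on `z`. -/
theorem IsIsotropicPatch.exists_veronese {u : ℂ → EuclideanSpace ℝ (Fin 5)} {Ω : Set ℂ}
    (h : IsIsotropicPatch u Ω) (hm : ∀ z ∈ Ω, mu u z = dlogKappa u z)
    (hmb : ∀ z ∈ Ω, dzbar (mu u) z = -kappaSqC u z) {z₀ : ℂ} (hz₀ : z₀ ∈ Ω) :
    ∃ A : (Fin 6 → ℝ) →ₗ[ℝ] (Fin 6 → ℝ), (∀ v w, lorentz (A v) (A w) = lorentz v w) ∧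
      ∃ r > 0, Metric.ball z₀ r ⊆ Ω ∧
      (∀ z ∈ Metric.ball z₀ r, ∃ (τ : ℝ) (x : EuclideanSpace ℝ (Fin 3)),
        A (lightVec (u z)) = τ • verLight x) ∧ verPole (A (lightVec (u z₀))) 2 ≠ 0 := by
  -- Chosen so that `A₀ = (s, -i s, 0)` is isotropic with `⟨A₀, Ā₀⟩ = 2s² = k(z₀)`, and is
  -- orthogonal to the pole `ψ₀`, where `verPole` does not vanish.
  set s : ℝ := √(kappaSq u z₀ / 2) with hs
  have hk0 := h.kappaSq_pos hz₀
  have hss : (s : ℂ) * s = kappaSqC u z₀ / 2 := by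
    rw [hs, ← Complex.ofReal_mul, Real.mul_self_sqrt (by positivity), kappaSqC]
    push_cast; ring
  set ψ₀ : Fin 3 → ℝ := ![0, 0, 1] with hψ₀
  set A₀ : Fin 3 → ℂ := ![s, -Complex.I * s, 0] with hA₀
  have hψr : star (fun i => (ψ₀ i : ℂ)) = fun i => (ψ₀ i : ℂ) := by ext i; simp
  have N1 := h.nullFrame_ver hz₀
  have N2 := nullFrame_model (ψ := fun i => (ψ₀ i : ℂ)) (A := A₀) (h.kappaSqC_ne hz₀) hψr
    (by simp [dot3, ψ₀]) (by simp [dot3, ψ₀, A₀])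
    (by simp only [dot3, A₀, Matrix.cons_val]; linear_combination (s : ℂ) * s * Complex.I_mul_I)
    (by
      simp only [dot3, A₀, Pi.star_apply, Matrix.cons_val, star_mul', star_neg, Complex.star_def,
        Complex.conj_I, Complex.conj_ofReal, map_zero]
      linear_combination 2 * hss - (s : ℂ) * s * Complex.I_mul_I)
  have hkr : star (kappaSqC u z₀) = kappaSqC u z₀ := by simp [kappaSqC]
  set L := N1.toLinearMap N2 with hL
  have hLs : ∀ v, L (star v) = star (L v) := N1.star_toLinearMap N2 (h.star_frameF hz₀)
    (h.star_frameNt hz₀) (by rw [← ver_star, hψr])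
    (by rw [star_sub, star_smul, ← ver_star, ← ver_star, hψr, star_star, ver_comm]; simp [hkr])
    (by simp [hkr]) (by simp [hkr]) (by simp [hkr])
  obtain ⟨A, hA, hAL⟩ := exists_real_isometry L hLs (N1.lorentz_toLinearMap N2)
  have hF : ∀ z ∈ Ω, ∀ ψ : Fin 3 → ℝ, L (frameF u z) = ver (fun i => (ψ i : ℂ)) (fun i => ψ i) →
      ∃ τ : ℝ, τ ≠ 0 ∧ A (lightVec (u z)) = τ • verLight (WithLp.toLp 2 ψ) := by
    intro z hz ψ hψ
    have hτ : verScale u z * liftScale u z ≠ 0 :=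
      (mul_pos (h.verScale_pos hz) (liftScale_pos (h.conformal z hz))).ne'
    refine ⟨_, inv_ne_zero hτ, (eq_inv_smul_iff₀ hτ).2 ?_⟩
    ext i
    have h1 := congrFun (hψ.trans (ver_ofReal (WithLp.toLp 2 ψ))) i
    rw [frameF, canLift_eq, smul_smul, map_smul, Pi.smul_apply, smul_eq_mul,
      show L (lightLift u z) i = (A (lightVec (u z)) i : ℂ) from
        (congrFun (hAL (lightVec (u z))) i).symm] at h1
    exact_mod_cast h1
  obtain ⟨R, hR, hball⟩ := Metric.nhds_basis_closedBall.mem_iff.1 (h.isOpen.mem_nhds hz₀)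
  have hkc : ContinuousOn (kappaSqC u) Ω := fun z hz =>
    (h.smooth_kappaSqC z hz).continuousAt.continuousWithinAt
  have hmc : ContinuousOn (mu u) Ω := fun z hz =>
    (h.smooth_mu z hz).continuousAt.continuousWithinAt
  obtain ⟨C₁, hC₁⟩ := (isCompact_closedBall z₀ R).exists_bound_of_continuousOn (hkc.mono hball)
  obtain ⟨C₂, hC₂⟩ := (isCompact_closedBall z₀ R).exists_bound_of_continuousOn (hmc.mono hball)
  set C := max C₁ C₂ with hC
  have hC0 : 0 ≤ C := ((norm_nonneg _).trans
    (hC₁ z₀ (Metric.mem_closedBall_self hR.le))).trans (le_max_left _ _)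
  -- `R` keeps the rays where `k` and `μ` are bounded by `C`; the second bound is the smallness `‖ζ‖
  -- (2 + 2C) ≤ 1/2` required by `exists_model_ray`.
  have hr0 : 0 < min R (1 / 2 / (2 + 2 * C)) := lt_min hR (by positivity)
  refine ⟨A, hA, _, hr0, (Metric.ball_subset_closedBall.trans
    (Metric.closedBall_subset_closedBall (min_le_left _ _))).trans hball, fun z hz => ?_, ?_⟩
  · set ζ := z - z₀ with hζdef
    have hζ : ‖ζ‖ < min R (1 / 2 / (2 + 2 * C)) := by rwa [← dist_eq_norm]
    have hζ2 : ‖ζ‖ * (2 + 2 * C) ≤ 1 / 2 :=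
      (le_div_iff₀ (by positivity)).1 (hζ.le.trans (min_le_right _ _))
    have hζ1 : ‖ζ‖ ≤ 1 := by
      have := mul_nonneg (norm_nonneg ζ) hC0
      linarith
    have hray : ∀ t ∈ Set.Icc (0 : ℝ) 1, z₀ + t * ζ ∈ Metric.closedBall z₀ R := by
      intro t ht
      rw [mem_closedBall_iff_norm, add_sub_cancel_left, norm_mul, Complex.norm_real,
        Real.norm_of_nonneg ht.1]
      exact (mul_le_of_le_one_left (norm_nonneg _) ht.2).trans (hζ.le.trans (min_le_left _ _))
    have hcr : ContinuousOn (fun t : ℝ => z₀ + t * ζ) (Set.Icc 0 1) := by fun_prop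
    have bk : ∀ t ∈ Set.Icc (0 : ℝ) 1, ‖kappaSqC u (z₀ + t * ζ)‖ ≤ C := fun t ht =>
      (hC₁ _ (hray t ht)).trans (le_max_left _ _)
    have bm : ∀ t ∈ Set.Icc (0 : ℝ) 1, ‖mu u (z₀ + t * ζ)‖ ≤ C := fun t ht =>
      (hC₂ _ (hray t ht)).trans (le_max_right _ _)
    obtain ⟨ψ, B, hψ0, hB0, hsys⟩ := exists_model_ray bk bm (fun t _ => by simp [kappaSqC])
      (hkc.comp hcr fun t ht => hball (hray t ht)) (hmc.comp hcr fun t ht => hball (hray t ht))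
      hζ2 ψ₀ A₀
    have hsys' := (h.frameSystem hm hmb).ray L hLs fun t ht => hball (hray t ht)
    have e0 : z₀ + ((0 : ℝ) : ℂ) * ζ = z₀ := by simp
    have e1 : z₀ + ((1 : ℝ) : ℂ) * ζ = z := by simp [hζdef]
    have hN := N1.toLinearMap_n N2
    -- The initial values of `Z` agree because on both sides `Z` is the second null vector plus
    -- `k/4` times the first.
    have key := (hsys'.sub hsys).eq_zero hζ1 bk bm
      (by rw [e0, hψ0]; exact sub_eq_zero.2 (N1.toLinearMap_p N2))
      (by rw [e0, hψ0, hB0]; exact sub_eq_zero.2 (N1.toLinearMap_x N2))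
      (by rw [e0, hB0]; exact sub_eq_zero.2 (N1.toLinearMap_w N2))
      (by
        rw [e0, hB0, frameZ, map_add, map_smul, hL, N1.toLinearMap_p N2, N1.toLinearMap_n N2]
        module)
    rw [e1, sub_eq_zero] at key
    obtain ⟨τ, -, hτ⟩ := hF z (hball (by have := hray 1 (by simp); rwa [e1] at this)) _ key
    exact ⟨τ, _, hτ⟩
  · obtain ⟨τ, hτ, h1⟩ := hF z₀ hz₀ ψ₀ (N1.toLinearMap_p N2)
    rw [h1, verPole_smul]
    simpa [ψ₀] using hτ

/-! ### Conformal maps into the 2-sphere -/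

theorem dot3_add_left (a b c : Fin 3 → ℂ) : dot3 (a + b) c = dot3 a c + dot3 b c := by
  simp only [dot3, Pi.add_apply]; ring

theorem dot3_smul_left (r : ℂ) (a b : Fin 3 → ℂ) : dot3 (r • a) b = r * dot3 a b := by
  simp only [dot3, Pi.smul_apply, smul_eq_mul]; ring

theorem HasW.dot3 {F G : ℂ → Fin 3 → ℂ} {p q p' q' : Fin 3 → ℂ} {z : ℂ} (hF : HasW F p q z)
    (hG : HasW G p' q' z) : HasW (fun w => dot3 (F w) (G w)) (dot3 p (G z) + dot3 (F z) p')
      (dot3 q (G z) + dot3 (F z) q') z := by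
  have hF' := hasW_pi.1 hF
  have hG' := hasW_pi.1 hG
  refine ((((hF' 0).mul (hG' 0)).add ((hF' 1).mul (hG' 1))).add
    ((hF' 2).mul (hG' 2))).congr_val ?_ ?_ <;> simp only [MoebiusGeometry.dot3] <;> ring

theorem dot3_expand {p x x' : Fin 3 → ℂ} {k : ℂ} (hk : k ≠ 0) (hpp : dot3 p p = 1)
    (hpx : dot3 p x = 0) (hpx' : dot3 p x' = 0) (hxx : dot3 x x = 0) (hxx' : dot3 x x' = k)
    (hx'x' : dot3 x' x' = 0) (v : Fin 3 → ℂ) :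
    v = dot3 v p • p + (dot3 v x' / k) • x + (dot3 v x / k) • x' := by
  let E : Matrix (Fin 3) (Fin 3) ℂ := Matrix.of fun i j => ![p, x, x'] j i
  let D : Matrix (Fin 3) (Fin 3) ℂ := Matrix.of fun j i => ![p, k⁻¹ • x', k⁻¹ • x] j i
  have hDE : D * E = 1 := by
    have key : ∀ i j, (D * E) i j = dot3 (![p, k⁻¹ • x', k⁻¹ • x] i) (![p, x, x'] j) := by
      intro i j
      rw [Matrix.mul_apply, Fin.sum_univ_three]
      rfl
    have h1 := (dot3_comm x p).trans hpx
    have h2 := (dot3_comm x' p).trans hpx'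
    have h3 := (dot3_comm x' x).trans hxx'
    ext i j
    rw [key]
    clear key
    fin_cases i <;> fin_cases j <;> simp [dot3_smul_left, *]
  have hED : E * D = 1 := mul_eq_one_comm.1 hDE
  have hv : v = E.mulVec (D.mulVec v) := by rw [Matrix.mulVec_mulVec, hED, Matrix.one_mulVec]
  have hD : D.mulVec v = ![dot3 v p, dot3 v x' / k, dot3 v x / k] := by
    have key : ∀ i, D.mulVec v i = dot3 (![p, k⁻¹ • x', k⁻¹ • x] i) v := by
      intro i
      rw [Matrix.mulVec, dotProduct, Fin.sum_univ_three]
      rfl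
    ext i
    rw [key]
    fin_cases i <;> simp [dot3_smul_left, dot3_comm v, div_eq_inv_mul]
  rw [hD] at hv
  conv_lhs => rw [hv]
  ext i
  simp [Matrix.mulVec, dotProduct, Fin.sum_univ_succ, E]
  ring

/-- `ψ` is a real conformal immersion of the open set `Ω` into the unit sphere of `ℝ³ ⊂ ℂ³`. -/
structure IsSpherePatch (ψ : ℂ → Fin 3 → ℂ) (Ω : Set ℂ) : Prop where
  isOpen : IsOpen Ω
  smooth : SmoothOn Ω ψ
  real : ∀ z ∈ Ω, star (ψ z) = ψ z
  norm : ∀ z ∈ Ω, dot3 (ψ z) (ψ z) = 1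
  conformal : ∀ z ∈ Ω, dot3 (dz ψ z) (dz ψ z) = 0
  ne_zero : ∀ z ∈ Ω, dot3 (dz ψ z) (star (dz ψ z)) ≠ 0

/-- The conformal factor `⟨ψ_z, ψ_z̄⟩`. -/
noncomputable def sphereFactor (ψ : ℂ → Fin 3 → ℂ) (z : ℂ) : ℂ := dot3 (dz ψ z) (star (dz ψ z))

theorem dot3_dz {ψ : ℂ → Fin 3 → ℂ} {Ω : Set ℂ} (hΩ : IsOpen Ω) (hs : SmoothOn Ω ψ)
    (hn : ∀ z ∈ Ω, dot3 (ψ z) (ψ z) = 1) {z : ℂ} (hz : z ∈ Ω) : dot3 (ψ z) (dz ψ z) = 0 := by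
  have h1 := ((hs.hasW hz).dot3 (hs.hasW hz)).unique ((hasW_const (1 : ℂ) z).congr_on hΩ hz hn)
  have h2 := dot3_comm (dz ψ z) (ψ z)
  linear_combination 1 / 2 * h1.1 - 1 / 2 * h2

namespace IsSpherePatch

variable {ψ : ℂ → Fin 3 → ℂ} {Ω : Set ℂ} (h : IsSpherePatch ψ Ω) {z : ℂ} (hz : z ∈ Ω)

include h hz

theorem hasW : HasW ψ (dz ψ z) (star (dz ψ z)) z :=
  dz_real_pi h.isOpen hz h.real (h.smooth.hasW hz) ▸ h.smooth.hasW hz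

theorem star_dzbar_dz : star (dzbar (dz ψ) z) = dzbar (dz ψ) z :=
  (HasW.comm_on h.isOpen hz (fun _ hw => h.hasW hw) (h.smooth.dz.hasW hz)
    (h.smooth.dz.hasW hz).conj_pi).symm

/-- The structure equations of the round sphere, read off by expanding `ψ_zz` and `ψ_zz̄` in the
basis `ψ, ψ_z, ψ_z̄`. -/
theorem hasW_dz : HasW (dz ψ) ((dz (sphereFactor ψ) z / sphereFactor ψ z) • dz ψ z)
    (-sphereFactor ψ z • ψ z) z := by
  have hP := h.smooth.dz.hasW hz
  have r1 := h.norm z hz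
  have r2 := dot3_dz h.isOpen h.smooth h.norm hz
  have r3 := h.conformal z hz
  have r4 : dot3 (ψ z) (star (dz ψ z)) = 0 := by rw [← h.real z hz, dot3_star, r2, star_zero]
  have r5 : dot3 (star (dz ψ z)) (star (dz ψ z)) = 0 := by rw [dot3_star, r3, star_zero]
  have hB := h.star_dzbar_dz hz
  have e1 := (hP.dot3 hP).unique ((hasW_const (0 : ℂ) z).congr_on h.isOpen hz h.conformal)
  have e2 := ((h.hasW hz).dot3 hP).unique ((hasW_const (0 : ℂ) z).congr_on h.isOpen hz
    fun w hw => dot3_dz h.isOpen h.smooth h.norm hw)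
  have e3 : dz (sphereFactor ψ) z = _ := (hP.dot3 hP.conj_pi).dz_eq
  rw [hB] at e3
  have c1 := dot3_comm (dz ψ z) (dz (dz ψ) z)
  have c2 := dot3_comm (dz ψ z) (dzbar (dz ψ) z)
  have c3 := dot3_comm (ψ z) (dz (dz ψ) z)
  have c4 := dot3_comm (ψ z) (dzbar (dz ψ) z)
  have c5 := dot3_comm (dz ψ z) (star (dz ψ z))
  have f1 : dot3 (dz (dz ψ) z) (dz ψ z) = 0 := by linear_combination 1 / 2 * e1.1 - 1 / 2 * c1
  have f2 : dot3 (dzbar (dz ψ) z) (dz ψ z) = 0 := by linear_combination 1 / 2 * e1.2 - 1 / 2 * c2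
  have f3 : dot3 (dz (dz ψ) z) (ψ z) = 0 := by linear_combination e2.1 - r3 - c3
  have f4 : dot3 (dzbar (dz ψ) z) (ψ z) = -sphereFactor ψ z := by
    rw [sphereFactor]; linear_combination e2.2 - c4 + c5
  have f5 : dot3 (dz (dz ψ) z) (star (dz ψ z)) = dz (sphereFactor ψ) z := by
    linear_combination -e3 - c2 - f2
  have f6 : dot3 (dzbar (dz ψ) z) (star (dz ψ z)) = 0 := by
    rw [← hB, dot3_star, f2, star_zero]
  refine hP.congr_val ?_ ?_
  · have := dot3_expand (h.ne_zero z hz) r1 r2 r4 r3 rfl r5 (dz (dz ψ) z)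
    rw [f1, f3, f5] at this
    rw [this, sphereFactor]
    module
  · have := dot3_expand (h.ne_zero z hz) r1 r2 r4 r3 rfl r5 (dzbar (dz ψ) z)
    rw [f2, f4, f6] at this
    rw [this]
    module

omit hz in
theorem smooth_sphereFactor : SmoothOn Ω (sphereFactor ψ) := by
  have h1 := smoothOn_pi.1 h.smooth.dz
  exact (((h1 0).mul (h1 0).conj).add ((h1 1).mul (h1 1).conj)).add ((h1 2).mul (h1 2).conj)

/-- This says that the pulled-back round metric `2 ⟨ψ_z, ψ_z̄⟩ |dz|²` has Gauss curvature 1. It is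
the `ψ_z`-component of the equality of mixed derivatives of `ψ_z`. -/
theorem dzbar_dlog :
    dzbar (fun w => dz (sphereFactor ψ) w / sphereFactor ψ w) z = -sphereFactor ψ z := by
  have hk := h.smooth_sphereFactor
  have hm : SmoothOn Ω fun w => dz (sphereFactor ψ) w / sphereFactor ψ w :=
    hk.dz.div hk fun z hz => h.ne_zero z hz
  have hk0 : sphereFactor ψ z ≠ 0 := h.ne_zero z hz
  have e := HasW.comm_on h.isOpen hz (fun w hw => h.hasW_dz hw)
    ((hm.hasW hz).smul (h.hasW_dz hz)) ((hk.hasW hz).neg.smul (h.hasW hz))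
  have e1 := congrArg (fun v => dot3 v (star (dz ψ z))) e
  have r2 := dot3_dz h.isOpen h.smooth h.norm hz
  have r4 : dot3 (ψ z) (star (dz ψ z)) = 0 := by rw [← h.real z hz, dot3_star, r2, star_zero]
  simp only [dot3_add_left, dot3_smul_left, r4] at e1
  rw [← sphereFactor] at e1
  refine mul_right_cancel₀ hk0 ?_
  linear_combination e1

end IsSpherePatch

/-! ### The Veronese surface has Moebius curvature 1/2 -/

/-- `κ` and `Y_zz` differ by a multiple of the null vector `Y`, which is orthogonal to `Y_zz`. The
right side is visibly preserved by a Lorentz isometry applied to the lift. -/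
theorem lorentz_kappa_eq {u : ℂ → EuclideanSpace ℝ (Fin 5)} {Ω : Set ℂ}
    (h : IsCanonicalLift (canLift u) Ω) {z : ℂ} (hz : z ∈ Ω) :
    lorentz (kappa u z) (star (kappa u z)) =
      lorentz (dz (dz (canLift u)) z) (star (dz (dz (canLift u)) z)) := by
  have h1 := h.Y_dz_dz hz
  have h2 : lorentz (canLift u z) (star (dz (dz (canLift u)) z)) = 0 := by
    rw [← h.real z hz, lorentz_star, h1, star_zero]
  rw [h.kappa_eq hz, star_add, star_smul, h.real z hz]
  simp only [lorentz_add_left, lorentz_add_right, lorentz_smul_left, lorentz_smul_right,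
    lorentz_comm _ (canLift u z), h1, h2, h.null z hz]
  ring

/-- If a canonical lift is a multiple of `ver ψ ψ` then `ψ` is conformal, and its conformal
factor is the norm of the second derivative of the lift. -/
theorem IsCanonicalLift.isSpherePatch {H : ℂ → Fin 6 → ℂ} {Ω : Set ℂ} (h : IsCanonicalLift H Ω)
    {ψ : ℂ → Fin 3 → ℂ} {s : ℂ → ℂ} (hψ : SmoothOn Ω ψ) (hψr : ∀ z ∈ Ω, star (ψ z) = ψ z)
    (hn : ∀ z ∈ Ω, dot3 (ψ z) (ψ z) = 1) (hs : SmoothOn Ω s) (hsr : ∀ z ∈ Ω, star (s z) = s z)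
    (hs0 : ∀ z ∈ Ω, s z ≠ 0) (hH : ∀ z ∈ Ω, H z = s z • ver (ψ z) (ψ z)) : IsSpherePatch ψ Ω ∧ ∀ z ∈ Ω,
      lorentz (dz (dz H) z) (star (dz (dz H) z)) = sphereFactor ψ z := by
  have hψW : ∀ z ∈ Ω, HasW ψ (dz ψ z) (star (dz ψ z)) z := fun z hz =>
    dz_real_pi h.isOpen hz hψr (hψ.hasW hz) ▸ hψ.hasW hz
  have hHW : ∀ z ∈ Ω, HasW H (dz s z • ver (ψ z) (ψ z) + (2 * s z) • ver (ψ z) (dz ψ z))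
      (dzbar s z • ver (ψ z) (ψ z) + (2 * s z) • ver (ψ z) (star (dz ψ z))) z := fun z hz =>
    (((hs.hasW hz).smul ((hψW z hz).ver (hψW z hz))).congr_on h.isOpen hz hH).congr_val
      (by rw [ver_comm (dz ψ z)]; module) (by rw [ver_comm (star (dz ψ z))]; module)
  have r2 : ∀ z ∈ Ω, dot3 (ψ z) (dz ψ z) = 0 := fun z hz => dot3_dz h.isOpen hψ hn hz
  have r4 : ∀ z ∈ Ω, dot3 (ψ z) (star (dz ψ z)) = 0 := fun z hz => by
    rw [← hψr z hz, dot3_star, r2 z hz, star_zero]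
  have hc : ∀ z ∈ Ω, dot3 (dz ψ z) (dz ψ z) = 0 := by
    intro z hz
    have e := h.zz z hz
    rw [(hHW z hz).dz_eq] at e
    simp only [lorentz_add_left, lorentz_add_right, lorentz_smul_left, lorentz_smul_right,
      lorentz_ver, dot3_comm (dz ψ z) (ψ z), hn z hz, r2 z hz] at e
    have : 3 * s z ^ 2 * dot3 (dz ψ z) (dz ψ z) = 0 := by linear_combination e
    exact (mul_eq_zero.1 this).resolve_left
      (mul_ne_zero three_ne_zero (pow_ne_zero 2 (hs0 z hz)))
  -- The normalisation `⟨H_z, H_z̄⟩ = 1/2` reads `3 s² ⟨ψ_z, ψ_z̄⟩ = 1/2`; in particular `ψ` is an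
  -- immersion.
  have hk : ∀ z ∈ Ω, s z * s z * sphereFactor ψ z = 1 / 6 := by
    intro z hz
    have e := h.zzbar z hz
    rw [(hHW z hz).dz_eq, (hHW z hz).dzbar_eq] at e
    simp only [lorentz_add_left, lorentz_add_right, lorentz_smul_left, lorentz_smul_right,
      lorentz_ver, dot3_comm (dz ψ z) (ψ z), hn z hz, r2 z hz,
      r4 z hz] at e
    rw [sphereFactor]
    linear_combination 1 / 3 * e
  have S : IsSpherePatch ψ Ω := ⟨h.isOpen, hψ, hψr, hn, hc, fun z hz h0 => by
    have := hk z hz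
    rw [sphereFactor, h0] at this
    norm_num at this⟩
  refine ⟨S, fun z hz => ?_⟩
  have e := (((hs.hasW hz).mul (hs.hasW hz)).mul (S.smooth_sphereFactor.hasW hz)).unique
    ((hasW_const (1 / 6 : ℂ) z).congr_on h.isOpen hz hk)
  have hk0 : sphereFactor ψ z ≠ 0 := S.ne_zero z hz
  -- The derivative of `s² ⟨ψ_z, ψ_z̄⟩ = 1/6`. The left side is the coefficient of `ver ψ ψ_z` in
  -- `H_zz`, which therefore disappears.
  have e1 : 4 * dz s z + 2 * s z * (dz (sphereFactor ψ) z / sphereFactor ψ z) = 0 := by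
    have e2 : s z * (4 * dz s z + 2 * s z * (dz (sphereFactor ψ) z / sphereFactor ψ z)) = 0 := by
      field_simp
      linear_combination 2 * e.1
    exact (mul_eq_zero.1 e2).resolve_left (hs0 z hz)
  have hHH := ((((hs.dz.hasW hz).smul ((hψW z hz).ver (hψW z hz))).add
    (((hs.hasW hz).const_mul 2).smul ((hψW z hz).ver (S.hasW_dz hz)))).congr_on h.isOpen hz
      fun w hw => (hHW w hw).dz_eq).dz_eq
  have hHH' : dz (dz H) z = dz (dz s) z • ver (ψ z) (ψ z) + (2 * s z) • ver (dz ψ z) (dz ψ z) := by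
    rw [hHH, ver_comm (dz ψ z) (ψ z), ver_smul_right]
    have : dz (dz s) z • ver (ψ z) (ψ z) + dz s z • (ver (ψ z) (dz ψ z) + ver (ψ z) (dz ψ z)) +
        ((2 * dz s z) • ver (ψ z) (dz ψ z) + (2 * s z) • (ver (dz ψ z) (dz ψ z) +
          (dz (sphereFactor ψ) z / sphereFactor ψ z) • ver (ψ z) (dz ψ z))) =
        dz (dz s) z • ver (ψ z) (ψ z) + (2 * s z) • ver (dz ψ z) (dz ψ z) +
        (4 * dz s z + 2 * s z * (dz (sphereFactor ψ) z / sphereFactor ψ z)) •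
          ver (ψ z) (dz ψ z) := by module
    rw [this, e1, zero_smul, add_zero]
  have r5 : dot3 (star (dz ψ z)) (star (dz ψ z)) = 0 := by rw [dot3_star, hc z hz, star_zero]
  have h2s : star (2 * s z) = 2 * s z := by rw [star_mul', hsr z hz, star_ofNat]
  rw [hHH', star_add, star_smul, star_smul, h2s, ← ver_star, ← ver_star, hψr z hz]
  simp only [lorentz_add_left, lorentz_add_right, lorentz_smul_left, lorentz_smul_right,
    lorentz_ver, dot3_comm (dz ψ z) (ψ z), hn z hz, r2 z hz, r4 z hz, r5, hc z hz]
  rw [← sphereFactor]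
  linear_combination 6 * sphereFactor ψ z * hk z hz

/-- The complexification of a linear map of Minkowski space. -/
noncomputable def complexify (A : (Fin 6 → ℝ) →ₗ[ℝ] (Fin 6 → ℝ)) :
    (Fin 6 → ℂ) →ₗ[ℂ] (Fin 6 → ℂ) where
  toFun v i := (A (fun j => (v j).re) i : ℂ) + Complex.I * (A (fun j => (v j).im) i : ℂ)
  map_add' v w := by
    have h1 : (fun j => ((v + w) j).re) = (fun j => (v j).re) + fun j => (w j).re := by
      ext j; simp
    have h2 : (fun j => ((v + w) j).im) = (fun j => (v j).im) + fun j => (w j).im := by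
      ext j; simp
    rw [h1, h2, map_add, map_add]
    ext i
    simp
    ring
  map_smul' c v := by
    have h1 : (fun j => ((c • v) j).re) = c.re • (fun j => (v j).re) - c.im • fun j => (v j).im := by
      ext j; simp
    have h2 : (fun j => ((c • v) j).im) = c.re • (fun j => (v j).im) + c.im • fun j => (v j).re := by
      ext j; simp
    rw [h1, h2, map_add, map_sub]
    ext i
    simp only [map_smul, Pi.sub_apply, Pi.add_apply, Pi.smul_apply, smul_eq_mul, RingHom.id_apply]
    conv_rhs => rw [← Complex.re_add_im c]
    push_cast
    linear_combination ((c.im : ℂ) * (A (fun j => (v j).im) i : ℂ)) * -Complex.I_mul_I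

theorem complexify_ofReal (A : (Fin 6 → ℝ) →ₗ[ℝ] (Fin 6 → ℝ)) (v : Fin 6 → ℝ) :
    complexify A (fun i => (v i : ℂ)) = fun i => (A v i : ℂ) := by
  ext i
  have : A (fun _ => 0) = 0 := map_zero A
  simp [complexify, this]

theorem complexify_star (A : (Fin 6 → ℝ) →ₗ[ℝ] (Fin 6 → ℝ)) (v : Fin 6 → ℂ) :
    complexify A (star v) = star (complexify A v) := by
  ext i
  have : (fun j => -(v j).im) = -fun j => (v j).im := rfl
  simp [complexify, this]

theorem lorentz_complexify {A : (Fin 6 → ℝ) →ₗ[ℝ] (Fin 6 → ℝ)}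
    (hA : ∀ v w, lorentz (A v) (A w) = lorentz v w) (v w : Fin 6 → ℂ) :
    lorentz (complexify A v) (complexify A w) = lorentz v w := by
  have key : ∀ v : Fin 6 → ℂ, v = (fun j => ((v j).re : ℂ)) + Complex.I • fun j => ((v j).im : ℂ) :=
    fun v => by ext j; simp [mul_comm Complex.I]
  rw [key v, key w]
  simp only [map_add, map_smul, complexify_ofReal, lorentz_add_left, lorentz_add_right,
    lorentz_smul_left, lorentz_smul_right, lorentz_ofReal, hA]

theorem IsIsotropicPatch.dzbar_dlogKappa_of_veronese {u : ℂ → EuclideanSpace ℝ (Fin 5)} {Ω : Set ℂ}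
    (h : IsIsotropicPatch u Ω) {A : (Fin 6 → ℝ) →ₗ[ℝ] (Fin 6 → ℝ)}
    (hA : ∀ v w, lorentz (A v) (A w) = lorentz v w) {ψ : ℂ → EuclideanSpace ℝ (Fin 3)}
    (hψ : SmoothOn Ω ψ) (hn : ∀ z ∈ Ω, ‖ψ z‖ = 1)
    (hAψ : ∀ z ∈ Ω, ∃ r : ℝ, r ≠ 0 ∧ A (lightVec (u z)) = r • lightVec (veroneseVec (ψ z)))
    {z : ℂ} (hz : z ∈ Ω) : dzbar (dlogKappa u) z = -kappaSqC u z := by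
  set L := complexify A with hL
  have hY := h.lift
  have hd : ∀ z ∈ Ω, HasW (fun w => L (canLift u w)) (L (dz (canLift u) z))
      (L (dzbar (canLift u) z)) z := fun z hz => (hY.smooth.hasW hz).linear L
  have hdd : ∀ z ∈ Ω, dz (dz fun w => L (canLift u w)) z = L (dz (dz (canLift u)) z) :=
    fun z hz => (((hY.smooth.dz.hasW hz).linear L).congr_on h.isOpen hz
      fun w hw => (hd w hw).dz_eq).dz_eq
  have hLs : SmoothOn Ω fun w => L (canLift u w) := fun z hz =>
    (L.toContinuousLinearMap.restrictScalars ℝ).contDiff.contDiffAt.comp z (hY.smooth z hz)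
  have hH : IsCanonicalLift (fun w => L (canLift u w)) Ω := by
    refine ⟨h.isOpen, hLs, fun z hz => ?_, fun z hz => ?_, fun z hz => ?_, fun z hz => ?_⟩
    · rw [← complexify_star, hY.real z hz]
    · rw [lorentz_complexify hA, hY.null z hz]
    · rw [(hd z hz).dz_eq, lorentz_complexify hA, hY.zz z hz]
    · rw [(hd z hz).dz_eq, (hd z hz).dzbar_eq, lorentz_complexify hA, hY.zzbar z hz]
  have hv : ∀ z ∈ Ω, verLight (ψ z) = lightVec (veroneseVec (ψ z)) := fun z hz => by
    rw [verLight, lightVec, hn z hz, one_pow]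
  -- The scale `r` exists only pointwise; expressing it through the time component of `L Y` shows
  -- that it varies smoothly.
  have hAL : ∀ z ∈ Ω, (L (canLift u z) 0 ≠ 0) ∧ L (canLift u z) = L (canLift u z) 0 •
      ver (fun i => (ψ z i : ℂ)) (fun i => (ψ z i : ℂ)) := by
    intro z hz
    obtain ⟨r, hr, e⟩ := hAψ z hz
    have e1 : L (canLift u z) = ((liftScale u z * r : ℝ) : ℂ) •
        ver (fun i => (ψ z i : ℂ)) (fun i => (ψ z i : ℂ)) := by
      rw [ver_ofReal, hv z hz, canLift_eq, map_smul, show L (lightLift u z) =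
        fun i => (A (lightVec (u z)) i : ℂ) from complexify_ofReal A _, e]
      ext i
      simp [mul_assoc]
    have e2 : L (canLift u z) 0 = ((liftScale u z * r : ℝ) : ℂ) := by
      rw [e1, ver_ofReal, hv z hz]
      simp [lightVec]
    rw [e2]
    exact ⟨by exact_mod_cast mul_ne_zero (liftScale_pos (h.conformal z hz)).ne' hr, e1⟩
  have hψC : SmoothOn Ω fun z i => (ψ z i : ℂ) := smoothOn_pi.2 fun i =>
    SmoothOn.ofReal fun z hz => ((contDiff_piLp_apply (p := 2)).contDiffAt.comp z (hψ z hz))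
  obtain ⟨S, hS⟩ := hH.isSpherePatch hψC (fun z _ => by ext i; simp)
    (fun z hz => by
      have := EuclideanSpace.real_norm_sq_eq (ψ z)
      rw [hn z hz, Fin.sum_univ_three] at this
      simp only [dot3, ← pow_two]
      exact_mod_cast this.symm.trans (one_pow 2)) (smoothOn_pi.1 hLs 0)
    (fun z hz => (congrFun (hH.real z hz) 0 :)) (fun z hz => (hAL z hz).1) fun z hz => (hAL z hz).2
  have hk : ∀ z ∈ Ω, kappaSqC u z = sphereFactor (fun z i => (ψ z i : ℂ)) z := fun z hz => by
    rw [← hS z hz, hdd z hz, ← complexify_star, lorentz_complexify hA, ← h.lorentz_kappa hz,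
      lorentz_kappa_eq hY hz]
  have hdk : ∀ z ∈ Ω, dz (kappaSqC u) z = dz (sphereFactor fun z i => (ψ z i : ℂ)) z :=
    fun z hz => ((S.smooth_sphereFactor.hasW hz).congr_on h.isOpen hz hk).dz_eq
  have hm : ∀ z ∈ Ω, dlogKappa u z = dz (sphereFactor fun z i => (ψ z i : ℂ)) z /
      sphereFactor (fun z i => (ψ z i : ℂ)) z := fun z hz => by
    rw [dlogKappa, hdk z hz, hk z hz]
  have hms := h.smooth_dlogKappa.congr h.isOpen fun z hz => (hm z hz).symm
  rw [((hms.hasW hz).congr_on h.isOpen hz hm).dzbar_eq, S.dzbar_dlog hz, hk z hz]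

/-! ### Surfaces in local coordinates -/

section Coordinates

variable {M : Type*} [TopologicalSpace M] [ChartedSpace ℂ M]

/-- Complex analytic coordinate changes are real smooth, so holomorphic charts may be used for maps
smooth over `ℝ`. -/
theorem contDiffGroupoid_complex_le_real :
    contDiffGroupoid ω 𝓘(ℂ) ≤ contDiffGroupoid ∞ 𝓘(ℝ, ℂ) := by
  intro e he
  obtain ⟨h1, h2⟩ := mem_groupoid_of_pregroupoid.1 he
  exact mem_groupoid_of_pregroupoid.2 ⟨(h1.restrict_scalars ℝ).of_le le_top,
    (h2.restrict_scalars ℝ).of_le le_top⟩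

theorem mem_maximalAtlas_real {e : OpenPartialHomeomorph M ℂ}
    (he : e ∈ IsManifold.maximalAtlas 𝓘(ℂ) ω M) : e ∈ IsManifold.maximalAtlas 𝓘(ℝ, ℂ) ∞ M :=
  mem_maximalAtlas_iff.2 fun e' he' => (mem_maximalAtlas_iff.1 he e' he').imp
    (fun h => contDiffGroupoid_complex_le_real h) fun h => contDiffGroupoid_complex_le_real h

theorem smoothOn_comp_symm {W : Type*} [NormedAddCommGroup W] [NormedSpace ℝ W] {f : M → W}
    {U : Set M} (hf : ContMDiffOn 𝓘(ℝ, ℂ) 𝓘(ℝ, W) ∞ f U) (hU : IsOpen U)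
    {e : OpenPartialHomeomorph M ℂ} (he : e ∈ IsManifold.maximalAtlas 𝓘(ℂ) ω M) :
    SmoothOn (e.target ∩ e.symm ⁻¹' U) fun z => f (e.symm z) := by
  intro z hz
  have h1 := hf.comp ((contMDiffOn_symm_of_mem_maximalAtlas (mem_maximalAtlas_real he)).mono
    Set.inter_subset_left) (s := e.target ∩ e.symm ⁻¹' U) fun z hz => hz.2
  exact (contMDiffOn_iff_contDiffOn.1 h1).contDiffAt
    ((e.isOpen_inter_preimage_symm hU).mem_nhds hz)

theorem isIsotropicPatch_localExpr {y : M → S4} (hy : IsConformalImmersion y)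
    (hiso : IsIsotropic y) (humb : HasNoUmbilics y) {e : OpenPartialHomeomorph M ℂ}
    (he : e ∈ IsManifold.maximalAtlas 𝓘(ℂ) ω M) : IsIsotropicPatch (localExpr y e) e.target where
  isOpen := e.open_target
  smooth := by
    have := smoothOn_comp_symm hy.smooth.contMDiffOn isOpen_univ he
    exact this.mono fun z hz => ⟨hz, Set.mem_univ _⟩
  conformal := hy.conformal e he
  norm_eq z _ := by simp [localExpr]
  isotropic := hiso e he
  kappa_ne := humb e he

end Coordinates

/-! ### From the scalar equations to the conditions of the theorem -/

theorem IsIsotropicPatch.mono {u : ℂ → EuclideanSpace ℝ (Fin 5)} {Ω Ω' : Set ℂ}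
    (h : IsIsotropicPatch u Ω) (hΩ' : IsOpen Ω') (hs : Ω' ⊆ Ω) : IsIsotropicPatch u Ω' :=
  ⟨⟨hΩ', h.smooth.mono hs, fun z hz => h.conformal z (hs hz), fun z hz => h.norm_eq z (hs hz)⟩,
    fun z hz => h.isotropic z (hs hz), fun z hz => h.kappa_ne z (hs hz)⟩

theorem IsIsotropicPatch.moebiusCurvature_eq_half_iff {u : ℂ → EuclideanSpace ℝ (Fin 5)}
    {Ω : Set ℂ} (h : IsIsotropicPatch u Ω) {z : ℂ} (hz : z ∈ Ω) :
    moebiusCurvature u z = 1 / 2 ↔ dzbar (dlogKappa u) z = -kappaSqC u z := by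
  have hk := h.kappaSqC_ne hz
  rw [← Complex.ofReal_inj, h.moebiusCurvature_eq hz, div_eq_iff (mul_ne_zero two_ne_zero hk)]
  push_cast
  constructor <;> intro h1
  · linear_combination -h1
  · linear_combination -h1

theorem IsIsotropicPatch.moebiusCurvature_of_norm_invP {u : ℂ → EuclideanSpace ℝ (Fin 5)}
    {Ω : Set ℂ} (h : IsIsotropicPatch u Ω) {c : ℝ} (hc : c ≠ 0) (hP : ∀ z ∈ Ω, ‖invP u z‖ = c)
    {z : ℂ} (hz : z ∈ Ω) : moebiusCurvature u z = 1 / 2 := by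
  refine (h.moebiusCurvature_eq_half_iff hz).2 (h.scalarSystem.dzbar_l_of_normSq (c := (c : ℂ))
    (by exact_mod_cast hc) (fun z hz => ?_) hz)
  have hk := h.kappaSq_pos hz
  have h1 := hP z hz
  rw [invP, h.rho_eq hz, h.lorentz_kappa hz, norm_div, norm_star, kappaSqC, Complex.norm_real,
    Real.norm_of_nonneg hk.le, div_eq_iff hk.ne'] at h1
  rw [kappaSqC, Complex.star_def, Complex.mul_conj', h1]
  push_cast; ring

theorem IsIsotropicPatch.invP_eq {u : ℂ → EuclideanSpace ℝ (Fin 5)} {Ω : Set ℂ}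
    (h : IsIsotropicPatch u Ω) (hl : ∀ z ∈ Ω, dzbar (dlogKappa u) z = -kappaSqC u z)
    {z : ℂ} (hz : z ∈ Ω) : invP u z = -3 := by
  have hk := h.kappaSqC_ne hz
  rw [invP, h.rho_eq hz, h.lorentz_kappa hz, (h.scalarSystem.defect_eq_zero hl hz).1,
    div_eq_iff hk]
  simp [kappaSqC]

theorem contDiff_lightVec : ContDiff ℝ ∞ lightVec := by
  refine contDiff_pi.2 fun i => Fin.cases ?_ (fun i => ?_) i
  · exact contDiff_const
  · exact contDiff_piLp_apply (p := 2)

section Surface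

variable {M : Type*} [TopologicalSpace M] [ChartedSpace ℂ M]

/-- The ODE argument only shows that `A (1, y)` lies on the Veronese cone. The smooth map `ψ` is
defined instead as the normalisation of `verPole (A (1, y))`, near the point, where its last
coordinate is non-zero. -/
theorem isLocallyVeronese_of_curvature [IsManifold 𝓘(ℂ) ω M] {y : M → S4}
    (hy : IsConformalImmersion y) (hiso : IsIsotropic y) (humb : HasNoUmbilics y)
    (hK : InCoordinates y fun u z => moebiusCurvature u z = 1 / 2) : IsLocallyVeronese y := by
  intro p
  set e := chartAt ℂ p
  have he : e ∈ IsManifold.maximalAtlas 𝓘(ℂ) ω M := IsManifold.chart_mem_maximalAtlas p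
  have h := isIsotropicPatch_localExpr hy hiso humb he
  have hp : p ∈ e.source := mem_chart_source ℂ p
  have hl : ∀ z ∈ e.target, dzbar (dlogKappa (localExpr y e)) z = -kappaSqC (localExpr y e) z :=
    fun z hz => (h.moebiusCurvature_eq_half_iff hz).1 (hK e he z hz)
  obtain ⟨A, hA, r, hr, -, hτ, hpole⟩ := h.exists_veronese
    (fun z hz => (h.scalarSystem.defect_eq_zero hl hz).2)
    (fun z hz => by linear_combination (h.scalarSystem.defect_eq_zero hl hz).1) (e.map_source hp)
  have hu : ∀ q ∈ e.source, localExpr y e (e q) = y q := fun q hq => by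
    rw [localExpr, e.left_inv hq]
  rw [hu p hp] at hpole
  set g : EuclideanSpace ℝ (Fin 5) → EuclideanSpace ℝ (Fin 3) := fun x => verPole (A (lightVec x))
    with hg
  have hgs : ContDiff ℝ ∞ g := contDiff_verPole.comp
    ((LinearMap.toContinuousLinearMap A).contDiff.comp contDiff_lightVec)
  have hyc : Continuous fun q => (y q : EuclideanSpace ℝ (Fin 5)) := hy.smooth.continuous
  have hopen : IsOpen {q : M | g (y q) 2 ≠ 0} :=
    isOpen_ne_fun ((EuclideanSpace.proj (𝕜 := ℝ) 2).continuous.comp (hgs.continuous.comp hyc))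
      continuous_const
  obtain ⟨T, hT⟩ := exists_moebius A hA
  have hne : ∀ q, g (y q) 2 ≠ 0 → g (y q) ≠ 0 := fun q hq h0 => hq (by rw [h0]; rfl)
  classical
  -- The default value is never attained on the neighbourhood chosen below, where `g (y q) 2 ≠ 0`.
  let ψ : M → S2 := fun q => if hq : g (y q) ≠ 0 then
    ⟨‖g (y q)‖⁻¹ • g (y q), by
      rw [mem_sphere_zero_iff_norm, norm_smul, norm_inv, norm_norm,
        inv_mul_cancel₀ (norm_ne_zero_iff.2 hq)]⟩
    else ⟨EuclideanSpace.single 0 1, by simp⟩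
  have hψ : ∀ q, g (y q) 2 ≠ 0 → (ψ q : EuclideanSpace ℝ (Fin 3)) = ‖g (y q)‖⁻¹ • g (y q) := by
    intro q hq
    simp only [ψ, dif_pos (hne q hq)]
  refine ⟨(e.source ∩ e ⁻¹' Metric.ball (e p) r) ∩ {q | g (y q) 2 ≠ 0},
    (e.isOpen_inter_preimage Metric.isOpen_ball).inter hopen,
    ⟨⟨hp, Metric.mem_ball_self hr⟩, hpole⟩, T, ⟨A, hA, fun x => ⟨_, (hT x).1, (hT x).2⟩⟩, ψ, ?_, ?_⟩
  · refine ContMDiffOn.congr (f := fun q => ‖g (y q)‖⁻¹ • g (y q)) ?_ fun q hq => hψ q hq.2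
    intro q hq
    have h1 : ContDiffAt ℝ ∞ (fun x => ‖g x‖⁻¹ • g x) (y q) :=
      ((hgs.contDiffAt.norm ℝ (hne q hq.2)).inv (norm_ne_zero_iff.2 (hne q hq.2))).smul
        hgs.contDiffAt
    exact (h1.contMDiffAt.comp q (hy.smooth q)).contMDiffWithinAt
  · rintro q ⟨⟨hq1, hq2⟩, hq3⟩
    obtain ⟨τ, x, hx⟩ := hτ (e q) hq2
    rw [hu q hq1] at hx
    refine Subtype.ext ?_
    ext i
    change (T (y q) : EuclideanSpace ℝ (Fin 5)) i = veroneseVec (ψ q) i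
    rw [hψ q hq3]
    refine (?_ : _ = _).trans (veroneseVec_verPole hx hq3 i).symm
    rw [eq_div_iff (hT (y q)).1, mul_comm]
    exact (congrFun (hT (y q)).2 i.succ).symm

/-- The equation is local, so it suffices to restrict the coordinate to the part lying over the
neighbourhood where the Veronese representation holds. -/
theorem dzbar_dlogKappa_of_isLocallyVeronese {y : M → S4} (hy : IsConformalImmersion y)
    (hiso : IsIsotropic y) (humb : HasNoUmbilics y) (hV : IsLocallyVeronese y)
    {e : OpenPartialHomeomorph M ℂ} (he : e ∈ IsManifold.maximalAtlas 𝓘(ℂ) ω M) {z : ℂ}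
    (hz : z ∈ e.target) : dzbar (dlogKappa (localExpr y e)) z = -kappaSqC (localExpr y e) z := by
  obtain ⟨U, hU, hzU, T, ⟨A, hA, hAT⟩, ψ, hψ, hTψ⟩ := hV (e.symm z)
  have h := (isIsotropicPatch_localExpr hy hiso humb he).mono (e.isOpen_inter_preimage_symm hU)
    Set.inter_subset_left
  refine h.dzbar_dlogKappa_of_veronese hA (smoothOn_comp_symm hψ hU he) (fun z _ => by simp)
    (fun z hz => ?_) ⟨hz, hzU⟩
  obtain ⟨r, hr, hx⟩ := hAT (y (e.symm z))
  rw [hTψ _ hz.2] at hx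
  exact ⟨r, hr, hx⟩

end Surface

end MoebiusGeometry

theorem mainTheorem4 {M : Type*} [TopologicalSpace M] [ChartedSpace ℂ M] [IsManifold 𝓘(ℂ) ω M]
    (y : M → MoebiusGeometry.S4)
    (hy : MoebiusGeometry.IsConformalImmersion y)
    (hiso : MoebiusGeometry.IsIsotropic y)
    (humb : MoebiusGeometry.HasNoUmbilics y) :
    List.TFAE [
      ∃ c : ℝ, c ≠ 0 ∧ MoebiusGeometry.InCoordinates y
        (fun u z => ‖MoebiusGeometry.invP u z‖ = c),
      MoebiusGeometry.InCoordinates y (fun u z => MoebiusGeometry.moebiusCurvature u z = 1 / 2),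
      MoebiusGeometry.IsLocallyVeronese y] ∧
    (MoebiusGeometry.IsLocallyVeronese y →
      MoebiusGeometry.InCoordinates y (fun u z => MoebiusGeometry.invP u z = -3)) := by
  have key : MoebiusGeometry.IsLocallyVeronese y →
      MoebiusGeometry.InCoordinates y (fun u z => MoebiusGeometry.invP u z = -3) :=
    fun hV e he z hz =>
      (MoebiusGeometry.isIsotropicPatch_localExpr hy hiso humb he).invP_eq (fun z hz =>
        MoebiusGeometry.dzbar_dlogKappa_of_isLocallyVeronese hy hiso humb hV he hz) hz
  refine ⟨?_, key⟩
  tfae_have 1 → 2 := fun ⟨c, hc, hP⟩ e he z hz =>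
    (MoebiusGeometry.isIsotropicPatch_localExpr hy hiso humb he).moebiusCurvature_of_norm_invP hc
      (hP e he) hz
  tfae_have 2 → 3 := MoebiusGeometry.isLocallyVeronese_of_curvature hy hiso humb
  tfae_have 3 → 1 := fun hV => ⟨3, three_ne_zero, fun e he z hz => by
    beta_reduce
    rw [key hV e he z hz, norm_neg, Complex.norm_ofNat]⟩
  tfae_finish
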